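/- All matrices are complex. A square rational (or polynomial) matrix $M(\lambda)$ is $T$-odd if $M(-\lambda)^T=-M(\lambda)$. **Data.** Let $G(\lambda)$ be an $n\times n$ $T$-odd (skew-Hamiltonian) rational matrix with a minimal realization $G(\lambda)=P(\lambda)+B^T(\lambda I_r-A)^{-1}B$, where $P(\lambda)=\sum_{j=0}^m\lambda^jA_j$ with $A_m\neq0$, and $P(\lambda)$ and $\lambda I_r-A$ are $T$-odd. Minimal means that $r$ is the smallest possible size among all realizations $P'(\lambda)+C'(\lambda E'-A')^{-1}B'$ of $G(\lambda)$ with $P'$ polynomial and $E'$ nonsingular. Let $\mathcal S(\lambda)=\begin{bmatrix}P(\lambda)&-B^T\\B&\lambda I_r-A\end{bmatrix}$. **Fiedler matrices.** For $X\in\mathbb C^{n\times n}$ and $1\le i\le m-1$ put $M_0(X)=I_{(m-1)n}\oplus X$, $M_{-m}(X)=X\oplus I_{(m-1)n}$, $M_i(X)=I_{(m-i-1)n}\oplus\begin{bmatrix}X&I_n\\I_n&0\end{bmatrix}\oplus I_{(i-1)n}$ and $M_{-i}(X)=I_{(m-i-1)n}\oplus\begin{bmatrix}0&I_n\\I_n&X\end{bmatrix}\oplus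 I_{(i-1)n}$. Let $M_i^P=M_i(-A_i)$ for $0\le i\le m-1$, $M_{-i}^P=M_{-i}(A_i)$ for $1\le i\le m$, and $\mathbb M_i^P=M_i^P\oplus I_r$. Let $\mathbb M_0^{\mathcal S}=\begin{bmatrix}M_0^P&e_m\otimes B^T\\-e_m^T\otimes B&A\end{bmatrix}$, $\mathbb M_{-m}^{\mathcal S}=M_{-m}^P\oplus I_r$ and $\mathbb M_i^{\mathcal S}=\mathbb M_i^P$ for all other $i$. For an index tuple $\mathbf t=(t_1,\dots,t_k)$ write $M_{\mathbf t}=M_{t_1}\cdots M_{t_k}$, and similarly for the other families. **Index tuples.** The admissible tuple of $\{0:k\}$ with index $p$ ($0\le p\le k$, $k-p$ even) is $\mathbf v=(k-1,k,\;k-3,k-2,\;\dots,\;p+1,p+2,\;0,1,\dots,p)$, and $\mathrm{Ind}(\mathbf v)=p$. It is simple if $p\in\{0,1\}$. Its symmetric complement is $(k-1,k-3,\dots,p+1)$ followed by the strings $(0:p-1),(0:p-2),\dots,(0:0)$, where $(0:j)=(0,1,\dots,j)$ and there are no such strings if $p=0$. Let $0\le h\le m-1$ be even, let $\mathbf w$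 be the simple admissible tuple of $\{0:h\}$, and let $\mathbf c_w$ be its symmetric complement. Let $\mathbf z+m$ be any admissible tuple of $\{0:m-h-1\}$, with symmetric complement $\mathbf c_z+m$. Let $i_0(\mathbf w)$ be the largest $s$ such that $(s,s-1,\dots,0)$ is a subtuple of $\mathbf w$. **Pencils.** Put $L(\lambda)=(\lambda M^P_{\mathbf z}-M^P_{\mathbf w})M^P_{\mathbf c_w}M^P_{\mathbf c_z}$ and $\mathbb L(\lambda)=(\lambda\mathbb M^{\mathcal S}_{\mathbf z}-\mathbb M^{\mathcal S}_{\mathbf w})\mathbb M^P_{\mathbf c_w}\mathbb M^P_{\mathbf c_z}$. A quasi-identity matrix is $Q=\epsilon_1I_n\oplus\cdots\oplus\epsilon_mI_n$ with parameters $\epsilon_i\in\{\pm1\}$. **Definition.** An $(mn+r)\times(mn+r)$ irreducible system matrix $\mathbb T(\lambda)=\begin{bmatrix}\mathcal X-\lambda\mathcal Y&\mathcal C\\\mathcal B&H-\lambda K\end{bmatrix}$ with $K$ ($r\times r$) nonsingular is a Rosenbrock strong linearization of $G(\lambda)$ if (a) and (b) hold. Irreducible means that the realization $\mathbb G_{\mathbb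 T}(\lambda)=\mathcal X-\lambda\mathcal Y+\mathcal C(\lambda K-H)^{-1}\mathcal B$ of its transfer function is minimal. (a) There are unimodular $U(\lambda),V(\lambda)$ and nonsingular constant $U_0,V_0$ with $\mathrm{diag}(U(\lambda),U_0)\,\mathbb T(\lambda)\,\mathrm{diag}(V(\lambda),V_0)=\mathrm{diag}(I_{(m-1)n},\mathcal S(\lambda))$. (b) There are $\mathcal O_\ell(\lambda),\mathcal O_r(\lambda)$, biproper (having a nonsingular limit as $\lambda\to\infty$), with $\mathcal O_\ell(\lambda)\,\lambda^{-1}\mathbb G_{\mathbb T}(\lambda)\,\mathcal O_r(\lambda)=\mathrm{diag}(I_{(m-1)n},\lambda^{-m}G(\lambda))$. **Theorem.** Let $k=m-i_0(\mathbf w)$; then $1\le k\le m$. There is a quasi-identity matrix $Q$, unique up to sign, such that $QL(\lambda)$ is $T$-odd. Let $\mathbf s$ be the $k$-th parameter of $Q$ and $\mathbb Q=\mathrm{diag}(\mathbf sQ,I_r)$. Then $$\mathbb Q\mathbb L(\lambda)=\begin{bmatrix}\mathbf sQL(\lambda)&-e_k\otimes B^T\\e_k^T\otimes B&\lambda I_r-A\end{bmatrix}$$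 is $T$-odd. Moreover, $\mathbb Q$ is the only matrix of the form $\mathrm{diag}(\mathbf s'Q',I_r)$, with $Q'$ a quasi-identity matrix and $\mathbf s'$ its $k$-th parameter, for which $\mathrm{diag}(\mathbf s'Q',I_r)\mathbb L(\lambda)$ is $T$-odd. If $r>0$, it is the only matrix of the form $\mathrm{diag}(Q',I_r)$, with $Q'$ a quasi-identity matrix, for which $\mathrm{diag}(Q',I_r)\mathbb L(\lambda)$ is $T$-odd. If $A_m$ is nonsingular or $\mathrm{Ind}(\mathbf z+m)=0$, then $\mathbb Q\mathbb L(\lambda)$ is a Rosenbrock strong linearization of $G(\lambda)$. The transfer function $\mathbb G(\lambda)=\mathbf sQL(\lambda)+(e_k\otimes B^T)(\lambda I_r-A)^{-1}(e_k^T\otimes B)$ of $\mathbb Q\mathbb L(\lambda)$ is $T$-odd. -/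

import Mathlib

open Polynomial Matrix

/-! ### Substitution `λ ↦ -λ` and `T`-odd matrices -/

/-- The automorphism `f(λ) ↦ f(-λ)` of the field of rational functions. -/
noncomputable def negSubst : RatFunc ℂ →+* RatFunc ℂ :=
  RatFunc.mapRingHom (Polynomial.algEquivAevalNegX (R := ℂ))
    (nonZeroDivisors_le_comap_nonZeroDivisors_of_injective _
      (Polynomial.algEquivAevalNegX (R := ℂ)).injective)

/-- A matrix polynomial `M(λ)` is `T`-odd if `M(-λ)ᵀ = -M(λ)`. -/
def IsTOddPoly {ι : Type} (M : Matrix ι ι ℂ[X]) : Prop :=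
  Mᵀ.map (fun f => f.comp (-X)) = -M

/-- A rational matrix `G(λ)` is `T`-odd (skew-Hamiltonian) if `G(-λ)ᵀ = -G(λ)`. -/
def IsTOddRat {ι : Type} (G : Matrix ι ι (RatFunc ℂ)) : Prop :=
  Gᵀ.map negSubst = -G

/-! ### Constant, polynomial and rational matrices -/

/-- A constant matrix, viewed as a matrix polynomial. -/
noncomputable def constPoly {ι κ : Type} (M : Matrix ι κ ℂ) : Matrix ι κ ℂ[X] :=
  M.map Polynomial.C

/-- A constant matrix, viewed as a rational matrix. -/
noncomputable def constRat {ι κ : Type} (M : Matrix ι κ ℂ) : Matrix ι κ (RatFunc ℂ) :=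
  M.map RatFunc.C

/-- A matrix polynomial, viewed as a rational matrix. -/
noncomputable def polyRat {ι κ : Type} (M : Matrix ι κ ℂ[X]) : Matrix ι κ (RatFunc ℂ) :=
  M.map (algebraMap ℂ[X] (RatFunc ℂ))

/-- The matrix polynomial `P(λ) = ∑_{j=0}^m λ^j A_j`. -/
noncomputable def matPoly {n : ℕ} (m : ℕ) (Ac : ℕ → Matrix (Fin n) (Fin n) ℂ) :
    Matrix (Fin n) (Fin n) ℂ[X] :=
  ∑ j ∈ Finset.range (m + 1), (X ^ j : ℂ[X]) • constPoly (Ac j)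

/-- The pencil `λ Y + Z` of constant matrices. -/
noncomputable def pencil {ι κ : Type} (Y Z : Matrix ι κ ℂ) : Matrix ι κ ℂ[X] :=
  (X : ℂ[X]) • constPoly Y + constPoly Z

/-- A matrix polynomial is unimodular if its determinant is a nonzero constant. -/
def IsUnimodular {ι : Type} [Fintype ι] [DecidableEq ι] (U : Matrix ι ι ℂ[X]) : Prop :=
  ∃ c : ℂ, c ≠ 0 ∧ U.det = Polynomial.C c

/-- A rational matrix `F` is biproper if `F(λ)` tends, as `|λ| → ∞`, to a nonsingular matrix. -/
def IsBiproper {ι : Type} [Fintype ι] [DecidableEq ι] (F : Matrix ι ι (RatFunc ℂ)) : Prop :=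
  ∃ D : Matrix ι ι ℂ, D.det ≠ 0 ∧ ∀ i j,
    Filter.Tendsto (fun x : ℂ => RatFunc.eval (RingHom.id ℂ) x (F i j))
      (Bornology.cobounded ℂ) (nhds (D i j))

/-! ### System matrices, realizations, minimality -/

/-- The data `P(λ), C, B, A, E` of a system matrix `[P(λ), C; B, A - λE]`. -/
structure SystemMatrix (ι ρ : Type) where
  P : Matrix ι ι ℂ[X]
  C : Matrix ι ρ ℂ
  B : Matrix ρ ι ℂ
  A : Matrix ρ ρ ℂ
  E : Matrix ρ ρ ℂ

namespace SystemMatrix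

/-- The matrix polynomial `[P(λ), C; B, A - λE]`. -/
noncomputable def toMatrix {ι ρ : Type} (S : SystemMatrix ι ρ) :
    Matrix (ι ⊕ ρ) (ι ⊕ ρ) ℂ[X] :=
  Matrix.fromBlocks S.P (constPoly S.C) (constPoly S.B) (pencil (-S.E) S.A)

/-- The transfer function `P(λ) + C (λE - A)⁻¹ B`. -/
noncomputable def transfer {ι ρ : Type} [Fintype ρ] [DecidableEq ρ] (S : SystemMatrix ι ρ) :
    Matrix ι ι (RatFunc ℂ) :=
  polyRat S.P + constRat S.C * (polyRat (pencil S.E (-S.A)))⁻¹ * constRat S.B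

/-- `S` is a realization of `G`: `E` is nonsingular and `G(λ) = P(λ) + C (λE - A)⁻¹ B`. -/
def IsRealization {ι ρ : Type} [Fintype ρ] [DecidableEq ρ] (S : SystemMatrix ι ρ)
    (G : Matrix ι ι (RatFunc ℂ)) : Prop :=
  S.E.det ≠ 0 ∧ S.transfer = G

/-- `S` is a minimal realization of `G`: the size `r` of the pencil `λE - A` is the smallest
among all the realizations of `G`. -/
def IsMinimalRealization {ι : Type} {r : ℕ} (S : SystemMatrix ι (Fin r))
    (G : Matrix ι ι (RatFunc ℂ)) : Prop :=
  S.IsRealization G ∧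
    ∀ (r' : ℕ) (T : SystemMatrix ι (Fin r')), T.IsRealization G → r ≤ r'

/-- A system matrix is irreducible if the realization of its transfer function is minimal. -/
def IsIrreducible {ι : Type} {r : ℕ} (S : SystemMatrix ι (Fin r)) : Prop :=
  S.IsMinimalRealization S.transfer

end SystemMatrix

/-! ### Block matrices

An `mn × mn` matrix is indexed by `Fin m × Fin n`: the first component is the (0-based) number of
the block. The integers `k` below count blocks from `1` to `m`. -/

/-- `e_k ⊗ C`, where `e_k` is the `k`-th column of the `m × m` identity matrix. -/
def blockCol {R : Type} [Zero R] {n r : ℕ} (m : ℕ) (k : ℤ) (C : Matrix (Fin n) (Fin r) R) :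
    Matrix (Fin m × Fin n) (Fin r) R :=
  Matrix.of fun a b => if ((a.1 : ℕ) : ℤ) + 1 = k then C a.2 b else 0

/-- `e_kᵀ ⊗ B`, where `e_k` is the `k`-th column of the `m × m` identity matrix. -/
def blockRow {R : Type} [Zero R] {n r : ℕ} (m : ℕ) (k : ℤ) (B : Matrix (Fin r) (Fin n) R) :
    Matrix (Fin r) (Fin m × Fin n) R :=
  Matrix.of fun b a => if ((a.1 : ℕ) : ℤ) + 1 = k then B b a.2 else 0

/-- The `n × n` block in block position `(s, t)` (0-based) of the elementary matrix `M_i(X)`. -/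
def elemBlock {R : Type} [Zero R] [One R] {n : ℕ} (m : ℕ) (i : ℤ) (X : Matrix (Fin n) (Fin n) R)
    (s t : ℕ) : Matrix (Fin n) (Fin n) R :=
  if i = 0 then
    if s = t then (if s + 1 = m then X else 1) else 0
  else if i = -(m : ℤ) then
    if s = t then (if s = 0 then X else 1) else 0
  else
    -- the special `2 × 2` block sits in the block rows and columns `m - |i|` and `m - |i| + 1`
    let k := m - i.natAbs
    if s + 1 = k ∧ t + 1 = k then (if 0 < i then X else 0)
    else if s = k ∧ t = k then (if 0 < i then 0 else X)
    else if (s + 1 = k ∧ t = k) ∨ (s = k ∧ t + 1 = k) then 1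
    else if s = t then 1 else 0

/-- The elementary matrices `M_i(X)`, for `i ∈ {-m : m-1}`:
`M_0(X) = I_{(m-1)n} ⊕ X`, `M_{-m}(X) = X ⊕ I_{(m-1)n}`, and for `1 ≤ i ≤ m-1`
`M_i(X) = I_{(m-i-1)n} ⊕ [X, I; I, 0] ⊕ I_{(i-1)n}`,
`M_{-i}(X) = I_{(m-i-1)n} ⊕ [0, I; I, X] ⊕ I_{(i-1)n}`. -/
def elemM {R : Type} [Zero R] [One R] {n : ℕ} (m : ℕ) (i : ℤ) (X : Matrix (Fin n) (Fin n) R) :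
    Matrix (Fin m × Fin n) (Fin m × Fin n) R :=
  Matrix.of fun a b => elemBlock m i X a.1 b.1 a.2 b.2

/-- The matrix `I_{(m-1)n} ⊕ X`. -/
def idOplus {R : Type} [Zero R] [One R] {n : ℕ} (m : ℕ) (X : Matrix (Fin n) (Fin n) R) :
    Matrix (Fin m × Fin n) (Fin m × Fin n) R :=
  Matrix.of fun a b =>
    if a.1 = b.1 then
      if (a.1 : ℕ) + 1 = m then X a.2 b.2 else (1 : Matrix (Fin n) (Fin n) R) a.2 b.2
    else 0

/-- The matrix `I_{(m-1)n} ⊕ S(λ)` for a system matrix `S(λ)`; its rows and columns are split as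
`mn + r`, so that `P(λ)` is in the last of the `m` diagonal `n × n` blocks. -/
noncomputable def idOplusSystem {n r : ℕ} (m : ℕ) (S : SystemMatrix (Fin n) (Fin r)) :
    Matrix ((Fin m × Fin n) ⊕ Fin r) ((Fin m × Fin n) ⊕ Fin r) ℂ[X] :=
  Matrix.fromBlocks (idOplus m S.P) (constPoly (blockCol m m S.C))
    (constPoly (blockRow m m S.B)) (pencil (-S.E) S.A)

/-- The matrix `diag(U, V)`. -/
def blockDiag2 {R ι ρ : Type} [Zero R] (U : Matrix ι ι R) (V : Matrix ρ ρ R) :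
    Matrix (ι ⊕ ρ) (ι ⊕ ρ) R :=
  Matrix.fromBlocks U 0 0 V

/-! ### Rosenbrock strong linearizations -/

/-- The `(mn+r) × (mn+r)` matrix polynomial `L(λ)` is a Rosenbrock strong linearization of the
rational matrix `G(λ)` with system matrix `S(λ)`: it is an irreducible system matrix
`[𝒳 - λ𝒴, 𝒞; ℬ, H - λK]` with `K` nonsingular,
(a) `diag(U(λ), U₀) L(λ) diag(V(λ), V₀) = diag(I_{(m-1)n}, S(λ))` for some unimodular `U`, `V` and
some nonsingular constant `U₀`, `V₀`;
(b) `O_ℓ(λ) λ⁻¹ 𝔾(λ) O_r(λ) = diag(I_{(m-1)n}, λ^{-m} G(λ))` for some biproper `O_ℓ`, `O_r`, where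
`𝔾(λ)` is the transfer function of `L(λ)`. -/
def IsRosenbrockStrongLinearization {n m r : ℕ}
    (L : Matrix ((Fin m × Fin n) ⊕ Fin r) ((Fin m × Fin n) ⊕ Fin r) ℂ[X])
    (S : SystemMatrix (Fin n) (Fin r)) (G : Matrix (Fin n) (Fin n) (RatFunc ℂ)) : Prop :=
  ∃ T : SystemMatrix (Fin m × Fin n) (Fin r),
    T.toMatrix = L ∧
    (∃ 𝒳 𝒴 : Matrix (Fin m × Fin n) (Fin m × Fin n) ℂ, T.P = pencil (-𝒴) 𝒳) ∧
    T.E.det ≠ 0 ∧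
    T.IsIrreducible ∧
    (∃ (U V : Matrix (Fin m × Fin n) (Fin m × Fin n) ℂ[X]) (U₀ V₀ : Matrix (Fin r) (Fin r) ℂ),
      IsUnimodular U ∧ IsUnimodular V ∧ U₀.det ≠ 0 ∧ V₀.det ≠ 0 ∧
      blockDiag2 U (constPoly U₀) * L * blockDiag2 V (constPoly V₀) = idOplusSystem m S) ∧
    (∃ Ol Or : Matrix (Fin m × Fin n) (Fin m × Fin n) (RatFunc ℂ),
      IsBiproper Ol ∧ IsBiproper Or ∧
      Ol * ((RatFunc.X : RatFunc ℂ)⁻¹ • T.transfer) * Or =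
        idOplus m (((RatFunc.X : RatFunc ℂ) ^ m)⁻¹ • G))

/-! ### Fiedler matrices -/

/-- The Fiedler matrices `M^P_i` of `P(λ) = ∑ λ^j A_j`: `M_i(-A_i)` for `i ≥ 0` and
`M_i(A_{-i})` for `i < 0`. -/
def fiedlerP {R : Type} [Ring R] {n : ℕ} (m : ℕ) (Ac : ℕ → Matrix (Fin n) (Fin n) R) (i : ℤ) :
    Matrix (Fin m × Fin n) (Fin m × Fin n) R :=
  if 0 ≤ i then elemM m i (-Ac i.natAbs) else elemM m i (Ac i.natAbs)

/-- The matrices `𝕄^P_i = diag(M^P_i, I_r)`. -/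
def fiedlerPExt {R : Type} [Ring R] {n : ℕ} (m r : ℕ) (Ac : ℕ → Matrix (Fin n) (Fin n) R)
    (i : ℤ) : Matrix ((Fin m × Fin n) ⊕ Fin r) ((Fin m × Fin n) ⊕ Fin r) R :=
  blockDiag2 (fiedlerP m Ac i) 1

/-- The Fiedler matrices `𝕄^S_i`, `i ∈ {-m : m-1}`, of the system matrix `[P(λ), C; B, A - λE]`
with `P(λ) = ∑_{j=0}^m λ^j A_j`. For `1 ≤ i ≤ m-1` both `diag(M^P_i, I_r)` and its inverse
`diag(M^P_{-i}, I_r)` are of the last form. -/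
def fiedlerS {R : Type} [Ring R] {n r : ℕ} (m : ℕ) (Ac : ℕ → Matrix (Fin n) (Fin n) R)
    (C : Matrix (Fin n) (Fin r) R) (B : Matrix (Fin r) (Fin n) R) (A E : Matrix (Fin r) (Fin r) R)
    (i : ℤ) : Matrix ((Fin m × Fin n) ⊕ Fin r) ((Fin m × Fin n) ⊕ Fin r) R :=
  if i = 0 then
    Matrix.fromBlocks (fiedlerP m Ac 0) (-blockCol m m C) (-blockRow m m B) (-A)
  else if i = -(m : ℤ) then
    blockDiag2 (fiedlerP m Ac i) (-E)
  else
    blockDiag2 (fiedlerP m Ac i) 1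

/-- `M_𝐭 = M_{t_1} M_{t_2} ⋯ M_{t_k}` for an index tuple `𝐭 = (t_1, …, t_k)`. -/
def tupleProd {R κ : Type} [Ring R] [Fintype κ] [DecidableEq κ] (M : ℤ → Matrix κ κ R)
    (t : List ℤ) : Matrix κ κ R :=
  (t.map M).prod

/-! ### Index tuples -/

/-- The tuple `𝐭 + k`. -/
def shiftTuple (k : ℤ) (t : List ℤ) : List ℤ := t.map (· + k)

/-- The tuple `(h-1:h, h-3:h-2, …, p+1:p+2, 0:p)`. -/
def admissibleTuple (h p : ℕ) : List ℤ :=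
  ((List.range ((h - p) / 2)).flatMap fun l : ℕ =>
    [(h : ℤ) - 2 * (l : ℤ) - 1, (h : ℤ) - 2 * (l : ℤ)]) ++
  (List.range (p + 1)).map fun l : ℕ => (l : ℤ)

/-- `w` is the admissible tuple of `{0:h}` with index `Ind(w) = p`
(in column standard form). -/
def IsAdmissibleTuple (h p : ℕ) (w : List ℤ) : Prop :=
  p ≤ h ∧ Even (h - p) ∧ w = admissibleTuple h p

/-- The symmetric complement `(h-1, h-3, …, p+1, 0:p-1, 0:p-2, …, 0:1, 0)` of the admissible tuple
of `{0:h}` with index `p`; it is `(h-1, h-3, …, 1)` if `p = 0`, and empty if `h = 0`. -/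
def symmComplement (h p : ℕ) : List ℤ :=
  ((List.range ((h - p) / 2)).map fun l : ℕ => (h : ℤ) - 2 * (l : ℤ) - 1) ++
  (List.range p).flatMap fun l : ℕ => (List.range (p - l)).map fun j : ℕ => (j : ℤ)

/-- The number `i_t(α)` of consecutive inversions of the tuple `α` at `t`: the largest `s` such that
`(t+s, …, t+1, t)` is a subtuple of `α`, and `-1` if `t ∉ α`. -/
def inversionsAt (t : ℤ) (α : List ℤ) : ℤ :=
  if t ∈ α then
    (Nat.findGreatest
      (fun s => List.Sublist ((List.range (s + 1)).reverse.map fun j : ℕ => t + (j : ℤ)) α)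
      α.length : ℤ)
  else -1

/-! ### Quasi-identity matrices -/

/-- The quasi-identity matrix `ε_1 I_n ⊕ ⋯ ⊕ ε_m I_n` with parameters `ε_i ∈ {1, -1}`. -/
def quasiIdentity (n : ℕ) {m : ℕ} (ε : Fin m → ℤˣ) :
    Matrix (Fin m × Fin n) (Fin m × Fin n) ℂ :=
  Matrix.diagonal fun a => (((ε a.1 : ℤˣ) : ℤ) : ℂ)

/-! ### The pencils -/

/-- The pencil `L(λ) = (λ M^P_z - M^P_w) M^P_{c_w} M^P_{c_z}`. -/
noncomputable def gfprP {n : ℕ} (m : ℕ) (Ac : ℕ → Matrix (Fin n) (Fin n) ℂ)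
    (w cw z cz : List ℤ) : Matrix (Fin m × Fin n) (Fin m × Fin n) ℂ[X] :=
  pencil (tupleProd (fiedlerP m Ac) z) (-tupleProd (fiedlerP m Ac) w) *
    constPoly (tupleProd (fiedlerP m Ac) cw) * constPoly (tupleProd (fiedlerP m Ac) cz)

/-- The pencil `𝕃(λ) = (λ 𝕄^S_z - 𝕄^S_w) 𝕄^P_{c_w} 𝕄^P_{c_z}` associated with the system matrix
`[P(λ), C; B, A - λE]`, where `P(λ) = ∑_{j=0}^m λ^j A_j`. -/
noncomputable def gfprS {n r : ℕ} (m : ℕ) (Ac : ℕ → Matrix (Fin n) (Fin n) ℂ)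
    (C : Matrix (Fin n) (Fin r) ℂ) (B : Matrix (Fin r) (Fin n) ℂ) (A E : Matrix (Fin r) (Fin r) ℂ)
    (w cw z cz : List ℤ) :
    Matrix ((Fin m × Fin n) ⊕ Fin r) ((Fin m × Fin n) ⊕ Fin r) ℂ[X] :=
  pencil (tupleProd (fiedlerS m Ac C B A E) z) (-tupleProd (fiedlerS m Ac C B A E) w) *
    constPoly (tupleProd (fiedlerPExt m r Ac) cw) * constPoly (tupleProd (fiedlerPExt m r Ac) cz)

/-- The matrix `diag(δ Q, I_r)`, where `Q` is the quasi-identity matrix with parameters `ε` and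
`δ ∈ {1, -1}`. -/
noncomputable def extQuasiIdentity (n r : ℕ) {m : ℕ} (δ : ℤˣ) (ε : Fin m → ℤˣ) :
    Matrix ((Fin m × Fin n) ⊕ Fin r) ((Fin m × Fin n) ⊕ Fin r) ℂ :=
  blockDiag2 ((((δ : ℤˣ) : ℤ) : ℂ) • quasiIdentity n ε) 1

/-!
Write `a t = A_{m-t}` and `S` for the ring of `n × n` matrices, so that `L(λ)` is an `m × m` matrix
over `S[λ]`. Among the Fiedler factors with a coefficient in their block, those of odd index on the
positive side and their counterparts on the negative side commute pairwise, and the tuple products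
collapse to `L(λ) = O (λX' - Y') O`: the congruence factor `O` is a product of commuting invertible
elementary factors, and the core pencil `λX' - Y'` is sparse, a triangular Hankel block of size
governed by `p = Ind(z + m)` followed by a block tridiagonal part. Explicit sign patterns make
`X'` and `Y'` symmetric or skew and carry `O` to `Oᵀ`, which gives the quasi-identity matrix `Q`; it
is unique up to sign because, as `A_m ≠ 0`, a diagonal `±1` matrix that commutes with both
coefficients is scalar.

For the strong linearization, replace the last column of the identity by the Horner shifts of
`P(λ)`. The core pencil maps this column to `P(λ)` in the last place, so the pencil is reduced to
`diag(I, P(λ))` by the core pencil with last column `e_m`. The latter is unimodular since its value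
at every point has trivial kernel; this is where `p = 0` or `det A_m ≠ 0` enters. Multiplication by
`O` moves `e_m` to `e_k`. At infinity the same reduction is applied to `λ⁻¹` times the transfer
function, whose constant coefficient has acquired a strictly proper part: for `p = 0` with the
reversed Horner shifts, while for `det A_m ≠ 0` the leading coefficient is invertible and the
pencil itself is biproper. Irreducibility holds because `diag(I, G(λ))` and the transfer function
differ by unimodular factors, and a polynomial multiple of a rational matrix has a realization of
the same size, by division by `λE - A`.
-/

section BlockMatrices

variable {S : Type*}

/-- The `m × m` matrix with entries `f s r`, `0 ≤ s, r < m`. Entry functions on `ℕ × ℕ` let the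
index arithmetic be done by `omega`, and an `mn × mn` matrix is treated as an `m × m` matrix over
the ring `S` of `n × n` matrices. -/
def natMatrix (m : ℕ) (f : ℕ → ℕ → S) : Matrix (Fin m) (Fin m) S :=
  Matrix.of fun s r => f s r

@[simp] lemma natMatrix_apply (m : ℕ) (f : ℕ → ℕ → S) (s r : Fin m) :
    natMatrix m f s r = f s r := rfl

lemma natMatrix_congr {m : ℕ} {f f' : ℕ → ℕ → S} (h : ∀ s r, s < m → r < m → f s r = f' s r) :
    natMatrix m f = natMatrix m f' := by
  ext s r
  exact h s r s.2 r.2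

variable [Ring S]

/-- The entries of the identity matrix. -/
def idEntry (s r : ℕ) : S := if r = s then 1 else 0

/-- The entries of the elementary matrix with the block `[u, 1; 1, v]` in the (0-based) rows and
columns `t - 1`, `t`. -/
def elemEntry (t : ℕ) (u v : S) (s r : ℕ) : S :=
  if s + 1 = t then u * idEntry s r + idEntry (s + 1) r
  else if s = t then (if 0 < s then idEntry (s - 1) r else 0) + v * idEntry s r
  else idEntry s r

lemma natMatrix_idEntry (m : ℕ) : natMatrix m (idEntry : ℕ → ℕ → S) = 1 := by
  ext s r
  simp [idEntry, Matrix.one_apply, Fin.ext_iff, eq_comm]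

lemma sum_idEntry_mul {m : ℕ} (c : ℕ) (x : ℕ → S) :
    ∑ k : Fin m, idEntry c k * x k = if c < m then x c else 0 := by
  rw [Fin.sum_univ_eq_sum_range (fun k => idEntry c k * x k) m]
  simp [idEntry]

lemma natMatrix_elemEntry_mul (m t : ℕ) (u v : S) (f : ℕ → ℕ → S) :
    natMatrix m (elemEntry t u v) * natMatrix m f = natMatrix m (fun s r =>
      if s + 1 = t then u * f s r + (if t < m then f t r else 0)
      else if s = t then (if 0 < t then f (t - 1) r else 0) + v * f s r else f s r) := by
  ext s r
  have hs := s.2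
  have hs' : (s : ℕ) - 1 < m := by omega
  have hm : m ≠ 0 := by omega
  have hsum (c : ℕ) := sum_idEntry_mul (m := m) c (fun k => f k r)
  rw [Matrix.mul_apply]
  simp only [natMatrix_apply, elemEntry]
  split_ifs <;>
    simp_all [add_mul, mul_assoc, Finset.sum_add_distrib, ← Finset.mul_sum]

lemma commute_elemEntry (m : ℕ) {t t' : ℕ} (h : t + 2 ≤ t') (u v u' v' : S) :
    Commute (natMatrix m (elemEntry t u v)) (natMatrix m (elemEntry t' u' v')) := by
  rw [commute_iff_eq, natMatrix_elemEntry_mul, natMatrix_elemEntry_mul]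
  refine natMatrix_congr fun s r hs hr => ?_
  simp only [elemEntry, idEntry]
  grind

lemma natMatrix_elemEntry_mul_neg (m : ℕ) {t : ℕ} (h0 : 0 < t) (ht : t < m) (u : S) :
    natMatrix m (elemEntry t u 0) * natMatrix m (elemEntry t 0 (-u)) = 1 := by
  rw [natMatrix_elemEntry_mul, ← natMatrix_idEntry]
  refine natMatrix_congr fun s r _ _ => ?_
  simp only [elemEntry, idEntry]
  split_ifs <;> first | omega | simp

lemma natMatrix_elemEntry_neg_mul (m : ℕ) {t : ℕ} (h0 : 0 < t) (ht : t < m) (u : S) :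
    natMatrix m (elemEntry t 0 (-u)) * natMatrix m (elemEntry t u 0) = 1 := by
  rw [natMatrix_elemEntry_mul, ← natMatrix_idEntry]
  refine natMatrix_congr fun s r _ _ => ?_
  simp only [elemEntry, idEntry]
  split_ifs <;> first | omega | simp

end BlockMatrices

section Products

variable {M : Type*} [Monoid M]

/-- The product `F (c + 2N - 2) ⋯ F (c + 2) F c`: the commuting factors coming from every second
index of a tuple. -/
def stepTwoProd (F : ℕ → M) (c : ℕ) : ℕ → M
  | 0 => 1
  | N + 1 => F (c + 2 * N) * stepTwoProd F c N

lemma stepTwoProd_congr {F F' : ℕ → M} {c N : ℕ} (h : ∀ l < N, F (c + 2 * l) = F' (c + 2 * l)) :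
    stepTwoProd F c N = stepTwoProd F' c N := by
  induction N with
  | zero => rfl
  | succ N ih =>
    rw [stepTwoProd, stepTwoProd, h N (by omega), ih fun l hl => h l (by omega)]

lemma commute_stepTwoProd {F : ℕ → M} {x : M} {c N : ℕ}
    (h : ∀ l < N, Commute x (F (c + 2 * l))) : Commute x (stepTwoProd F c N) := by
  induction N with
  | zero => exact Commute.one_right x
  | succ N ih => exact (h N (by omega)).mul_right (ih fun l hl => h l (by omega))

lemma stepTwoProd_succ_eq_mul (F : ℕ → M) (c N : ℕ) :
    stepTwoProd F c (N + 1) = stepTwoProd F (c + 2) N * F c := by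
  induction N with
  | zero => simp [stepTwoProd]
  | succ N ih =>
    rw [stepTwoProd, ih, stepTwoProd, mul_assoc, show c + 2 * (N + 1) = c + 2 + 2 * N by ring]

lemma stepTwoProd_reflect {F : ℕ → M} (hF : ∀ i j, i + 2 ≤ j → Commute (F i) (F j))
    (m c N : ℕ) (h : c + 2 * N ≤ m + 2) :
    stepTwoProd (fun i => F (m - i)) c N = stepTwoProd F (m + 2 - c - 2 * N) N := by
  induction N with
  | zero => rfl
  | succ N ih =>
    rw [stepTwoProd, ih (by omega), stepTwoProd_succ_eq_mul,
      show m + 2 - c - 2 * (N + 1) + 2 = m + 2 - c - 2 * N by omega,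
      show m - (c + 2 * N) = m + 2 - c - 2 * (N + 1) by omega]
    exact commute_stepTwoProd fun l _ => hF _ _ (by omega)

lemma isUnit_stepTwoProd {F : ℕ → M} {c N : ℕ} (h : ∀ l < N, IsUnit (F (c + 2 * l))) :
    IsUnit (stepTwoProd F c N) := by
  induction N with
  | zero => exact isUnit_one
  | succ N ih => exact (h N (by omega)).mul (ih fun l hl => h l (by omega))

end Products

section BlockFactorization

variable {S : Type*} [Ring S]

lemma stepTwoProd_elemEntry_mul (m : ℕ) (u v : ℕ → S) (c N : ℕ) (hc : 0 < c) (f : ℕ → ℕ → S) :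
    stepTwoProd (fun t => natMatrix m (elemEntry t (u t) (v t))) c N * natMatrix m f =
      natMatrix m (fun s r =>
        if c ≤ s + 1 ∧ s + 1 < c + 2 * N then
          if (s + 1 - c) % 2 = 0 then u (s + 1) * f s r + (if s + 1 < m then f (s + 1) r else 0)
          else f (s - 1) r + v s * f s r
        else f s r) := by
  induction N with
  | zero =>
    rw [stepTwoProd, one_mul]
    refine natMatrix_congr fun s r _ _ => ?_
    rw [if_neg (by omega)]
  | succ N ih =>
    rw [stepTwoProd, mul_assoc, ih, natMatrix_elemEntry_mul]
    refine natMatrix_congr fun s r _ _ => ?_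
    grind

lemma stepTwoProd_elemEntry (m : ℕ) (u v : ℕ → S) (c N : ℕ) (hc : 0 < c) :
    stepTwoProd (fun t => natMatrix m (elemEntry t (u t) (v t))) c N = natMatrix m (fun s r =>
      if c ≤ s + 1 ∧ s + 1 < c + 2 * N then
        if (s + 1 - c) % 2 = 0 then
          u (s + 1) * idEntry s r + (if s + 1 < m then idEntry (s + 1) r else 0)
        else idEntry (s - 1) r + v s * idEntry s r
      else idEntry s r) := by
  rw [← stepTwoProd_elemEntry_mul m u v c N hc, natMatrix_idEntry, mul_one]

variable (m : ℕ) (a : ℕ → S)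

/-- The Fiedler matrix `M^P_{m-t}`, `0 < t ≤ m`, where `a t = A_{m-t}`. The special block is then in
the rows and columns `t - 1`, `t`, truncated to the block row `m - 1` if `t = m`. -/
def posFactor (t : ℕ) : Matrix (Fin m) (Fin m) S := natMatrix m (elemEntry t (-a t) 0)

/-- The Fiedler matrix `M^P_{-(m-t)}`, `0 ≤ t < m`, where `a t = A_{m-t}`. -/
def negFactor (t : ℕ) : Matrix (Fin m) (Fin m) S := natMatrix m (elemEntry t 0 (a t))

/-- For `m = g + 1 + 2H`: the product `M^P_{2H-1} ⋯ M^P_3 M^P_1` of the odd factors of the simple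
admissible tuple `𝐰` of `{0:2H}`, which is also `M^P_{𝐜_w}`. -/
def posOdd (g H : ℕ) : Matrix (Fin m) (Fin m) S := stepTwoProd (posFactor m a) (g + 2) H

/-- For `m = g + 1 + 2H`: the product of the even factors `M^P_0, M^P_2, …, M^P_{2H}` of `𝐰`. -/
def posEven (g H : ℕ) : Matrix (Fin m) (Fin m) S := stepTwoProd (posFactor m a) (g + 1) (H + 1)

/-- The product of the factors `M^P_{i-m}`, `i = p+1, p+3, …, p+2Z-1`, shared by the tuple `𝐳` with
`Ind(𝐳 + m) = p` and its symmetric complement. -/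
def negOdd (p Z : ℕ) : Matrix (Fin m) (Fin m) S := stepTwoProd (negFactor m a) (p + 1) Z

/-- The product of the factors `M^P_{i-m}`, `i = p+2, p+4, …, p+2Z`, of the tuple `𝐳` with
`Ind(𝐳 + m) = p`. -/
def negEven (p Z : ℕ) : Matrix (Fin m) (Fin m) S := stepTwoProd (negFactor m a) (p + 2) Z

/-- The entries of the lower triangular Hankel matrix of size `p` with `a 0` on the antidiagonal,
extended by the identity; `M^P_{(0:p-1)-m} M^P_{(0:p-2)-m} ⋯ M^P_{(0:0)-m}` is of this form. -/
def hankelEntry (p s r : ℕ) : S :=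
  if s < p ∧ r < p then (if p ≤ s + r + 1 then a (s + r + 1 - p) else 0) else idEntry s r

/-- The entries of the leading coefficient of the core pencil, to which `L(λ)` is congruent: a
triangular Hankel matrix of size `p + 1` followed by a tridiagonal part. -/
def leadEntry (p s r : ℕ) : S :=
  if s ≤ p ∧ r ≤ p then (if p ≤ s + r then a (s + r - p) else 0)
  else if s ≤ p ∨ r ≤ p then 0
  else if (s - p) % 2 = 0 then (if r = s then a s else if r + 1 = s then 1 else 0)
  else if r = s + 1 then 1 else 0

/-- The entries of the negative of the constant coefficient of the core pencil. -/
def constEntry (p s r : ℕ) : S :=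
  if s < p ∧ r < p then (if p ≤ s + r + 1 then a (s + r + 1 - p) else 0)
  else if s < p ∨ r < p then 0
  else if (s - p) % 2 = 0 then (if r = s then -a (s + 1) else if r = s + 1 then 1 else 0)
  else if r + 1 = s then 1 else 0

lemma posOdd_mul_leadEntry {p Z H g : ℕ} (hg : g = p + 2 * Z) (hm : m = g + 1 + 2 * H) :
    posOdd m a g H * natMatrix m (leadEntry a p) =
      negEven m a p Z * natMatrix m (hankelEntry a (p + 1)) := by
  unfold posOdd negEven posFactor negFactor
  rw [stepTwoProd_elemEntry_mul _ _ _ _ _ (by omega),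
    stepTwoProd_elemEntry_mul _ _ _ _ _ (by omega)]
  refine natMatrix_congr fun s r hs hr => ?_
  simp only [leadEntry, hankelEntry, idEntry, mul_ite, mul_zero, mul_one, zero_mul]
  grind

lemma negOdd_mul_constEntry {p Z H g : ℕ} (hg : g = p + 2 * Z) (hm : m = g + 1 + 2 * H) :
    negOdd m a p Z * natMatrix m (constEntry a p) =
      posEven m a g H * natMatrix m (hankelEntry a p) := by
  unfold negOdd posEven posFactor negFactor
  rw [stepTwoProd_elemEntry_mul _ _ _ _ _ (by omega),
    stepTwoProd_elemEntry_mul _ _ _ _ _ (by omega)]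
  refine natMatrix_congr fun s r hs hr => ?_
  simp only [constEntry, hankelEntry, idEntry, mul_ite, mul_zero, mul_one, zero_mul]
  grind

lemma commute_negFactor {t t' : ℕ} (h : t + 2 ≤ t') :
    Commute (negFactor m a t) (negFactor m a t') := commute_elemEntry m h _ _ _ _

lemma commute_posFactor {t t' : ℕ} (h : t + 2 ≤ t') :
    Commute (posFactor m a t) (posFactor m a t') := commute_elemEntry m h _ _ _ _

lemma commute_negFactor_posFactor {t t' : ℕ} (h : t + 2 ≤ t') :
    Commute (negFactor m a t) (posFactor m a t') := commute_elemEntry m h _ _ _ _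

lemma isUnit_negFactor {t : ℕ} (h0 : 0 < t) (ht : t < m) : IsUnit (negFactor m a t) := by
  have h1 := natMatrix_elemEntry_neg_mul m h0 ht (-a t)
  have h2 := natMatrix_elemEntry_mul_neg m h0 ht (-a t)
  rw [neg_neg] at h1 h2
  exact ⟨⟨_, _, h1, h2⟩, rfl⟩

lemma isUnit_posFactor {t : ℕ} (h0 : 0 < t) (ht : t < m) : IsUnit (posFactor m a t) :=
  ⟨⟨_, _, natMatrix_elemEntry_mul_neg m h0 ht (-a t),
    natMatrix_elemEntry_neg_mul m h0 ht (-a t)⟩, rfl⟩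

lemma prod_range'_negFactor_mul {c p : ℕ} (hp : p < m) (hc : c ≤ p) (f : ℕ → ℕ → S) :
    ((List.range' c (p + 1 - c)).map (negFactor m a)).prod * natMatrix m f = natMatrix m (fun s r =>
      if s + 1 < c ∨ p < s then f s r
      else if s + 1 = c then f p r
      else (if 0 < s then f (s - 1) r else 0) + a s * f p r) := by
  obtain ⟨d, rfl⟩ := Nat.exists_eq_add_of_le hc
  induction d generalizing c with
  | zero =>
    simp only [show c + 0 + 1 - c = 1 by omega, List.range'_one, List.map_cons, List.map_nil,
      List.prod_cons, List.prod_nil, mul_one, negFactor]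
    rw [natMatrix_elemEntry_mul]
    refine natMatrix_congr fun s r _ _ => ?_
    simp only [add_zero]
    split_ifs <;> first | omega | simp_all
  | succ d ih =>
    rw [show c + (d + 1) + 1 - c = (c + 1 + d + 1 - (c + 1)) + 1 by omega, List.range'_succ,
      List.map_cons, List.prod_cons, mul_assoc]
    rw [show c + (d + 1) = c + 1 + d by omega] at *
    rw [ih (by omega) (by omega), negFactor, natMatrix_elemEntry_mul]
    refine natMatrix_congr fun s r hs _ => ?_
    split_ifs <;> first | omega | simp_all

lemma prod_range_negFactor_mul_hankelEntry {p : ℕ} (hp : p < m) :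
    ((List.range (p + 1)).map (negFactor m a)).prod * natMatrix m (hankelEntry a p) =
      natMatrix m (hankelEntry a (p + 1)) := by
  have := prod_range'_negFactor_mul m a hp (Nat.zero_le p) (hankelEntry a p)
  rw [Nat.sub_zero, ← List.range_eq_range'] at this
  rw [this]
  refine natMatrix_congr fun s r _ _ => ?_
  simp only [hankelEntry, idEntry, mul_ite, mul_zero, mul_one]
  grind

lemma prod_strings_map_negFactor {p : ℕ} (hp : p ≤ m) :
    (((List.range p).flatMap fun l => List.range (p - l)).map (negFactor m a)).prod =
      natMatrix m (hankelEntry a p) := by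
  induction p with
  | zero =>
    have hzero : hankelEntry a 0 = idEntry := by
      ext s r
      simp [hankelEntry]
    simp [hzero, natMatrix_idEntry]
  | succ p ih =>
    rw [← prod_range_negFactor_mul_hankelEntry m a (by omega), ← ih (by omega),
      List.range_succ_eq_map, List.flatMap_cons, List.map_append, List.prod_append,
      List.flatMap_map]
    simp [List.range_succ_eq_map]

end BlockFactorization

section TupleProducts

/-- The first part `(h-1, h, h-3, h-2, …)` of an admissible tuple, consisting of `N` pairs. -/
def pairTuple (h : ℤ) (N : ℕ) : List ℤ :=
  (List.range N).flatMap fun l : ℕ => [h - 2 * (l : ℤ) - 1, h - 2 * (l : ℤ)]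

lemma pairTuple_succ (h : ℤ) (N : ℕ) :
    pairTuple h (N + 1) = (h - 1) :: h :: pairTuple (h - 2) N := by
  have hstep (l : ℕ) : h - 2 * ((l + 1 : ℕ) : ℤ) = h - 2 - 2 * (l : ℤ) := by push_cast; ring
  simp only [pairTuple, List.range_succ_eq_map, List.flatMap_cons, List.flatMap_map,
    Nat.succ_eq_add_one, hstep]
  simp

lemma mem_pairTuple {h i : ℤ} {N : ℕ} (hi : i ∈ pairTuple h N) : h - 2 * N < i ∧ i ≤ h := by
  simp only [pairTuple, List.mem_flatMap, List.mem_range, List.mem_cons, List.not_mem_nil,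
    or_false] at hi
  obtain ⟨l, hl, hi⟩ := hi
  omega

lemma admissibleTuple_eq (p N : ℕ) :
    admissibleTuple (p + 2 * N) p =
      pairTuple ((p + 2 * N : ℕ) : ℤ) N ++ (List.range (p + 1)).map fun l : ℕ => (l : ℤ) := by
  rw [admissibleTuple, show (p + 2 * N - p) / 2 = N by omega]
  rfl

variable {M : Type*} [Monoid M]

lemma prod_map_pairTuple (F : ℤ → M) (p N : ℕ)
    (hF : ∀ i j : ℕ, i + 2 ≤ j → j ≤ p + 2 * N → Commute (F i) (F j)) :
    ((pairTuple ((p + 2 * N : ℕ) : ℤ) N).map F).prod =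
      stepTwoProd (fun i : ℕ => F i) (p + 1) N * stepTwoProd (fun i : ℕ => F i) (p + 2) N := by
  induction N with
  | zero => simp [pairTuple, stepTwoProd]
  | succ N ih =>
    rw [pairTuple_succ, show ((p + 2 * (N + 1) : ℕ) : ℤ) - 2 = ((p + 2 * N : ℕ) : ℤ) by
      push_cast; ring, List.map_cons, List.map_cons, List.prod_cons, List.prod_cons,
      ih fun i j hij hj => hF i j hij (by omega)]
    have hc : Commute (F ((p + 2 * (N + 1) : ℕ) : ℤ)) (stepTwoProd (fun i : ℕ => F i) (p + 1) N) :=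
      commute_stepTwoProd fun l hl => (hF _ _ (by omega) le_rfl).symm
    rw [stepTwoProd, stepTwoProd, ← mul_assoc (F ((p + 2 * (N + 1) : ℕ) : ℤ)), hc.eq,
      show ((p + 2 * (N + 1) : ℕ) : ℤ) - 1 = ((p + 1 + 2 * N : ℕ) : ℤ) by push_cast; ring,
      show p + 2 * (N + 1) = p + 2 + 2 * N by ring]
    simp only [mul_assoc]

lemma prod_map_admissibleTuple (F : ℤ → M) (p N : ℕ)
    (hF : ∀ i j : ℕ, i + 2 ≤ j → j ≤ p + 2 * N → Commute (F i) (F j)) :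
    ((admissibleTuple (p + 2 * N) p).map F).prod =
      stepTwoProd (fun i : ℕ => F i) (p + 1) N * stepTwoProd (fun i : ℕ => F i) (p + 2) N *
        ((List.range (p + 1)).map fun i : ℕ => F i).prod := by
  rw [admissibleTuple_eq, List.map_append, List.prod_append, prod_map_pairTuple F p N hF,
    List.map_map]
  rfl

lemma prod_map_symmComplement (F : ℤ → M) (p N : ℕ) :
    ((symmComplement (p + 2 * N) p).map F).prod =
      stepTwoProd (fun i : ℕ => F i) (p + 1) N *
        (((List.range p).flatMap fun l => List.range (p - l)).map fun i : ℕ => F i).prod := by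
  rw [symmComplement, show (p + 2 * N - p) / 2 = N by omega, List.map_append, List.prod_append]
  congr 1
  · induction N with
    | zero => simp [stepTwoProd]
    | succ N ih =>
      rw [List.range_succ_eq_map, List.map_cons, List.map_cons, List.prod_cons, stepTwoProd, ← ih,
        List.map_map, List.map_map]
      congr 1
      · congr 1; push_cast; ring
      · simp only [List.map_map]
        congr 2
        funext l
        simp only [Function.comp_apply]
        congr 1; push_cast; ring
  · simp [List.map_flatMap, Function.comp_def]

lemma map_stepTwoProd {M' Φ : Type*} [Monoid M'] [FunLike Φ M M'] [MonoidHomClass Φ M M'] (φ : Φ)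
    (F : ℕ → M) (c N : ℕ) :
    φ (stepTwoProd F c N) = stepTwoProd (fun i => φ (F i)) c N := by
  induction N with
  | zero => simp [stepTwoProd]
  | succ N ih => rw [stepTwoProd, map_mul, ih, stepTwoProd]

lemma admissibleTuple_zero (N : ℕ) :
    admissibleTuple (2 * N) 0 = pairTuple ((2 * N : ℕ) : ℤ) N ++ [0] := by
  simpa using admissibleTuple_eq 0 N

lemma pairTuple_succ_append_zero (N : ℕ) :
    pairTuple ((2 * (N + 1) : ℕ) : ℤ) (N + 1) ++ [0] =
      pairTuple ((2 * (N + 1) : ℕ) : ℤ) N ++ [1, 2, 0] := by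
  have htwo : 2 * ((N : ℤ) + 1) - 2 * N = 2 := by ring
  simp [pairTuple, List.range_succ, htwo]

lemma not_reverse_range_sublist_pairTuple_append {N s : ℕ} (hs : 1 < s) :
    ¬ ((List.range (s + 1)).reverse.map fun j : ℕ => (0 : ℤ) + (j : ℤ)).Sublist
      (pairTuple ((2 * (N + 1) : ℕ) : ℤ) N ++ [1, 2, 0]) := by
  intro hsub
  have hthree : [2, 1, 0].Sublist
      ((List.range (s + 1)).reverse.map fun j : ℕ => (0 : ℤ) + (j : ℤ)) := by
    obtain ⟨d, rfl⟩ := Nat.exists_eq_add_of_le hs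
    rw [show 1 + 1 + d + 1 = 3 + d by ring, List.range_add, List.reverse_append, List.map_append]
    exact List.sublist_append_right _ _
  have hlow : (pairTuple ((2 * (N + 1) : ℕ) : ℤ) N).filter (fun i : ℤ => decide (i ≤ 2)) = [] :=
    List.filter_eq_nil_iff.2 fun i hi => by
      have := mem_pairTuple hi
      simp only [decide_eq_true_eq]
      omega
  have hfilter := (hthree.trans hsub).filter (fun i : ℤ => decide (i ≤ 2))
  rw [List.filter_append, hlow] at hfilter
  revert hfilter
  decide

lemma inversionsAt_admissibleTuple (N : ℕ) :
    inversionsAt 0 (admissibleTuple (2 * N) 0) = if N = 0 then 0 else 1 := by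
  rcases N with _ | N
  · decide
  · rw [admissibleTuple_zero, inversionsAt, if_pos (by simp),
      pairTuple_succ_append_zero, if_neg (Nat.succ_ne_zero N)]
    norm_cast
    rw [Nat.findGreatest_eq_iff]
    refine ⟨by simp, fun _ => ?_, fun s hs _ => not_reverse_range_sublist_pairTuple_append hs⟩
    exact List.Sublist.trans (by decide) (List.sublist_append_right _ _)

end TupleProducts

section FiedlerProducts

variable {R : Type} [Ring R] {n : ℕ} (m : ℕ) (Ac : ℕ → Matrix (Fin n) (Fin n) R)

/-- The coefficients in reverse order, so that the block index `t` of a Fiedler matrix is also the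
index of its coefficient. -/
def revCoeff (t : ℕ) : Matrix (Fin n) (Fin n) R := Ac (m - t)

lemma fiedlerP_nat {i : ℕ} (hi : i < m) :
    fiedlerP m Ac i =
      compRingEquiv (Fin m) (Fin n) R (posFactor m (revCoeff m Ac) (m - i)) := by
  ext ⟨s, x⟩ ⟨r, y⟩
  have hs := s.2
  have hr := r.2
  simp only [fiedlerP, Nat.cast_nonneg, if_true, elemM, of_apply, elemBlock, compRingEquiv_apply,
    comp_apply, posFactor, natMatrix_apply, elemEntry, idEntry, Int.natAbs_natCast, revCoeff]
  rw [show m - (m - i) = i by omega]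
  split_ifs <;> first | omega | simp

lemma fiedlerP_neg {t : ℕ} (ht : t < m) :
    fiedlerP m Ac ((t : ℤ) - m) =
      compRingEquiv (Fin m) (Fin n) R (negFactor m (revCoeff m Ac) t) := by
  ext ⟨s, x⟩ ⟨r, y⟩
  have hs := s.2
  have := r.2
  have hab : ((t : ℤ) - m).natAbs = m - t := by omega
  simp only [fiedlerP, elemM, of_apply, elemBlock, compRingEquiv_apply,
    comp_apply, negFactor, natMatrix_apply, elemEntry, idEntry, revCoeff, hab,
    show m - (m - t) = t by omega, show ¬ (0 : ℤ) ≤ t - m by omega, if_false]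
  split_ifs <;> first | omega | simp

variable {m}

lemma stepTwoProd_fiedlerP {c N g : ℕ} (h : c + 2 * N ≤ m + 1) (hg : m + 2 - c - 2 * N = g) :
    stepTwoProd (fun i : ℕ => fiedlerP m Ac i) c N =
      compRingEquiv (Fin m) (Fin n) R (stepTwoProd (posFactor m (revCoeff m Ac)) g N) := by
  rw [← hg, ← stepTwoProd_reflect (fun i j hij => commute_posFactor m _ hij) m c N (by omega)]
  refine Eq.trans ?_ (map_stepTwoProd (compRingEquiv (Fin m) (Fin n) R) _ c N).symm
  exact stepTwoProd_congr fun l hl => fiedlerP_nat m Ac (by omega)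

lemma stepTwoProd_fiedlerP_neg {c N : ℕ} (h : c + 2 * N ≤ m + 1) :
    stepTwoProd (fun i : ℕ => fiedlerP m Ac (i - m)) c N =
      compRingEquiv (Fin m) (Fin n) R (stepTwoProd (negFactor m (revCoeff m Ac)) c N) := by
  refine Eq.trans ?_ (map_stepTwoProd (compRingEquiv (Fin m) (Fin n) R) _ c N).symm
  exact stepTwoProd_congr fun l hl => fiedlerP_neg m Ac (by omega)

lemma commute_fiedlerP {i j : ℕ} (hij : i + 2 ≤ j) (hj : j < m) :
    Commute (fiedlerP m Ac i) (fiedlerP m Ac j) := by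
  rw [fiedlerP_nat m Ac hj, fiedlerP_nat m Ac (show i < m by omega)]
  exact ((commute_posFactor m _ (by omega)).map (compRingEquiv (Fin m) (Fin n) R)).symm

lemma commute_fiedlerP_neg {i j : ℕ} (hij : i + 2 ≤ j) (hj : j < m) :
    Commute (fiedlerP m Ac ((i : ℤ) - m)) (fiedlerP m Ac ((j : ℤ) - m)) := by
  rw [fiedlerP_neg m Ac hj, fiedlerP_neg m Ac (show i < m by omega)]
  exact (commute_negFactor m _ (by omega)).map (compRingEquiv (Fin m) (Fin n) R)

lemma prod_map_fiedlerP_neg (l : List ℕ) (hl : ∀ i ∈ l, i < m) :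
    (l.map fun i : ℕ => fiedlerP m Ac ((i : ℤ) - m)).prod =
      compRingEquiv (Fin m) (Fin n) R ((l.map (negFactor m (revCoeff m Ac))).prod) := by
  rw [map_list_prod, List.map_map]
  congr 1
  exact List.map_congr_left fun i hi => fiedlerP_neg m Ac (hl i hi)

lemma tupleProd_eq_shift (M : ℤ → Matrix (Fin m × Fin n) (Fin m × Fin n) R) (z : List ℤ) :
    tupleProd M z = ((shiftTuple m z).map fun i => M (i - m)).prod := by
  simp [tupleProd, shiftTuple, Function.comp_def]

section

variable {p Z H g : ℕ}

lemma tupleProd_pairTuple (hm : m = g + 1 + 2 * H) :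
    tupleProd (fiedlerP m Ac) (pairTuple ((2 * H : ℕ) : ℤ) H) =
      compRingEquiv (Fin m) (Fin n) R (posOdd m (revCoeff m Ac) g H *
        stepTwoProd (posFactor m (revCoeff m Ac)) (g + 1) H) := by
  have := prod_map_pairTuple (fiedlerP m Ac) 0 H
    fun i j hij hj => commute_fiedlerP Ac hij (by omega)
  rw [Nat.zero_add] at this
  rw [tupleProd, this, stepTwoProd_fiedlerP Ac (by omega) (show _ = g + 2 by omega),
    stepTwoProd_fiedlerP Ac (by omega) (show _ = g + 1 by omega), map_mul]
  rfl

lemma tupleProd_fiedlerP_admissibleTuple (hm : m = g + 1 + 2 * H) :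
    tupleProd (fiedlerP m Ac) (admissibleTuple (2 * H) 0) =
      compRingEquiv (Fin m) (Fin n) R
        (posOdd m (revCoeff m Ac) g H * posEven m (revCoeff m Ac) g H) := by
  have h0 := tupleProd_pairTuple Ac hm
  have hc : Commute (posFactor m (revCoeff m Ac) (g + 1 + 2 * H))
      (stepTwoProd (posFactor m (revCoeff m Ac)) (g + 1) H) :=
    commute_stepTwoProd fun l hl => (commute_posFactor m _ (by omega)).symm
  rw [tupleProd] at h0 ⊢
  rw [admissibleTuple_zero, List.map_append, List.prod_append, h0, posEven, stepTwoProd,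
    hc.eq, ← mul_assoc, map_mul]
  have h1 := fiedlerP_nat m Ac (i := 0) (by omega)
  rw [Nat.cast_zero, Nat.sub_zero] at h1
  rw [List.map_singleton, List.prod_singleton, h1, ← hm, map_mul _ _ (posFactor _ _ _), map_mul]

lemma tupleProd_fiedlerP_symmComplement (hm : m = g + 1 + 2 * H) :
    tupleProd (fiedlerP m Ac) (symmComplement (2 * H) 0) =
      compRingEquiv (Fin m) (Fin n) R (posOdd m (revCoeff m Ac) g H) := by
  have := prod_map_symmComplement (fiedlerP m Ac) 0 H
  rw [Nat.zero_add] at this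
  rw [tupleProd, this, stepTwoProd_fiedlerP Ac (by omega) (show _ = g + 2 by omega)]
  simp [posOdd]

lemma tupleProd_fiedlerP_of_shift_admissibleTuple (hm : m = g + 1 + 2 * H)
    (hg : g = p + 2 * Z) {z : List ℤ} (hz : shiftTuple m z = admissibleTuple g p) :
    tupleProd (fiedlerP m Ac) z = compRingEquiv (Fin m) (Fin n) R
      (negOdd m (revCoeff m Ac) p Z * negEven m (revCoeff m Ac) p Z *
        ((List.range (p + 1)).map (negFactor m (revCoeff m Ac))).prod) := by
  rw [tupleProd_eq_shift, hz, hg, prod_map_admissibleTuple (fun i => fiedlerP m Ac (i - m)) p Z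
    fun i j hij hj => commute_fiedlerP_neg Ac hij (by omega),
    stepTwoProd_fiedlerP_neg Ac (by omega), stepTwoProd_fiedlerP_neg Ac (by omega),
    prod_map_fiedlerP_neg Ac _ (by simp only [List.mem_range]; omega), map_mul, map_mul]
  rfl

lemma tupleProd_fiedlerP_of_shift_symmComplement (hm : m = g + 1 + 2 * H)
    (hg : g = p + 2 * Z) {cz : List ℤ} (hcz : shiftTuple m cz = symmComplement g p) :
    tupleProd (fiedlerP m Ac) cz = compRingEquiv (Fin m) (Fin n) R
      (negOdd m (revCoeff m Ac) p Z * natMatrix m (hankelEntry (revCoeff m Ac) p)) := by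
  rw [tupleProd_eq_shift, hcz, hg, prod_map_symmComplement (fun i => fiedlerP m Ac (i - m)) p Z,
    stepTwoProd_fiedlerP_neg Ac (by omega),
    prod_map_fiedlerP_neg Ac, map_mul,
    prod_strings_map_negFactor m _ (by omega)]
  · rfl
  · intro i hi
    simp only [List.mem_flatMap, List.mem_range] at hi
    omega

end

end FiedlerProducts

section Congruence

variable {S : Type*} [Ring S] {m : ℕ} (a : ℕ → S) {p Z H g : ℕ}

/-- The factor `O` in `L(λ) = O (λX' - Y') O`, where `λX' - Y'` is the core pencil: the product of
the commuting odd-position factors that `𝐰` and `𝐳` share with their symmetric complements. -/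
def congFactor (m : ℕ) (a : ℕ → S) (p Z g H : ℕ) : Matrix (Fin m) (Fin m) S :=
  negOdd m a p Z * posOdd m a g H

lemma commute_negOdd_posOdd (hg : g = p + 2 * Z) : Commute (negOdd m a p Z) (posOdd m a g H) :=
  commute_stepTwoProd fun l _ => (commute_stepTwoProd fun l' hl' =>
    (commute_negFactor_posFactor m a (by omega)).symm).symm

lemma commute_hankelEntry {x : Matrix (Fin m) (Fin m) S} (hp : p ≤ m)
    (hx : ∀ t < p, Commute (negFactor m a t) x) : Commute (natMatrix m (hankelEntry a p)) x := by
  rw [← prod_strings_map_negFactor m a hp]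
  refine Commute.list_prod_left _ _ fun y hy => ?_
  simp only [List.mem_map, List.mem_flatMap, List.mem_range] at hy
  obtain ⟨i, ⟨l, hl, hi⟩, rfl⟩ := hy
  exact hx i (by omega)

lemma commute_hankelEntry_posOdd (hp : p ≤ m) (hg : g = p + 2 * Z) :
    Commute (natMatrix m (hankelEntry a p)) (posOdd m a g H) :=
  commute_hankelEntry a hp fun _ ht => commute_stepTwoProd fun _ _ =>
    commute_negFactor_posFactor m a (by omega)

lemma commute_hankelEntry_negOdd (hp : p ≤ m) :
    Commute (natMatrix m (hankelEntry a p)) (negOdd m a p Z) :=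
  commute_hankelEntry a hp fun _ ht => commute_stepTwoProd fun _ _ =>
    commute_negFactor m a (by omega)

lemma isUnit_congFactor (hm : m = g + 1 + 2 * H) (hg : g = p + 2 * Z) :
    IsUnit (congFactor m a p Z g H) :=
  (isUnit_stepTwoProd fun _ _ => isUnit_negFactor m a (by omega) (by omega)).mul
    (isUnit_stepTwoProd fun _ _ => isUnit_posFactor m a (by omega) (by omega))

lemma congFactor_mul_leadEntry_mul_congFactor (hm : m = g + 1 + 2 * H) (hg : g = p + 2 * Z) :
    (negOdd m a p Z * negEven m a p Z * ((List.range (p + 1)).map (negFactor m a)).prod) *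
      posOdd m a g H * (negOdd m a p Z * natMatrix m (hankelEntry a p)) =
    congFactor m a p Z g H * natMatrix m (leadEntry a p) * congFactor m a p Z g H := by
  have h1 := (commute_hankelEntry_posOdd (m := m) (H := H) a (by omega) hg).eq
  have h2 := (commute_hankelEntry_negOdd (m := m) (Z := Z) a (p := p) (by omega)).eq
  have h3 := (commute_negOdd_posOdd (m := m) (H := H) a hg).eq
  rw [congFactor, mul_assoc (negOdd m a p Z) (posOdd m a g H) (natMatrix m _),
    posOdd_mul_leadEntry m a hg hm, ← prod_range_negFactor_mul_hankelEntry m a (by omega), ← h2,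
    mul_assoc _ (posOdd m a g H), ← mul_assoc (posOdd m a g H), ← h1]
  simp only [mul_assoc, h3]

lemma congFactor_mul_constEntry_mul_congFactor (hm : m = g + 1 + 2 * H) (hg : g = p + 2 * Z) :
    (posOdd m a g H * posEven m a g H) *
      posOdd m a g H * (negOdd m a p Z * natMatrix m (hankelEntry a p)) =
    congFactor m a p Z g H * natMatrix m (constEntry a p) * congFactor m a p Z g H := by
  have h1 := (commute_hankelEntry_posOdd (m := m) (H := H) a (by omega) hg).eq
  have h2 := (commute_hankelEntry_negOdd (m := m) (Z := Z) a (p := p) (by omega)).eq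
  have h3 := (commute_negOdd_posOdd (m := m) (H := H) a hg).eq
  rw [congFactor, h3, mul_assoc (posOdd m a g H) (negOdd m a p Z) (natMatrix m _),
    negOdd_mul_constEntry m a hg hm, ← h2, mul_assoc _ (posOdd m a g H),
    ← mul_assoc (posOdd m a g H) (natMatrix m _), ← h1]
  simp only [mul_assoc]

end Congruence

section Rows

variable {S : Type*} [Ring S] {m p N : ℕ} (a : ℕ → S)

lemma sum_range_ite_eq_mul (m c : ℕ) (x : S) (W : ℕ → S) :
    ∑ r ∈ Finset.range m, (if r = c then x else 0) * W r = if c < m then x * W c else 0 := by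
  simp [ite_mul]

lemma sum_leadEntry_of_le {s : ℕ} (hpm : p < m) (hs : s ≤ p) (W : ℕ → S) :
    ∑ r ∈ Finset.range m, leadEntry a p s r * W r =
      ∑ u ∈ Finset.range (s + 1), a u * W (p - s + u) := by
  have h := Finset.sum_Ico_eq_sum_range (fun r => leadEntry a p s r * W r) (p - s) (p + 1)
  rw [show p + 1 - (p - s) = s + 1 by omega] at h
  rw [← Finset.sum_subset (s₁ := Finset.Ico (p - s) (p + 1)), h]
  · refine Finset.sum_congr rfl fun u hu => ?_
    rw [Finset.mem_range] at hu
    rw [leadEntry, if_pos (by omega), if_pos (by omega), show s + (p - s + u) - p = u by omega]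
  · intro r hr
    simp only [Finset.mem_Ico, Finset.mem_range] at hr ⊢
    omega
  · intro r _ hr
    simp only [Finset.mem_Ico] at hr
    rw [leadEntry]
    split_ifs <;> first | omega | simp

lemma sum_constEntry_of_lt {s : ℕ} (hpm : p < m) (hs : s < p) (W : ℕ → S) :
    ∑ r ∈ Finset.range m, constEntry a p s r * W r =
      ∑ u ∈ Finset.range (s + 1), a u * W (p - 1 - s + u) := by
  have h := Finset.sum_Ico_eq_sum_range (fun r => constEntry a p s r * W r) (p - 1 - s) p
  rw [show p - (p - 1 - s) = s + 1 by omega] at h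
  rw [← Finset.sum_subset (s₁ := Finset.Ico (p - 1 - s) p), h]
  · refine Finset.sum_congr rfl fun u hu => ?_
    rw [Finset.mem_range] at hu
    rw [constEntry, if_pos (by omega), if_pos (by omega),
      show s + (p - 1 - s + u) + 1 - p = u by omega]
  · intro r hr
    simp only [Finset.mem_Ico, Finset.mem_range] at hr ⊢
    omega
  · intro r _ hr
    simp only [Finset.mem_Ico] at hr
    rw [constEntry]
    split_ifs <;> first | omega | simp

lemma sum_leadEntry_of_odd {s : ℕ} (hs : p < s) (hodd : (s - p) % 2 = 1) (hsm : s + 1 < m)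
    (W : ℕ → S) : ∑ r ∈ Finset.range m, leadEntry a p s r * W r = W (s + 1) := by
  have : ∀ r, leadEntry a p s r = if r = s + 1 then 1 else 0 := fun r => by
    rw [leadEntry]; split_ifs <;> first | omega | rfl
  simp only [this, sum_range_ite_eq_mul, hsm, if_true, one_mul]

lemma sum_constEntry_of_odd {s : ℕ} (hs : p < s) (hodd : (s - p) % 2 = 1) (hsm : s < m)
    (W : ℕ → S) : ∑ r ∈ Finset.range m, constEntry a p s r * W r = W (s - 1) := by
  have : ∀ r, constEntry a p s r = if r = s - 1 then 1 else 0 := fun r => by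
    rw [constEntry]; split_ifs <;> first | omega | rfl
  simp only [this, sum_range_ite_eq_mul, show s - 1 < m by omega, if_true, one_mul]

lemma sum_leadEntry_of_even {s : ℕ} (hs : p < s) (heven : (s - p) % 2 = 0) (hsm : s < m)
    (W : ℕ → S) :
    ∑ r ∈ Finset.range m, leadEntry a p s r * W r = W (s - 1) + a s * W s := by
  have : ∀ r, leadEntry a p s r =
      (if r = s - 1 then 1 else 0) + (if r = s then a s else 0) := fun r => by
    rw [leadEntry]; split_ifs <;> first | omega | simp
  simp only [this, add_mul, Finset.sum_add_distrib, sum_range_ite_eq_mul, hsm,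
    show s - 1 < m by omega, if_true, one_mul]

lemma sum_constEntry_of_even {s : ℕ} (hs : p ≤ s) (heven : (s - p) % 2 = 0) (hsm : s < m)
    (W : ℕ → S) : ∑ r ∈ Finset.range m, constEntry a p s r * W r =
      -(a (s + 1) * W s) + if s + 1 < m then W (s + 1) else 0 := by
  have : ∀ r, constEntry a p s r =
      (if r = s then -a (s + 1) else 0) + (if r = s + 1 then 1 else 0) := fun r => by
    rw [constEntry]; split_ifs <;> first | omega | simp
  simp only [this, add_mul, Finset.sum_add_distrib, sum_range_ite_eq_mul, hsm,
    if_true, one_mul, neg_mul]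

/-- All rows but the last of `(ℓX' - Y') W = 0`, for the core pencil and a vector `W` with entries
in `S`. -/
def IsCoreKernel (m p : ℕ) (ℓ : S) (W : ℕ → S) : Prop :=
  ∀ s, s + 1 < m → ℓ * ∑ r ∈ Finset.range m, leadEntry a p s r * W r =
    ∑ r ∈ Finset.range m, constEntry a p s r * W r

namespace IsCoreKernel

variable {a} {ℓ : S} {W : ℕ → S}

lemma apply_add_two_mul (h : IsCoreKernel a m p ℓ W) (hm : m = p + 2 * N + 1)
    (hlast : W (m - 1) = 0) {l : ℕ} (hl : l ≤ N) : W (p + 2 * l) = 0 := by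
  induction hl using Nat.decreasingInduction with
  | self => rwa [hm] at hlast
  | of_succ l hl ih =>
    have hrow := h (p + 2 * l + 1) (by omega)
    rw [sum_leadEntry_of_odd a (by omega) (by omega) (by omega),
      sum_constEntry_of_odd a (by omega) (by omega) (by omega),
      show p + 2 * l + 1 + 1 = p + 2 * (l + 1) by omega, ih, mul_zero] at hrow
    exact hrow.symm

lemma mul_apply_sub (h : IsCoreKernel a m p ℓ W) (hpm : p < m) (hℓ : ∀ x, Commute ℓ x)
    (ha : ∀ x, a 0 * x = 0 → x = 0) {s : ℕ} (hs : s < p) : ℓ * W (p - s) = W (p - 1 - s) := by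
  induction s using Nat.strong_induction_on with
  | _ s ih =>
    have hrow := h s (by omega)
    rw [sum_leadEntry_of_le a hpm hs.le, sum_constEntry_of_lt a hpm hs,
      Finset.mul_sum, Finset.sum_range_succ', Finset.sum_range_succ'] at hrow
    have hterm : ∀ u ∈ Finset.range s, ℓ * (a (u + 1) * W (p - s + (u + 1))) =
        a (u + 1) * W (p - 1 - s + (u + 1)) := fun u hu => by
      rw [Finset.mem_range] at hu
      have := ih (s - (u + 1)) (by omega) (by omega)
      rw [← mul_assoc, (hℓ _).eq, mul_assoc, show p - s + (u + 1) = p - (s - (u + 1)) by omega,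
        this, show p - 1 - (s - (u + 1)) = p - 1 - s + (u + 1) by omega]
    rw [Finset.sum_congr rfl hterm, add_right_inj, ← mul_assoc, (hℓ _).eq, mul_assoc, add_zero,
      add_zero, ← sub_eq_zero, ← mul_sub] at hrow
    exact sub_eq_zero.1 (ha _ hrow)

lemma apply_of_le (h : IsCoreKernel a m p ℓ W) (hm : m = p + 2 * N + 1) (hlast : W (m - 1) = 0)
    (hℓ : ∀ x, Commute ℓ x) (ha : p ≠ 0 → ∀ x, a 0 * x = 0 → x = 0) {t : ℕ} (ht : t ≤ p) :
    W t = 0 := by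
  induction ht using Nat.decreasingInduction with
  | self => exact h.apply_add_two_mul hm hlast (l := 0) (by omega)
  | of_succ t ht ih =>
    have := h.mul_apply_sub (by omega) hℓ (ha (by omega)) (s := p - 1 - t) (by omega)
    rwa [show p - (p - 1 - t) = t + 1 by omega, ih, mul_zero,
      show p - 1 - (p - 1 - t) = t by omega, eq_comm] at this

lemma apply_add_two_mul_add_one (h : IsCoreKernel a m p ℓ W) (hm : m = p + 2 * N + 1)
    (heven : ∀ l ≤ N, W (p + 2 * l) = 0) (hle : ∀ t ≤ p, W t = 0) {l : ℕ} (hl : l < N) :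
    W (p + 2 * l + 1) = 0 := by
  induction l with
  | zero =>
    have hrow := h p (by omega)
    rw [sum_leadEntry_of_le a (by omega) le_rfl,
      sum_constEntry_of_even a le_rfl (by omega) (by omega), if_pos (by omega),
      Finset.sum_eq_zero fun u hu => ?_, hle p le_rfl] at hrow
    · simpa using hrow.symm
    · rw [hle _ (by simp at hu; omega), mul_zero]
  | succ l ih =>
    have hrow := h (p + 2 * (l + 1)) (by omega)
    rw [sum_leadEntry_of_even a (by omega) (by omega) (by omega),
      sum_constEntry_of_even a (by omega) (by omega) (by omega), if_pos (by omega),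
      heven (l + 1) (by omega), show p + 2 * (l + 1) - 1 = p + 2 * l + 1 by omega,
      ih (by omega)] at hrow
    simpa using hrow.symm

lemma eq_zero (h : IsCoreKernel a m p ℓ W) (hm : m = p + 2 * N + 1) (hlast : W (m - 1) = 0)
    (hℓ : ∀ x, Commute ℓ x) (ha : p ≠ 0 → ∀ x, a 0 * x = 0 → x = 0) {t : ℕ} (ht : t < m) :
    W t = 0 := by
  have heven : ∀ l ≤ N, W (p + 2 * l) = 0 := fun l => h.apply_add_two_mul hm hlast
  have hle : ∀ t ≤ p, W t = 0 := fun t => h.apply_of_le hm hlast hℓ ha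
  rcases Nat.lt_or_ge t p with htp | htp
  · exact hle t htp.le
  · obtain ⟨l, hl | hl⟩ := Nat.even_or_odd' (t - p)
    · rw [show t = p + 2 * l by omega]
      exact heven l (by omega)
    · rw [show t = p + 2 * l + 1 by omega]
      exact h.apply_add_two_mul_add_one hm heven hle (by omega)

end IsCoreKernel

lemma eq_zero_of_sum_leadEntry_mul (hm : m = p + 2 * N + 1) (ha : ∀ x, a 0 * x = 0 → x = 0)
    (W : ℕ → S) (hrow : ∀ s < m, ∑ r ∈ Finset.range m, leadEntry a p s r * W r = 0) {t : ℕ}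
    (ht : t < m) : W t = 0 := by
  have hsub : ∀ s ≤ p, W (p - s) = 0 := by
    intro s
    induction s using Nat.strong_induction_on with
    | _ s ih =>
      intro hs
      have h := hrow s (by omega)
      rw [sum_leadEntry_of_le a (by omega) hs, Finset.sum_range_succ', Finset.sum_eq_zero, zero_add,
        add_zero] at h
      · exact ha _ h
      · intro u hu
        rw [Finset.mem_range] at hu
        have := ih (s - (u + 1)) (by omega) (by omega)
        rw [show p - s + (u + 1) = p - (s - (u + 1)) by omega, this, mul_zero]
  have heven : ∀ t, p < t → t < m → (t - p) % 2 = 0 → W t = 0 := fun t h1 h2 h3 => by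
    have h := hrow (t - 1) (by omega)
    rwa [sum_leadEntry_of_odd a (by omega) (by omega) (by omega), Nat.sub_add_cancel (by omega)]
      at h
  rcases Nat.lt_or_ge p t with h | h
  · rcases Nat.mod_two_eq_zero_or_one (t - p) with h' | h'
    · exact heven t h ht h'
    · have h2 := hrow (t + 1) (by omega)
      rwa [sum_leadEntry_of_even a (by omega) (by omega) (by omega),
        heven (t + 1) (by omega) (by omega) (by omega), mul_zero, add_zero,
        show t + 1 - 1 = t by omega] at h2
  · simpa [Nat.sub_sub_self h] using hsub (p - t) (by omega)

/-- The Horner shift `a 0 ℓ ^ t + a 1 ℓ ^ (t - 1) + ⋯ + a t`, for central `ℓ`. -/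
def horner (ℓ : S) (t : ℕ) : S := ∑ u ∈ Finset.range (t + 1), ℓ ^ (t - u) * a u

lemma horner_succ (ℓ : S) (t : ℕ) : horner a ℓ (t + 1) = ℓ * horner a ℓ t + a (t + 1) := by
  rw [horner, Finset.sum_range_succ, horner, Finset.mul_sum]
  congr 1
  · refine Finset.sum_congr rfl fun u hu => ?_
    rw [Finset.mem_range] at hu
    rw [show t + 1 - u = t - u + 1 by omega, pow_succ', mul_assoc]
  · simp

/-- The vector that the core pencil `ℓX' - Y'` maps to the last unit vector times `P(ℓ)`. -/
def lastCol (p N : ℕ) (ℓ : S) (t : ℕ) : S :=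
  if t ≤ p then ℓ ^ (p - t + N)
  else if (t - p) % 2 = 0 then ℓ ^ (N - (t - p) / 2)
  else horner a ℓ t * ℓ ^ (N - (t - p) / 2)

section LastCol

variable {a} {ℓ : S} {s : ℕ}

lemma coreRow_lastCol_of_lt (hpm : p < m) (hℓ : ∀ x, Commute ℓ x) (h : s < p) :
    ℓ * ∑ r ∈ Finset.range m, leadEntry a p s r * lastCol a p N ℓ r =
      ∑ r ∈ Finset.range m, constEntry a p s r * lastCol a p N ℓ r := by
  rw [sum_leadEntry_of_le a hpm h.le, sum_constEntry_of_lt a hpm h, Finset.mul_sum]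
  refine Finset.sum_congr rfl fun u hu => ?_
  rw [Finset.mem_range] at hu
  rw [lastCol, lastCol, if_pos (by omega), if_pos (by omega), ← mul_assoc, (hℓ _).eq, mul_assoc,
    ← pow_succ']
  congr 2
  omega

lemma coreRow_lastCol_of_odd (hm : m = p + 2 * N + 1) (h : p < s) (hodd : (s - p) % 2 = 1)
    (hs : s < m) :
    ℓ * ∑ r ∈ Finset.range m, leadEntry a p s r * lastCol a p N ℓ r =
      ∑ r ∈ Finset.range m, constEntry a p s r * lastCol a p N ℓ r := by
  rw [sum_leadEntry_of_odd a h hodd (by omega), sum_constEntry_of_odd a h hodd hs, lastCol,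
    if_neg (by omega), if_pos (by omega), ← pow_succ', lastCol]
  split_ifs <;> first | omega | (congr 1; omega)

lemma sum_leadEntry_mul_lastCol (hm : m = p + 2 * N + 1) (hℓ : ∀ x, Commute ℓ x) (h : p ≤ s)
    (heven : (s - p) % 2 = 0) (hs : s < m) :
    ∑ r ∈ Finset.range m, leadEntry a p s r * lastCol a p N ℓ r =
      horner a ℓ s * ℓ ^ (N - (s - p) / 2) := by
  rcases h.eq_or_lt with rfl | h
  · rw [sum_leadEntry_of_le a (by omega) le_rfl, horner, Finset.sum_mul]
    refine Finset.sum_congr rfl fun u hu => ?_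
    rw [Finset.mem_range] at hu
    rw [lastCol, if_pos (by omega), show p - (p - p + u) + N = p - u + N by omega, pow_add,
      ← mul_assoc, ((hℓ (a u)).pow_left _).eq, Nat.sub_self, Nat.zero_div, Nat.sub_zero]
  · have hsucc := horner_succ a ℓ (s - 1)
    rw [Nat.sub_add_cancel (by omega)] at hsucc
    rw [sum_leadEntry_of_even a h heven hs, lastCol, if_neg (by omega), if_neg (by omega), lastCol,
      if_neg (by omega), if_pos heven, hsucc,
      show N - (s - 1 - p) / 2 = N - (s - p) / 2 + 1 by omega, pow_succ',
      ← mul_assoc, ← (hℓ (horner a ℓ (s - 1))).eq, add_mul]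

lemma coreRow_lastCol_of_even (hm : m = p + 2 * N + 1) (hℓ : ∀ x, Commute ℓ x) (h : p ≤ s)
    (heven : (s - p) % 2 = 0) (hs : s < m) :
    ℓ * ∑ r ∈ Finset.range m, leadEntry a p s r * lastCol a p N ℓ r -
      ∑ r ∈ Finset.range m, constEntry a p s r * lastCol a p N ℓ r =
      if s + 1 = m then horner a ℓ m else 0 := by
  have hlast : lastCol a p N ℓ s = ℓ ^ (N - (s - p) / 2) := by
    rcases h.eq_or_lt with rfl | h
    · simp [lastCol]
    · rw [lastCol, if_neg (by omega), if_pos heven]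
  have hnext : horner a ℓ (s + 1) * ℓ ^ (N - (s - p) / 2) =
      ℓ * (horner a ℓ s * ℓ ^ (N - (s - p) / 2)) + a (s + 1) * ℓ ^ (N - (s - p) / 2) := by
    rw [horner_succ, add_mul, mul_assoc]
  rw [sum_leadEntry_mul_lastCol hm hℓ h heven hs, sum_constEntry_of_even a h heven hs, hlast,
    sub_add_eq_sub_sub, sub_neg_eq_add, ← hnext]
  by_cases hsm : s + 1 = m
  · rw [if_neg (by omega), if_pos hsm, hsm, show N - (s - p) / 2 = 0 by omega, pow_zero, mul_one,
      sub_zero]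
  · rw [if_pos (by omega), if_neg hsm, lastCol, if_neg (by omega), if_neg (by omega),
      show (s + 1 - p) / 2 = (s - p) / 2 by omega, sub_self]

lemma coreRow_lastCol (hm : m = p + 2 * N + 1) (hℓ : ∀ x, Commute ℓ x) (hs : s < m) :
    ℓ * ∑ r ∈ Finset.range m, leadEntry a p s r * lastCol a p N ℓ r -
      ∑ r ∈ Finset.range m, constEntry a p s r * lastCol a p N ℓ r =
      if s + 1 = m then horner a ℓ m else 0 := by
  rcases Nat.lt_or_ge s p with h | h
  · rw [if_neg (by omega), sub_eq_zero, coreRow_lastCol_of_lt (by omega) hℓ h]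
  · rcases Nat.mod_two_eq_zero_or_one (s - p) with heven | hodd
    · exact coreRow_lastCol_of_even hm hℓ h heven hs
    · rw [if_neg (by omega), sub_eq_zero, coreRow_lastCol_of_odd hm (by omega) hodd hs]

end LastCol

/-- The reversed Horner shift `a j + a (j + 1) μ + ⋯ + a m μ ^ (m - j)`, for central `μ`. -/
def revHorner (m : ℕ) (μ : S) (j : ℕ) : S := ∑ i ∈ Finset.range (m + 1 - j), μ ^ i * a (j + i)

lemma revHorner_eq_add_mul (μ : S) {j : ℕ} (hj : j ≤ m) :
    revHorner a m μ j = a j + μ * revHorner a m μ (j + 1) := by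
  rw [revHorner, revHorner, show m + 1 - j = m + 1 - (j + 1) + 1 by omega, Finset.sum_range_succ',
    Finset.mul_sum, add_comm]
  simp [pow_succ', mul_assoc, add_right_comm, ← add_assoc]

lemma revHorner_eq_add (μ : S) {j : ℕ} (hj : j < m) :
    revHorner a m μ j = a j + μ * (a (j + 1) +
      if j + 1 < m then μ * revHorner a m μ (j + 2) else 0) := by
  rw [revHorner_eq_add_mul a μ hj.le, revHorner_eq_add_mul a μ hj]
  split_ifs with h
  · rfl
  · rw [revHorner, show m + 1 - (j + 1 + 1) = 0 by omega, Finset.sum_range_zero, mul_zero]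

/-- The vector that `X' - μY'`, for the core pencil of index `p = 0`, maps to the first unit vector
times `a 0 + a 1 μ + ⋯ + a m μ ^ m`. -/
def firstCol (m : ℕ) (μ : S) (t : ℕ) : S :=
  if t % 2 = 0 then μ ^ (t / 2) else -(revHorner a m μ (t + 1) * μ ^ (t / 2 + 1))

section FirstCol

variable {a} {μ : S} {s : ℕ}

lemma sum_constEntry_mul_firstCol (hμ : ∀ x, Commute μ x) (heven : s % 2 = 0) (hs : s < m) :
    a s * μ ^ (s / 2) - μ * ∑ r ∈ Finset.range m, constEntry a 0 s r * firstCol a m μ r =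
      revHorner a m μ s * μ ^ (s / 2) := by
  have hnext : (if s + 1 < m then firstCol a m μ (s + 1) else 0) =
      -((if s + 1 < m then μ * revHorner a m μ (s + 2) else 0) * μ ^ (s / 2)) := by
    split_ifs with h
    · rw [firstCol, if_neg (by omega), show (s + 1) / 2 = s / 2 by omega, pow_succ',
        ← mul_assoc, ← (hμ (revHorner a m μ (s + 1 + 1))).eq]
    · simp
  rw [sum_constEntry_of_even a (Nat.zero_le s) (by omega) hs, hnext, firstCol, if_pos heven,
    revHorner_eq_add a μ hs]
  noncomm_ring

lemma sum_leadEntry_mul_firstCol (heven : s % 2 = 0) (hs : s < m) :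
    ∑ r ∈ Finset.range m, leadEntry a 0 s r * firstCol a m μ r =
      a s * μ ^ (s / 2) - if s = 0 then 0 else revHorner a m μ s * μ ^ (s / 2) := by
  rcases Nat.eq_zero_or_pos s with rfl | h0
  · rw [sum_leadEntry_of_le a hs le_rfl]
    simp [firstCol]
  · rw [sum_leadEntry_of_even a h0 (by omega) hs, firstCol, if_neg (by omega), firstCol,
      if_pos heven, if_neg (by omega), Nat.sub_add_cancel h0,
      show (s - 1) / 2 + 1 = s / 2 by omega, neg_add_eq_sub]

lemma coreRow_firstCol (hm : m = 2 * N + 1) (hμ : ∀ x, Commute μ x) (hs : s < m) :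
    ∑ r ∈ Finset.range m, leadEntry a 0 s r * firstCol a m μ r -
      μ * ∑ r ∈ Finset.range m, constEntry a 0 s r * firstCol a m μ r =
      if s = 0 then revHorner a m μ 0 else 0 := by
  rcases Nat.mod_two_eq_zero_or_one s with heven | hodd
  · rw [sum_leadEntry_mul_firstCol heven hs, sub_right_comm,
      sum_constEntry_mul_firstCol hμ heven hs]
    split_ifs with h
    · simp [h]
    · exact sub_self _
  · rw [sum_leadEntry_of_odd a (by omega) (by omega) (by omega),
      sum_constEntry_of_odd a (by omega) (by omega) hs, if_neg (by omega), sub_eq_zero, firstCol,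
      if_pos (by omega), firstCol, if_pos (by omega), ← pow_succ']
    congr 1
    omega

end FirstCol

end Rows

section CongFactorEntries

variable {S : Type*} [Ring S] {m p Z H g : ℕ} (a : ℕ → S)

/-- The entries of the matrix `congFactor`. -/
def congFactorEntry (p g s r : ℕ) : S :=
  if p ≤ s ∧ s < g then
    if (s - p) % 2 = 0 then (if r = s + 1 then 1 else 0)
    else (if r + 1 = s then 1 else if r = s then a s else 0)
  else if g < s then
    if (s - g) % 2 = 1 then (if r = s then -a (s + 1) else if r = s + 1 then 1 else 0)
    else (if r + 1 = s then 1 else 0)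
  else if r = s then 1 else 0

lemma congFactor_eq (hm : m = g + 1 + 2 * H) (hg : g = p + 2 * Z) :
    congFactor m a p Z g H = natMatrix m (congFactorEntry a p g) := by
  unfold congFactor negOdd posOdd posFactor negFactor
  rw [stepTwoProd_elemEntry _ _ _ (g + 2) _ (by omega),
    stepTwoProd_elemEntry_mul _ _ _ _ _ (by omega)]
  refine natMatrix_congr fun s r hs hr => ?_
  simp only [congFactorEntry, idEntry, mul_ite, mul_zero, mul_one]
  grind

lemma congFactorEntry_last_col {s : ℕ} (hm : m = g + 1 + 2 * H) (hg : g = p + 2 * Z) (hs : s < m) :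
    congFactorEntry a p g s (m - 1) = if s + 1 + (if H = 0 then 0 else 1) = m then 1 else 0 := by
  unfold congFactorEntry
  grind

lemma congFactorEntry_last_row {r : ℕ} (hm : m = g + 1 + 2 * H) (hr : r < m) :
    congFactorEntry a p g (m - 1) r = if r + 1 + (if H = 0 then 0 else 1) = m then 1 else 0 := by
  unfold congFactorEntry
  grind

lemma mul_apply_of_row_eq {A N : Matrix (Fin m) (Fin m) S} {s : Fin m}
    (h : ∀ k : Fin m, A s k = if (k : ℕ) = s then 1 else 0) (r : Fin m) : (A * N) s r = N s r := by
  rw [Matrix.mul_apply, Finset.sum_eq_single s]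
  · simp [h]
  · intro k _ hk
    rw [h, if_neg (fun h' => hk (Fin.ext h')), zero_mul]
  · simp

lemma stepTwoProd_elemEntry_row (u v : ℕ → S) (c N : ℕ) (hc : 0 < c) {s : Fin m}
    (hs : (s : ℕ) + 1 < c ∨ c + 2 * N ≤ s + 1) (k : Fin m) :
    stepTwoProd (fun t => natMatrix m (elemEntry t (u t) (v t))) c N s k =
      if (k : ℕ) = s then 1 else 0 := by
  rw [stepTwoProd_elemEntry m u v c N hc, natMatrix_apply, if_neg (by omega), idEntry]

lemma posOdd_row {s : Fin m} (hs : (s : ℕ) ≤ g) (k : Fin m) :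
    posOdd m a g H s k = if (k : ℕ) = s then 1 else 0 :=
  stepTwoProd_elemEntry_row _ _ _ _ (by omega) (by omega) k

lemma posEven_row {s : Fin m} (hs : (s : ℕ) < g) (k : Fin m) :
    posEven m a g H s k = if (k : ℕ) = s then 1 else 0 :=
  stepTwoProd_elemEntry_row _ _ _ _ (by omega) (by omega) k

lemma negOdd_row (hg : g = p + 2 * Z) {s : Fin m} (hs : g ≤ s) (k : Fin m) :
    negOdd m a p Z s k = if (k : ℕ) = s then 1 else 0 :=
  stepTwoProd_elemEntry_row _ _ _ _ (by omega) (by omega) k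

lemma negEven_row (hg : g = p + 2 * Z) {s : Fin m} (hs : g < s) (k : Fin m) :
    negEven m a p Z s k = if (k : ℕ) = s then 1 else 0 :=
  stepTwoProd_elemEntry_row _ _ _ _ (by omega) (by omega) k

lemma hankelEntry_row {s : Fin m} (hs : p ≤ s) (k : Fin m) :
    natMatrix m (hankelEntry a p) s k = if (k : ℕ) = s then 1 else 0 := by
  rw [natMatrix_apply, hankelEntry, if_neg (by omega), idEntry]

lemma congFactor_mul_leadEntry_mul_congFactor_apply (hm : m = g + 1 + 2 * H) (hg : g = p + 2 * Z)
    {s : Fin m} (hs : g < s) (r : Fin m) :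
    (congFactor m a p Z g H * natMatrix m (leadEntry a p) * congFactor m a p Z g H) s r =
      congFactorEntry a p g s r := by
  have h : congFactor m a p Z g H * natMatrix m (leadEntry a p) * congFactor m a p Z g H =
      negOdd m a p Z * (negEven m a p Z *
        (natMatrix m (hankelEntry a (p + 1)) * natMatrix m (congFactorEntry a p g))) := by
    rw [← congFactor_eq a hm hg, ← mul_assoc (negEven m a p Z), ← posOdd_mul_leadEntry m a hg hm,
      congFactor]
    simp only [mul_assoc]
  rw [h, mul_apply_of_row_eq (negOdd_row a hg hs.le), mul_apply_of_row_eq (negEven_row a hg hs),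
    mul_apply_of_row_eq (hankelEntry_row a (by omega)), natMatrix_apply]

lemma congFactor_mul_constEntry_mul_congFactor_apply (hm : m = g + 1 + 2 * H) (hg : g = p + 2 * Z)
    {s : Fin m} (hs : p ≤ s) (hs' : s < g) (r : Fin m) :
    (congFactor m a p Z g H * natMatrix m (constEntry a p) * congFactor m a p Z g H) s r =
      congFactorEntry a p g s r := by
  have h : congFactor m a p Z g H * natMatrix m (constEntry a p) * congFactor m a p Z g H =
      posOdd m a g H * (posEven m a g H *
        (posOdd m a g H * (natMatrix m (hankelEntry a p) * negOdd m a p Z))) := by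
    rw [← congFactor_mul_constEntry_mul_congFactor a hm hg,
      (commute_hankelEntry_negOdd (m := m) (Z := Z) a (p := p) (by omega)).eq]
    simp only [mul_assoc]
  have h' := congFactor_eq a hm hg
  rw [congFactor, (commute_negOdd_posOdd (m := m) (H := H) a hg).eq] at h'
  rw [h, mul_apply_of_row_eq (posOdd_row a hs'.le), mul_apply_of_row_eq (posEven_row a hs'),
    mul_apply_of_row_eq (posOdd_row a hs'.le), mul_apply_of_row_eq (hankelEntry_row a hs),
    ← natMatrix_apply m (congFactorEntry a p g), ← h', mul_apply_of_row_eq (posOdd_row a hs'.le)]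

end CongFactorEntries

section IntDiag

variable {S : Type*} [Ring S] {m p Z H g : ℕ} {a : ℕ → S} {δ : ℕ → ℤ}

/-- The diagonal matrix with the integers `δ 0, δ 1, …` on the diagonal. -/
def intDiag (m : ℕ) (δ : ℕ → ℤ) : Matrix (Fin m) (Fin m) S :=
  Matrix.diagonal fun s => ((δ s : ℤ) : S)

lemma commute_intDiag_iff [IsAddTorsionFree S] {M : Matrix (Fin m) (Fin m) S} :
    Commute (intDiag m δ) M ↔ ∀ s r : Fin m, δ s = δ r ∨ M s r = 0 := by
  rw [Commute, SemiconjBy, ← Matrix.ext_iff]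
  refine forall₂_congr fun s r => ?_
  rw [intDiag, Matrix.diagonal_mul, Matrix.mul_diagonal, ← ((δ r).cast_commute _).eq,
    ← sub_eq_zero, ← sub_mul, ← Int.cast_sub, ← zsmul_eq_mul, smul_eq_zero, sub_eq_zero]

lemma commute_of_commute_mul_mul {M : Type*} [Monoid M] {u x y : M} (hu : IsUnit u)
    (hxu : Commute x u) (h : Commute x (u * y * u)) : Commute x y := by
  obtain ⟨u, rfl⟩ := hu
  simpa [mul_assoc] using (hxu.units_inv_right.mul_right h).mul_right hxu.units_inv_right

variable [IsAddTorsionFree S]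

lemma commute_intDiag_congFactor (hm : m = g + 1 + 2 * H) (hg : g = p + 2 * Z)
    (hlow : ∀ s, g < s → s + 1 < m → (s - g) % 2 = 1 → δ s = δ (s + 1))
    (hmid : ∀ s, p ≤ s → s < g → (s - p) % 2 = 0 → δ s = δ (s + 1)) :
    Commute (intDiag m δ) (congFactor m a p Z g H) := by
  have hlink : ∀ s, s + 1 < m → δ s = δ (s + 1) ∨
      (congFactorEntry a p g s (s + 1) = 0 ∧ congFactorEntry a p g (s + 1) s = 0) := fun s hs => by
    by_cases h2 : p ≤ s ∧ s < g ∧ (s - p) % 2 = 0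
    · exact Or.inl (hmid s h2.1 h2.2.1 h2.2.2)
    by_cases h3 : g < s ∧ (s - g) % 2 = 1
    · exact Or.inl (hlow s h3.1 hs h3.2)
    refine Or.inr ⟨?_, ?_⟩ <;> unfold congFactorEntry <;> split_ifs <;> first | omega | rfl
  rw [commute_intDiag_iff, congFactor_eq a hm hg]
  rintro ⟨s, hs⟩ ⟨r, hr⟩
  rw [natMatrix_apply]
  change δ s = δ r ∨ congFactorEntry a p g s r = 0
  by_cases hrs : r = s
  · exact Or.inl (by rw [hrs])
  by_cases hrs' : r + 1 = s
  · subst hrs'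
    exact (hlink r hs).imp Eq.symm And.right
  by_cases hsr : s + 1 = r
  · subst hsr
    exact (hlink s hr).imp_right And.left
  · right
    unfold congFactorEntry
    split_ifs <;> first | omega | rfl

section

variable [Nontrivial S]

lemma eq_succ_of_commute_lead_of_lt (hm : m = g + 1 + 2 * H) (hg : g = p + 2 * Z)
    (hX : Commute (intDiag m δ)
      (congFactor m a p Z g H * natMatrix m (leadEntry a p) * congFactor m a p Z g H))
    {s : ℕ} (hs : g < s) (hs' : s + 1 < m) (hodd : (s - g) % 2 = 1) : δ s = δ (s + 1) := by
  refine (commute_intDiag_iff.1 hX ⟨s, by omega⟩ ⟨s + 1, hs'⟩).resolve_right ?_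
  rw [congFactor_mul_leadEntry_mul_congFactor_apply a hm hg hs, congFactorEntry,
    if_neg (by simp only; omega), if_pos hs, if_pos hodd, if_neg (by simp), if_pos rfl]
  exact one_ne_zero

lemma eq_succ_of_commute_const_of_lt (hm : m = g + 1 + 2 * H) (hg : g = p + 2 * Z)
    (hY : Commute (intDiag m δ)
      (congFactor m a p Z g H * natMatrix m (constEntry a p) * congFactor m a p Z g H))
    {s : ℕ} (hs : p ≤ s) (hs' : s < g) (heven : (s - p) % 2 = 0) : δ s = δ (s + 1) := by
  refine (commute_intDiag_iff.1 hY ⟨s, by omega⟩ ⟨s + 1, by omega⟩).resolve_right ?_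
  rw [congFactor_mul_constEntry_mul_congFactor_apply a hm hg hs hs', congFactorEntry,
    if_pos ⟨hs, hs'⟩, if_pos heven, if_pos rfl]
  exact one_ne_zero

lemma eq_succ_of_commute_core (ha : a 0 ≠ 0)
    (hX : Commute (intDiag m δ) (natMatrix m (leadEntry a p)))
    (hY : Commute (intDiag m δ) (natMatrix m (constEntry a p))) {s : ℕ} (hpm : p < m)
    (hs : s + 1 < m) : δ s = δ (s + 1) := by
  have hX' : ∀ s r, s < m → r < m → leadEntry a p s r ≠ 0 → δ s = δ r := fun s r hs hr =>
    (commute_intDiag_iff.1 hX ⟨s, hs⟩ ⟨r, hr⟩).resolve_right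
  have hY' : ∀ s r, s < m → r < m → constEntry a p s r ≠ 0 → δ s = δ r := fun s r hs hr =>
    (commute_intDiag_iff.1 hY ⟨s, hs⟩ ⟨r, hr⟩).resolve_right
  rcases Nat.lt_or_ge s p with h | h
  · refine (hY' s (p - 1 - s) (by omega) (by omega) ?_).trans
      (hX' (p - 1 - s) (s + 1) (by omega) hs ?_)
    · rwa [constEntry, if_pos (by omega), if_pos (by omega),
        show s + (p - 1 - s) + 1 - p = 0 by omega]
    · rwa [leadEntry, if_pos (by omega), if_pos (by omega),
        show p - 1 - s + (s + 1) - p = 0 by omega]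
  · rcases Nat.mod_two_eq_zero_or_one (s - p) with h' | h'
    · refine hY' s (s + 1) (by omega) hs ?_
      rw [constEntry, if_neg (by omega), if_neg (by omega), if_pos h', if_neg (by omega),
        if_pos rfl]
      exact one_ne_zero
    · refine hX' s (s + 1) (by omega) hs ?_
      rw [leadEntry, if_neg (by omega), if_neg (by omega), if_neg (by omega), if_pos rfl]
      exact one_ne_zero

end

lemma intDiag_const_of_commute (ha : a 0 ≠ 0) (hm : m = g + 1 + 2 * H)
    (hg : g = p + 2 * Z)
    (hX : Commute (intDiag m δ)
      (congFactor m a p Z g H * natMatrix m (leadEntry a p) * congFactor m a p Z g H))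
    (hY : Commute (intDiag m δ)
      (congFactor m a p Z g H * natMatrix m (constEntry a p) * congFactor m a p Z g H))
    {s : ℕ} (hs : s < m) : δ s = δ 0 := by
  have := nontrivial_of_ne _ _ ha
  have hO : Commute (intDiag m δ) (congFactor m a p Z g H) := commute_intDiag_congFactor hm hg
    (fun _ => eq_succ_of_commute_lead_of_lt hm hg hX)
    (fun _ => eq_succ_of_commute_const_of_lt hm hg hY)
  have hu := isUnit_congFactor a hm hg
  have hstep : ∀ s, s + 1 < m → δ s = δ (s + 1) := fun s =>
    eq_succ_of_commute_core ha (commute_of_commute_mul_mul hu hO hX)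
      (commute_of_commute_mul_mul hu hO hY) (by omega)
  induction s with
  | zero => rfl
  | succ s ih => rw [← hstep s hs, ih (by omega)]

end IntDiag

section Signs

/-- The signs `σ` for which `diag(σ) (λX' - Y')`, with `λX' - Y'` the core pencil, is `T`-odd. -/
def coreSign (p s : ℕ) : ℤˣ := if s ≤ p then (-1) ^ s else (-1) ^ (p + (s - p + 1) / 2)

/-- The signs of the quasi-identity matrix `Q` for which `Q L(λ)` is `T`-odd. -/
def gfprSign (p g s : ℕ) : ℤˣ := if p ≤ s ∧ s < g then -coreSign p s else coreSign p s

lemma coreSign_succ_of_even {p s : ℕ} (h : p ≤ s) (h' : (s - p) % 2 = 0) :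
    coreSign p (s + 1) = -coreSign p s := by
  unfold coreSign
  rw [if_neg (by omega)]
  split_ifs with h1
  · obtain rfl : s = p := by omega
    rw [show s + (s + 1 - s + 1) / 2 = s + 1 by omega, pow_succ, mul_neg_one]
  · rw [show p + (s + 1 - p + 1) / 2 = p + (s - p + 1) / 2 + 1 by omega, pow_succ, mul_neg_one]

lemma coreSign_succ_of_odd {p s : ℕ} (h : p < s) (h' : (s - p) % 2 = 1) :
    coreSign p (s + 1) = coreSign p s := by
  unfold coreSign
  rw [if_neg (by omega), if_neg (by omega)]
  congr 1
  omega

variable {n m p Z H N g : ℕ} {a : ℕ → Matrix (Fin n) (Fin n) ℂ}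

lemma coreSign_smul_leadEntry (hm : m = p + 2 * N + 1)
    (ha : ∀ t ≤ m, (a t)ᵀ = (-1 : ℤˣ) ^ (m + t + 1) • a t) {s r : ℕ} (hs : s < m) (hr : r < m) :
    coreSign p s • leadEntry a p s r = coreSign p r • (leadEntry a p r s)ᵀ := by
  unfold leadEntry
  by_cases h1 : s ≤ p ∧ r ≤ p
  · rw [if_pos h1, if_pos h1.symm]
    by_cases h2 : p ≤ s + r
    · rw [if_pos h2, if_pos (by omega), show r + s = s + r by ring, ha _ (by omega), smul_smul,
        coreSign, coreSign, if_pos h1.1, if_pos h1.2, ← pow_add]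
      congr 1
      rw [show r + (m + (s + r - p) + 1) = s + 2 * (r + N + 1) by omega, pow_add _ s, pow_mul]
      simp
    · rw [if_neg h2, if_neg (by omega)]
      simp
  · rw [if_neg h1, if_neg (show ¬ (r ≤ p ∧ s ≤ p) from fun h => h1 h.symm)]
    by_cases h2 : s ≤ p ∨ r ≤ p
    · rw [if_pos h2, if_pos h2.symm]
      simp
    · rw [if_neg h2, if_neg (show ¬ (r ≤ p ∨ s ≤ p) from fun h => h2 h.symm)]
      rcases Nat.lt_trichotomy r s with h | h | h
      · by_cases h4 : r + 1 = s
        · subst h4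
          have := @coreSign_succ_of_odd p r (by omega)
          grind [Matrix.transpose_zero, Matrix.transpose_one, smul_zero, neg_neg]
        · grind [Matrix.transpose_zero, Matrix.transpose_one, smul_zero, neg_neg]
      · subst h
        by_cases h3 : (r - p) % 2 = 0
        · rw [if_pos h3, if_pos rfl, ha r hr.le, Even.neg_one_pow (by grind), one_smul]
        · rw [if_neg h3, if_neg (by omega), transpose_zero]
      · by_cases h4 : s + 1 = r
        · subst h4
          have := @coreSign_succ_of_odd p s (by omega)
          grind [Matrix.transpose_zero, Matrix.transpose_one, smul_zero, neg_neg]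
        · grind [Matrix.transpose_zero, Matrix.transpose_one, smul_zero, neg_neg]

lemma coreSign_smul_constEntry (hm : m = p + 2 * N + 1)
    (ha : ∀ t ≤ m, (a t)ᵀ = (-1 : ℤˣ) ^ (m + t + 1) • a t) {s r : ℕ} (hs : s < m) (hr : r < m) :
    coreSign p s • constEntry a p s r = (-coreSign p r) • (constEntry a p r s)ᵀ := by
  unfold constEntry
  by_cases h1 : s < p ∧ r < p
  · rw [if_pos h1, if_pos h1.symm]
    by_cases h2 : p ≤ s + r + 1
    · rw [if_pos h2, if_pos (by omega), show r + s = s + r by ring, ha _ (by omega), smul_smul,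
        coreSign, coreSign, if_pos (by omega), if_pos (by omega), neg_mul, ← pow_add]
      congr 1
      rw [← mul_neg_one (_ ^ (r + _)), ← pow_succ,
          show r + (m + (s + r + 1 - p) + 1) + 1 = s + 2 * (r + N + 2) by omega, pow_add _ s,
        pow_mul]
      simp
    · rw [if_neg h2, if_neg (by omega)]
      simp
  · rw [if_neg h1, if_neg (show ¬ (r < p ∧ s < p) from fun h => h1 h.symm)]
    by_cases h2 : s < p ∨ r < p
    · rw [if_pos h2, if_pos h2.symm]
      simp
    · rw [if_neg h2, if_neg (show ¬ (r < p ∨ s < p) from fun h => h2 h.symm)]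
      rcases Nat.lt_trichotomy r s with h | h | h
      · by_cases h4 : r + 1 = s
        · subst h4
          have := @coreSign_succ_of_even p r (by omega)
          grind [Matrix.transpose_zero, Matrix.transpose_one, smul_zero, neg_neg]
        · grind [Matrix.transpose_zero, Matrix.transpose_one, smul_zero, neg_neg]
      · subst h
        by_cases h3 : (r - p) % 2 = 0
        · rw [if_pos h3, if_pos rfl, transpose_neg, ha (r + 1) hr, Odd.neg_one_pow (by grind)]
          simp [Units.smul_def]
        · rw [if_neg h3, if_neg (by omega), transpose_zero]
          simp
      · by_cases h4 : s + 1 = r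
        · subst h4
          have := @coreSign_succ_of_even p s (by omega)
          grind [Matrix.transpose_zero, Matrix.transpose_one, smul_zero, neg_neg]
        · grind [Matrix.transpose_zero, Matrix.transpose_one, smul_zero, neg_neg]

lemma gfprSign_smul_congFactorEntry (hm : m = g + 1 + 2 * H) (hg : g = p + 2 * Z)
    (ha : ∀ t ≤ m, (a t)ᵀ = (-1 : ℤˣ) ^ (m + t + 1) • a t) {s r : ℕ} (hs : s < m) (hr : r < m) :
    gfprSign p g s • congFactorEntry a p g s r = coreSign p r • (congFactorEntry a p g r s)ᵀ := by
  unfold congFactorEntry gfprSign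
  rcases Nat.lt_trichotomy r s with h | h | h
  · by_cases h4 : r + 1 = s
    · subst h4
      have := @coreSign_succ_of_even p r
      have := @coreSign_succ_of_odd p r
      grind [Matrix.transpose_zero, Matrix.transpose_one, smul_zero, neg_neg]
    · grind [Matrix.transpose_zero, Matrix.transpose_one, smul_zero, neg_neg]
  · subst h
    by_cases h1 : p ≤ r ∧ r < g
    · rw [if_pos h1, if_pos h1]
      by_cases h3 : (r - p) % 2 = 0
      · rw [if_pos h3, if_neg (by omega), transpose_zero]
        simp
      · rw [if_neg h3, if_neg (by omega), if_pos rfl, ha r hr.le, Odd.neg_one_pow (by grind)]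
        simp [Units.smul_def]
    · rw [if_neg h1, if_neg h1]
      by_cases h2 : g < r
      · rw [if_pos h2]
        by_cases h3 : (r - g) % 2 = 1
        · rw [if_pos h3, if_pos rfl, transpose_neg, ha (r + 1) hr, Even.neg_one_pow (by grind),
            one_smul]
        · rw [if_neg h3, if_neg (by omega), transpose_zero]
      · rw [if_neg h2, if_pos rfl, transpose_one]
  · by_cases h4 : s + 1 = r
    · subst h4
      have := @coreSign_succ_of_even p s
      have := @coreSign_succ_of_odd p s
      grind [Matrix.transpose_zero, Matrix.transpose_one, smul_zero, neg_neg]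
    · grind [Matrix.transpose_zero, Matrix.transpose_one, smul_zero, neg_neg]

end Signs

section UpdateCol

variable {S ι : Type*} [Ring S] [Fintype ι] [DecidableEq ι]

lemma mul_one_updateCol (T : Matrix ι ι S) (c : ι) (x : ι → S) :
    T * (1 : Matrix ι ι S).updateCol c x = T.updateCol c (T *ᵥ x) := by
  ext s r
  by_cases h : r = c
  · subst h
    simp [Matrix.mul_apply, Matrix.mulVec, dotProduct]
  · simp [Matrix.mul_apply, Matrix.updateCol_ne h, Matrix.one_apply]

lemma updateCol_mul_diagonal (T : Matrix ι ι S) (c : ι) (x : S) :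
    T.updateCol c (Pi.single c 1) * Matrix.diagonal (Function.update 1 c x) =
      T.updateCol c (Pi.single c x) := by
  ext s r
  rw [Matrix.mul_diagonal]
  by_cases h : r = c
  · subst h
    by_cases hs : s = r
    · subst hs; simp
    · simp [hs]
  · simp [h]

lemma updateCol_mulVec (T : Matrix ι ι S) (c : ι) (x W : ι → S) (s : ι) :
    (T.updateCol c x *ᵥ W) s = (T *ᵥ Function.update W c 0) s + x s * W c := by
  have hterm : ∀ r, T.updateCol c x s r * W r =
      T s r * Function.update W c 0 r + if r = c then x s * W c else 0 := fun r => by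
    by_cases h : r = c
    · subst h; simp
    · simp [h]
  simp only [Matrix.mulVec, dotProduct, hterm, Finset.sum_add_distrib, Finset.sum_ite_eq',
    Finset.mem_univ, if_true]

lemma isUnit_one_updateCol (c : ι) (x : ι → S) (hx : x c = 1) :
    IsUnit ((1 : Matrix ι ι S).updateCol c x) := by
  have hmul : ∀ x y : ι → S, x c = 1 → y c = 1 → (∀ s, s ≠ c → y s + x s = 0) →
      (1 : Matrix ι ι S).updateCol c x * (1 : Matrix ι ι S).updateCol c y = 1 := by
    intro x y hx hy hxy
    ext s r
    rw [mul_one_updateCol]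
    by_cases hr : r = c
    · subst hr
      rw [Matrix.updateCol_self, updateCol_mulVec, Matrix.one_mulVec, hy, mul_one]
      by_cases hs : s = r
      · subst hs; simp [hx]
      · simp [hs, hxy s hs]
    · rw [Matrix.updateCol_ne hr, Matrix.updateCol_ne hr]
  let y := Function.update (-x) c 1
  exact ⟨⟨_, _, hmul x y hx (by simp [y]) fun s hs => by simp [y, hs],
    hmul y x (by simp [y]) hx fun s hs => by simp [y, hs]⟩, rfl⟩

lemma eq_zero_of_updateCol_single_mulVec (T : Matrix ι ι S) (c : ι)
    (hT : ∀ W : ι → S, W c = 0 → (∀ s, s ≠ c → (T *ᵥ W) s = 0) → W = 0) (W : ι → S)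
    (hW : T.updateCol c (Pi.single c 1) *ᵥ W = 0) : W = 0 := by
  have hrow : ∀ s, (T *ᵥ Function.update W c 0) s + Pi.single (M := fun _ => S) c 1 s * W c = 0 :=
    fun s => by rw [← updateCol_mulVec, hW, Pi.zero_apply]
  have hupdate : Function.update W c 0 = 0 :=
    hT _ (Function.update_self ..) fun s hs => by simpa [hs] using hrow s
  have hWc : W c = 0 := by simpa [hupdate] using hrow c
  rw [← hupdate, ← hWc, Function.update_eq_self]

end UpdateCol

section CorePencil

variable {S : Type*} [Ring S] {m p N : ℕ}

/-- The core pencil `αX' - βY'`; both the finite structure (`β = 1`) and the structure at infinity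
(`α = 1`) of `L(λ)` are read off from it. -/
def corePencil (m : ℕ) (a : ℕ → S) (p : ℕ) (α β : S) : Matrix (Fin m) (Fin m) S :=
  natMatrix m fun s r => α * leadEntry a p s r - β * constEntry a p s r

lemma natMatrix_mulVec (f : ℕ → ℕ → S) (W : ℕ → S) (s : Fin m) :
    (natMatrix m f *ᵥ fun r : Fin m => W r) s = ∑ r ∈ Finset.range m, f s r * W r :=
  Fin.sum_univ_eq_sum_range (fun r => f s r * W r) m

lemma corePencil_mulVec (a : ℕ → S) (p : ℕ) (α β : S) (W : ℕ → S) (s : Fin m) :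
    (corePencil m a p α β *ᵥ fun r : Fin m => W r) s =
      α * ∑ r ∈ Finset.range m, leadEntry a p s r * W r -
        β * ∑ r ∈ Finset.range m, constEntry a p s r * W r := by
  simp only [corePencil, natMatrix_mulVec, sub_mul, mul_assoc, Finset.sum_sub_distrib,
    Finset.mul_sum]

lemma exists_nat_extension (W : Fin m → S) : ∃ W' : ℕ → S, W = fun r : Fin m => W' r :=
  ⟨Function.extend Fin.val W 0, funext fun r => (Fin.val_injective.extend_apply W 0 r).symm⟩

lemma eq_zero_of_corePencil_updateCol_mulVec (a : ℕ → S) (hm : m = p + 2 * N + 1) (ℓ : S)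
    (hℓ : ∀ x, Commute ℓ x) (ha : p ≠ 0 → ∀ x, a 0 * x = 0 → x = 0) (c : Fin m)
    (hc : (c : ℕ) + 1 = m) (W : Fin m → S)
    (hW : (corePencil m a p ℓ 1).updateCol c (Pi.single c 1) *ᵥ W = 0) : W = 0 := by
  refine eq_zero_of_updateCol_single_mulVec _ c (fun W hWc hrow => ?_) W hW
  obtain ⟨W, rfl⟩ := exists_nat_extension W
  have hker : IsCoreKernel a m p ℓ W := fun s hs => by
    have hsc : (⟨s, by omega⟩ : Fin m) ≠ c := fun h => by simp [← h] at hc; omega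
    simpa [corePencil_mulVec, sub_eq_zero] using hrow _ hsc
  have hlast : W (m - 1) = 0 := by
    rwa [← hc, Nat.add_sub_cancel]
  exact funext fun r => hker.eq_zero hm hlast hℓ ha r.2

lemma eq_zero_of_natMatrix_leadEntry_mulVec (a : ℕ → S) (hm : m = p + 2 * N + 1)
    (ha : ∀ x, a 0 * x = 0 → x = 0) (W : Fin m → S)
    (hW : natMatrix m (leadEntry a p) *ᵥ W = 0) : W = 0 := by
  obtain ⟨W, rfl⟩ := exists_nat_extension W
  refine funext fun r => eq_zero_of_sum_leadEntry_mul a hm ha W (fun s hs => ?_) r.2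
  rw [← natMatrix_mulVec _ W ⟨s, hs⟩, hW, Pi.zero_apply]

lemma map_leadEntry {S' : Type*} [Ring S'] (ψ : S →+* S') (a : ℕ → S) (p s r : ℕ) :
    ψ (leadEntry a p s r) = leadEntry (fun t => ψ (a t)) p s r := by
  unfold leadEntry
  split_ifs <;> simp

lemma map_constEntry {S' : Type*} [Ring S'] (ψ : S →+* S') (a : ℕ → S) (p s r : ℕ) :
    ψ (constEntry a p s r) = constEntry (fun t => ψ (a t)) p s r := by
  unfold constEntry
  split_ifs <;> simp

lemma corePencil_mul_lastCol (a : ℕ → S) (hm : m = p + 2 * N + 1) (ℓ : S)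
    (hℓ : ∀ x, Commute ℓ x) (c : Fin m) (hc : (c : ℕ) + 1 = m) :
    corePencil m a p ℓ 1 * (1 : Matrix (Fin m) (Fin m) S).updateCol c
        (fun r => lastCol a p N ℓ r) =
      (corePencil m a p ℓ 1).updateCol c (Pi.single c 1) *
        Matrix.diagonal (Function.update 1 c (horner a ℓ m)) := by
  rw [mul_one_updateCol, updateCol_mul_diagonal]
  congr 1
  funext s
  rw [corePencil_mulVec, one_mul, coreRow_lastCol hm hℓ s.2]
  by_cases h : s = c
  · subst h; rw [if_pos hc, Pi.single_eq_same]
  · rw [if_neg (fun h' => h (Fin.ext (by omega))), Pi.single_eq_of_ne h]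

lemma lastCol_last (a : ℕ → S) (hm : m = p + 2 * N + 1) (ℓ : S) {c : ℕ}
    (hc : c + 1 = m) : lastCol a p N ℓ c = 1 := by
  unfold lastCol
  split_ifs with h1 h2
  · rw [show p - c + N = 0 by omega, pow_zero]
  · rw [show N - (c - p) / 2 = 0 by omega, pow_zero]
  · omega

lemma corePencil_mul_firstCol (a : ℕ → S) (hm : m = 2 * N + 1) (μ : S)
    (hμ : ∀ x, Commute μ x) (c : Fin m) (hc : (c : ℕ) = 0) :
    corePencil m a 0 1 μ * (1 : Matrix (Fin m) (Fin m) S).updateCol c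
        (fun r => firstCol a m μ r) =
      (corePencil m a 0 1 μ).updateCol c (Pi.single c 1) *
        Matrix.diagonal (Function.update 1 c (revHorner a m μ 0)) := by
  rw [mul_one_updateCol, updateCol_mul_diagonal]
  congr 1
  funext s
  rw [corePencil_mulVec, one_mul, coreRow_firstCol hm hμ s.2]
  by_cases h : s = c
  · subst h; rw [if_pos hc, Pi.single_eq_same]
  · rw [if_neg (fun h' => h (Fin.ext (by omega))), Pi.single_eq_of_ne h]

end CorePencil

section Flat

variable {m n : ℕ}

lemma det_comp_ne_zero {K : Type*} [Field K] (M : Matrix (Fin m) (Fin m) (Matrix (Fin n) (Fin n) K))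
    (hM : ∀ W, M *ᵥ W = 0 → W = 0) : (compRingEquiv (Fin m) (Fin n) K M).det ≠ 0 := by
  intro h
  obtain ⟨v, hv0, hv⟩ := Matrix.exists_mulVec_eq_zero_iff.2 h
  refine hv0 ?_
  have := hM (fun s => Matrix.of fun x _ => v (s, x)) ?_
  · funext ⟨s, x⟩
    have h1 := congrFun (congrFun (congrFun this s) x) x
    simpa using h1
  · funext s
    ext x y
    have h1 := congrFun hv (s, x)
    simp only [Matrix.mulVec, dotProduct, compRingEquiv_apply, comp_apply,
      Fintype.sum_prod_type, Pi.zero_apply] at h1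
    simp only [Matrix.mulVec, dotProduct, Matrix.sum_apply, Matrix.mul_apply, of_apply,
      Pi.zero_apply, Matrix.zero_apply]
    exact h1

variable {R : Type} [CommRing R] {r : ℕ}

lemma comp_mul_blockCol (N : Matrix (Fin m) (Fin m) (Matrix (Fin n) (Fin n) R)) {c k : Fin m}
    (h : ∀ s, N s c = if s = k then 1 else 0) (C : Matrix (Fin n) (Fin r) R) {c' k' : ℤ}
    (hc : c' = (c : ℕ) + 1) (hk : k' = (k : ℕ) + 1) :
    compRingEquiv (Fin m) (Fin n) R N * blockCol m c' C = blockCol m k' C := by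
  subst hc hk
  ext ⟨s, x⟩ y
  simp only [Matrix.mul_apply, Fintype.sum_prod_type, compRingEquiv_apply, comp_apply, blockCol,
    of_apply]
  rw [Finset.sum_eq_single c]
  · by_cases hs : s = k
    · simp [h, hs, Matrix.one_apply]
    · have : (s : ℕ) ≠ k := fun h' => hs (Fin.ext h')
      simp [h, hs, this]
  · intro b _ hb
    have : (b : ℕ) ≠ c := fun h' => hb (Fin.ext h')
    simp [this]
  · simp

lemma blockRow_mul_comp (N : Matrix (Fin m) (Fin m) (Matrix (Fin n) (Fin n) R)) {c k : Fin m}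
    (h : ∀ s, N c s = if s = k then 1 else 0) (B : Matrix (Fin r) (Fin n) R) {c' k' : ℤ}
    (hc : c' = (c : ℕ) + 1) (hk : k' = (k : ℕ) + 1) :
    blockRow m c' B * compRingEquiv (Fin m) (Fin n) R N = blockRow m k' B := by
  subst hc hk
  ext y ⟨s, x⟩
  simp only [Matrix.mul_apply, Fintype.sum_prod_type, compRingEquiv_apply, comp_apply, blockRow,
    of_apply]
  rw [Finset.sum_eq_single c]
  · by_cases hs : s = k
    · simp [h, hs, Matrix.one_apply]
    · have : (s : ℕ) ≠ k := fun h' => hs (Fin.ext h')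
      simp [h, hs, this]
  · intro b _ hb
    have : (b : ℕ) ≠ c := fun h' => hb (Fin.ext h')
    simp [this]
  · simp

lemma idOplus_eq {c : Fin m} (hc : (c : ℕ) + 1 = m) (P : Matrix (Fin n) (Fin n) R) :
    idOplus m P = compRingEquiv (Fin m) (Fin n) R (Matrix.diagonal (Function.update 1 c P)) := by
  ext ⟨s, x⟩ ⟨t, y⟩
  simp only [idOplus, of_apply, compRingEquiv_apply, comp_apply, Matrix.diagonal_apply]
  by_cases hst : s = t
  · subst hst
    by_cases hs : s = c
    · subst hs; simp [hc]
    · have : (s : ℕ) + 1 ≠ m := fun h => hs (Fin.ext (by omega))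
      simp [hs, this]
  · simp [hst]

end Flat

section Pencils

variable {ι κ τ : Type}

lemma constPoly_mul [Fintype κ] (M : Matrix ι κ ℂ) (N : Matrix κ τ ℂ) :
    constPoly (M * N) = constPoly M * constPoly N := by
  simp [constPoly, Matrix.map_mul]

lemma constPoly_one [DecidableEq ι] : constPoly (1 : Matrix ι ι ℂ) = 1 := by
  simp [constPoly]

lemma constPoly_neg (M : Matrix ι κ ℂ) : constPoly (-M) = -constPoly M := by
  ext; simp [constPoly]

lemma constPoly_add (M N : Matrix ι κ ℂ) : constPoly (M + N) = constPoly M + constPoly N := by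
  ext; simp [constPoly]

lemma constPoly_injective : Function.Injective (constPoly : Matrix ι κ ℂ → _) :=
  Matrix.map_injective Polynomial.C_injective

lemma constPoly_mul_pencil [Fintype κ] (M : Matrix ι κ ℂ) (Y Z : Matrix κ τ ℂ) :
    constPoly M * pencil Y Z = pencil (M * Y) (M * Z) := by
  simp only [pencil, Matrix.mul_add, Matrix.mul_smul, constPoly_mul]

lemma pencil_mul_constPoly [Fintype κ] (M : Matrix κ τ ℂ) (Y Z : Matrix ι κ ℂ) :
    pencil Y Z * constPoly M = pencil (Y * M) (Z * M) := by
  simp only [pencil, Matrix.add_mul, Matrix.smul_mul, constPoly_mul]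

lemma pencil_inj {Y Z Y' Z' : Matrix ι κ ℂ} : pencil Y Z = pencil Y' Z' ↔ Y = Y' ∧ Z = Z' := by
  constructor
  · intro h
    have hc : ∀ i j (d : ℕ), (pencil Y Z i j).coeff d = (pencil Y' Z' i j).coeff d := by simp [h]
    refine ⟨Matrix.ext fun i j => ?_, Matrix.ext fun i j => ?_⟩
    · have h1 : ∀ c d : ℂ, (X * Polynomial.C c + Polynomial.C d).coeff 1 = c := fun c d => by
        rw [Polynomial.coeff_add, mul_comm, Polynomial.coeff_C_mul, Polynomial.coeff_X_one,
          Polynomial.coeff_C_succ, mul_one, add_zero]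
      have h2 := hc i j 1
      simp only [pencil, constPoly, Matrix.add_apply, Matrix.smul_apply, Matrix.map_apply,
        smul_eq_mul, h1] at h2
      exact h2
    · simpa [pencil, constPoly] using hc i j 0
  · rintro ⟨rfl, rfl⟩; rfl

lemma isTOddPoly_pencil {Y Z : Matrix ι ι ℂ} :
    IsTOddPoly (pencil Y Z) ↔ Yᵀ = Y ∧ Zᵀ = -Z := by
  have h1 : (pencil Y Z)ᵀ.map (fun f => f.comp (-X)) = pencil (-Yᵀ) Zᵀ := by
    ext1 i j
    simp [pencil, constPoly]
  have h2 : -pencil Y Z = pencil (-Y) (-Z) := by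
    ext1 i j
    simp [pencil, constPoly]
    ring
  rw [IsTOddPoly, h1, h2, pencil_inj, neg_inj]

lemma isUnimodular_of_isUnit [Fintype ι] [DecidableEq ι] {U : Matrix ι ι ℂ[X]} (h : IsUnit U) :
    IsUnimodular U := by
  rw [Matrix.isUnit_iff_isUnit_det, Polynomial.isUnit_iff] at h
  obtain ⟨c, hc, h⟩ := h
  exact ⟨c, hc.ne_zero, h.symm⟩

lemma isUnit_of_eval_det_ne_zero [Fintype ι] [DecidableEq ι] {U : Matrix ι ι ℂ[X]}
    (h : ∀ z : ℂ, (U.map (Polynomial.eval z)).det ≠ 0) : IsUnit U := by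
  rw [Matrix.isUnit_iff_isUnit_det]
  by_contra hu
  have hdeg : U.det.degree ≠ 0 := fun hd => hu (Polynomial.isUnit_iff_degree_eq_zero.2 hd)
  obtain ⟨z, hz⟩ := IsAlgClosed.exists_root _ hdeg
  refine h z ?_
  have := RingHom.map_det (Polynomial.evalRingHom z) U
  rw [Polynomial.coe_evalRingHom, hz.eq_zero] at this
  exact this.symm

end Pencils

section Reduction

variable {m n p N : ℕ}

lemma map_corePencil {S S' : Type*} [Ring S] [Ring S'] (ψ : S →+* S') (a : ℕ → S) (α β : S) :
    (corePencil m a p α β).map ψ = corePencil m (fun t => ψ (a t)) p (ψ α) (ψ β) := by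
  ext1 s r
  simp [corePencil, map_leadEntry, map_constEntry]

lemma map_updateCol_single {S S' : Type*} [Ring S] [Ring S'] (ψ : S →+* S')
    (T : Matrix (Fin m) (Fin m) S) (c : Fin m) :
    (T.updateCol c (Pi.single c 1)).map ψ = (T.map ψ).updateCol c (Pi.single c 1) := by
  ext1 s r
  by_cases h : r = c
  · subst h
    by_cases hs : s = r
    · subst hs; simp
    · simp [hs]
  · simp [h]

lemma comp_map_ringHom {R R' : Type*} [Ring R] [Ring R'] (f : R →+* R')
    (M : Matrix (Fin m) (Fin m) (Matrix (Fin n) (Fin n) R)) :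
    (compRingEquiv (Fin m) (Fin n) R M).map f =
      compRingEquiv (Fin m) (Fin n) R' (M.map f.mapMatrix) := rfl

lemma commute_scalar {R : Type*} [CommRing R] (x : R) (M : Matrix (Fin n) (Fin n) R) :
    Commute (Matrix.scalar (Fin n) x) M :=
  Matrix.scalar_commute x (fun _ => Commute.all _ _) M

lemma mul_eq_zero_of_det_ne_zero {K : Type*} [Field K] {M : Matrix (Fin n) (Fin n) K}
    (h : M.det ≠ 0) (x : Matrix (Fin n) (Fin n) K) (hx : M * x = 0) : x = 0 := by
  have hu : IsUnit M := (Matrix.isUnit_iff_isUnit_det M).2 h.isUnit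
  exact hu.mul_left_cancel (hx.trans (mul_zero M).symm)

/-- The pencil `λX' - Y'` of the matrices with blocks `leadEntry` and `constEntry`, as a polynomial
matrix with scalar entries. -/
noncomputable def flatCore (m : ℕ) (a : ℕ → Matrix (Fin n) (Fin n) ℂ) (p : ℕ) :
    Matrix (Fin m × Fin n) (Fin m × Fin n) ℂ[X] :=
  pencil (compRingEquiv (Fin m) (Fin n) ℂ (natMatrix m (leadEntry a p)))
    (-compRingEquiv (Fin m) (Fin n) ℂ (natMatrix m (constEntry a p)))

lemma comp_corePencil_eq_flatCore (a : ℕ → Matrix (Fin n) (Fin n) ℂ) :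
    compRingEquiv (Fin m) (Fin n) ℂ[X] (corePencil m (fun t => constPoly (a t)) p
      (Matrix.scalar (Fin n) X) 1) = flatCore m a p := by
  let φ : Matrix (Fin n) (Fin n) ℂ →+* Matrix (Fin n) (Fin n) ℂ[X] := Polynomial.C.mapMatrix
  have hX : ∀ s r, leadEntry (fun t => constPoly (a t)) p s r = constPoly (leadEntry a p s r) :=
    fun s r => (map_leadEntry φ a p s r).symm
  have hY : ∀ s r, constEntry (fun t => constPoly (a t)) p s r = constPoly (constEntry a p s r) :=
    fun s r => (map_constEntry φ a p s r).symm
  ext1 ⟨s, x⟩ ⟨r, y⟩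
  simp only [compRingEquiv_apply, comp_apply, corePencil, natMatrix_apply, hX, hY, flatCore, pencil,
    one_mul, Matrix.add_apply, Matrix.sub_apply, Matrix.smul_apply]
  simp [constPoly, sub_eq_add_neg]

variable (Ac : ℕ → Matrix (Fin n) (Fin n) ℂ)

lemma horner_eq_matPoly :
    horner (fun t => constPoly (revCoeff m Ac t)) (Matrix.scalar (Fin n) (X : ℂ[X])) m =
      matPoly m Ac := by
  rw [horner, matPoly, ← Finset.sum_range_reflect]
  refine Finset.sum_congr rfl fun u hu => ?_
  rw [Finset.mem_range] at hu
  rw [revCoeff, ← map_pow, show m - (m + 1 - 1 - u) = u by omega]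
  ext1 x y
  simp [Matrix.scalar_apply, Matrix.diagonal_mul]

lemma isUnit_corePencil_updateCol (hm : m = p + 2 * N + 1) (ha : p ≠ 0 → (Ac m).det ≠ 0)
    {c : Fin m} (hc : (c : ℕ) + 1 = m) :
    IsUnit (compRingEquiv (Fin m) (Fin n) ℂ[X]
      ((corePencil m (fun t => constPoly (revCoeff m Ac t)) p (Matrix.scalar (Fin n) X) 1).updateCol
        c (Pi.single c 1))) := by
  refine isUnit_of_eval_det_ne_zero fun z => ?_
  have hcoeff : (fun t => (Polynomial.evalRingHom z).mapMatrix (constPoly (revCoeff m Ac t))) =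
      revCoeff m Ac := by
    funext t
    ext x y
    simp [constPoly]
  have hscalar : (Polynomial.evalRingHom z).mapMatrix (Matrix.scalar (Fin n) X) =
      Matrix.scalar (Fin n) z := by
    ext x y
    by_cases hxy : x = y <;> simp [Matrix.scalar_apply, hxy]
  rw [← Polynomial.coe_evalRingHom, comp_map_ringHom, map_updateCol_single, map_corePencil,
    map_one, hcoeff, hscalar]
  exact det_comp_ne_zero _ (eq_zero_of_corePencil_updateCol_mulVec (revCoeff m Ac) hm _
    (commute_scalar z) (fun hp => mul_eq_zero_of_det_ne_zero (ha hp)) c hc)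

lemma exists_unimodular_core_reduction (hm : m = p + 2 * N + 1) (ha : p ≠ 0 → (Ac m).det ≠ 0) :
    ∃ M V : Matrix (Fin m × Fin n) (Fin m × Fin n) ℂ[X], IsUnit M ∧ IsUnit V ∧
      flatCore m (revCoeff m Ac) p * V = M * idOplus m (matPoly m Ac) ∧
      (∀ (r : ℕ) (C : Matrix (Fin n) (Fin r) ℂ[X]), M * blockCol m m C = blockCol m m C) ∧
      (∀ (r : ℕ) (B : Matrix (Fin r) (Fin n) ℂ[X]), blockRow m m B * V = blockRow m m B) := by
  obtain ⟨c, hc⟩ : ∃ c : Fin m, (c : ℕ) + 1 = m := ⟨⟨m - 1, by omega⟩, by simp only; omega⟩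
  have hc' : (m : ℤ) = (c : ℕ) + 1 := by omega
  let aP : ℕ → Matrix (Fin n) (Fin n) ℂ[X] := fun t => constPoly (revCoeff m Ac t)
  let ℓ : Matrix (Fin n) (Fin n) ℂ[X] := Matrix.scalar (Fin n) X
  refine ⟨_, compRingEquiv (Fin m) (Fin n) ℂ[X] ((1 : Matrix (Fin m) (Fin m) _).updateCol c
      (fun r => lastCol aP p N ℓ r)), isUnit_corePencil_updateCol Ac hm ha hc,
    (isUnit_one_updateCol c _ (lastCol_last aP hm ℓ hc)).map (compRingEquiv (Fin m) (Fin n) _),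
    ?_, fun r C => comp_mul_blockCol _ (fun s => ?_) C hc' hc',
    fun r B => blockRow_mul_comp _ (fun s => ?_) B hc' hc'⟩
  · rw [← comp_corePencil_eq_flatCore, ← map_mul,
      corePencil_mul_lastCol aP hm ℓ (commute_scalar X) c hc, horner_eq_matPoly, map_mul,
      idOplus_eq hc]
  · rw [Matrix.updateCol_self, Pi.single_apply]
  · by_cases hs : s = c
    · subst hs
      rw [Matrix.updateCol_self, lastCol_last aP hm ℓ hc, if_pos rfl]
    · rw [Matrix.updateCol_ne hs, Matrix.one_apply, if_neg (Ne.symm hs), if_neg hs]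

/-- The matrix `congFactor` with scalar entries. -/
def flatCong (m : ℕ) (a : ℕ → Matrix (Fin n) (Fin n) ℂ) (p Z g H : ℕ) :
    Matrix (Fin m × Fin n) (Fin m × Fin n) ℂ :=
  compRingEquiv (Fin m) (Fin n) ℂ (congFactor m a p Z g H)

/-- The pencil `O (λX' - Y') O`, where `O = congFactor` and `λX' - Y'` is the core pencil. -/
noncomputable def congPencil (m : ℕ) (a : ℕ → Matrix (Fin n) (Fin n) ℂ) (p Z g H : ℕ) :
    Matrix (Fin m × Fin n) (Fin m × Fin n) ℂ[X] :=
  constPoly (flatCong m a p Z g H) * flatCore m a p * constPoly (flatCong m a p Z g H)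

lemma congPencil_eq_pencil (a : ℕ → Matrix (Fin n) (Fin n) ℂ) (Z g H : ℕ) :
    congPencil m a p Z g H = pencil
      (compRingEquiv (Fin m) (Fin n) ℂ
        (congFactor m a p Z g H * natMatrix m (leadEntry a p) * congFactor m a p Z g H))
      (-compRingEquiv (Fin m) (Fin n) ℂ
        (congFactor m a p Z g H * natMatrix m (constEntry a p) * congFactor m a p Z g H)) := by
  rw [congPencil, flatCore, flatCong, constPoly_mul_pencil, pencil_mul_constPoly]
  simp only [map_mul, mul_neg, neg_mul]

end Reduction

section FlatSigns

variable {m n p Z H N g : ℕ}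

lemma quasiIdentity_mul_comp (ε : Fin m → ℤˣ)
    (M : Matrix (Fin m) (Fin m) (Matrix (Fin n) (Fin n) ℂ)) (s r : Fin m) (x y : Fin n) :
    (quasiIdentity n ε * compRingEquiv (Fin m) (Fin n) ℂ M) (s, x) (r, y) =
      (ε s • M s r) x y := by
  rw [quasiIdentity, Matrix.diagonal_mul]
  simp [Units.smul_def]

lemma quasiIdentity_mul_comp_eq (ε ε' : Fin m → ℤˣ)
    (M : Matrix (Fin m) (Fin m) (Matrix (Fin n) (Fin n) ℂ))
    (h : ∀ s r, ε s • M s r = ε' r • (M r s)ᵀ) :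
    quasiIdentity n ε * compRingEquiv (Fin m) (Fin n) ℂ M =
      (compRingEquiv (Fin m) (Fin n) ℂ M)ᵀ * quasiIdentity n ε' := by
  ext ⟨s, x⟩ ⟨r, y⟩
  rw [quasiIdentity_mul_comp, h, quasiIdentity, Matrix.mul_diagonal]
  simp [Units.smul_def, mul_comm]

lemma quasiIdentity_transpose (ε : Fin m → ℤˣ) : (quasiIdentity n ε)ᵀ = quasiIdentity n ε :=
  Matrix.diagonal_transpose _

lemma quasiIdentity_mul_self (ε : Fin m → ℤˣ) : quasiIdentity n ε * quasiIdentity n ε = 1 := by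
  rw [quasiIdentity, Matrix.diagonal_mul_diagonal, ← Matrix.diagonal_one]
  congr 1
  funext a
  rw [← Int.cast_mul, ← Units.val_mul, Int.units_mul_self]
  simp

lemma quasiIdentity_neg (ε : Fin m → ℤˣ) :
    quasiIdentity n (fun s => -ε s) = -quasiIdentity n ε := by
  rw [quasiIdentity, quasiIdentity, Matrix.diagonal_neg]
  congr 1
  funext a
  simp

lemma smul_quasiIdentity (δ : ℤˣ) (ε : Fin m → ℤˣ) :
    (((δ : ℤˣ) : ℤ) : ℂ) • quasiIdentity n ε = quasiIdentity n (fun s => δ * ε s) := by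
  rw [quasiIdentity, quasiIdentity, ← Matrix.diagonal_smul]
  congr 1
  funext a
  simp

lemma quasiIdentity_mul_eq_comp (ε ε' : Fin m → ℤˣ) (δ : ℕ → ℤ)
    (hδ : ∀ s : Fin m, δ s = ε s * ε' s) :
    quasiIdentity n ε * quasiIdentity n ε' = compRingEquiv (Fin m) (Fin n) ℂ (intDiag m δ) := by
  ext ⟨s, x⟩ ⟨r, y⟩
  rw [quasiIdentity, quasiIdentity, Matrix.diagonal_mul_diagonal, Matrix.diagonal_apply,
    compRingEquiv_apply, comp_apply, intDiag, Matrix.diagonal_apply]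
  by_cases hs : s = r
  · subst hs
    rw [if_pos rfl, hδ]
    by_cases hxy : x = y
    · subst hxy
      simp [Matrix.intCast_apply]
    · simp [hxy, Matrix.intCast_apply]
  · simp [hs]

lemma IsTOddPoly.congr {ι κ : Type} [Fintype κ] {M : Matrix κ κ ℂ[X]} (h : IsTOddPoly M)
    (B : Matrix κ ι ℂ) : IsTOddPoly (constPoly Bᵀ * M * constPoly B) := by
  have hB : ∀ {ι κ : Type} (B : Matrix κ ι ℂ),
      (constPoly B).map (Polynomial.compRingHom (-X : ℂ[X])) = constPoly B := by
    intro ι κ B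
    ext1
    simp [constPoly]
  have hM : Mᵀ.map (Polynomial.compRingHom (-X : ℂ[X])) = -M := h
  have hT : (constPoly B)ᵀ = constPoly Bᵀ := rfl
  have hT' : (constPoly Bᵀ)ᵀ = constPoly B := rfl
  change (constPoly Bᵀ * M * constPoly B)ᵀ.map (Polynomial.compRingHom (-X : ℂ[X])) = _
  rw [transpose_mul, transpose_mul, hT, hT', Matrix.map_mul, Matrix.map_mul, hM, hB, hB,
    ← Matrix.mul_assoc, Matrix.mul_neg, Matrix.neg_mul]

variable {a : ℕ → Matrix (Fin n) (Fin n) ℂ}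

lemma isTOddPoly_flatCore (hm : m = p + 2 * N + 1)
    (ha : ∀ t ≤ m, (a t)ᵀ = (-1 : ℤˣ) ^ (m + t + 1) • a t) :
    IsTOddPoly (constPoly (quasiIdentity n fun s : Fin m => coreSign p s) * flatCore m a p) := by
  have hX := quasiIdentity_mul_comp_eq (fun s : Fin m => coreSign p s)
    (fun s : Fin m => coreSign p s) (natMatrix m (leadEntry a p))
    fun s r => coreSign_smul_leadEntry hm ha s.2 r.2
  have hY := quasiIdentity_mul_comp_eq (fun s : Fin m => coreSign p s)
    (fun s : Fin m => -coreSign p s) (natMatrix m (constEntry a p))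
    fun s r => coreSign_smul_constEntry hm ha s.2 r.2
  rw [quasiIdentity_neg] at hY
  rw [flatCore, constPoly_mul_pencil, isTOddPoly_pencil]
  constructor
  · rw [transpose_mul, quasiIdentity_transpose, hX]
  · rw [mul_neg, transpose_neg, transpose_mul, quasiIdentity_transpose, hY, mul_neg,
      neg_neg]

lemma quasiIdentity_mul_flatCong (hm : m = g + 1 + 2 * H) (hg : g = p + 2 * Z)
    (ha : ∀ t ≤ m, (a t)ᵀ = (-1 : ℤˣ) ^ (m + t + 1) • a t) :
    quasiIdentity n (fun s : Fin m => gfprSign p g s) * flatCong m a p Z g H =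
      (flatCong m a p Z g H)ᵀ * quasiIdentity n fun s : Fin m => coreSign p s :=
  quasiIdentity_mul_comp_eq _ _ _ fun s r => by
    rw [congFactor_eq a hm hg]
    exact gfprSign_smul_congFactorEntry hm hg ha s.2 r.2

lemma isTOddPoly_congPencil (hm : m = g + 1 + 2 * H) (hg : g = p + 2 * Z)
    (ha : ∀ t ≤ m, (a t)ᵀ = (-1 : ℤˣ) ^ (m + t + 1) • a t) :
    IsTOddPoly (constPoly (quasiIdentity n fun s : Fin m => gfprSign p g s) *
      congPencil m a p Z g H) := by
  have hcore := isTOddPoly_flatCore (p := p) (N := Z + H) (by omega) ha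
  convert hcore.congr (flatCong m a p Z g H) using 1
  rw [congPencil, ← mul_assoc, ← mul_assoc, ← constPoly_mul, quasiIdentity_mul_flatCong hm hg ha,
    constPoly_mul, mul_assoc _ _ (flatCore m a p)]

variable {ε ε' : Fin m → ℤˣ}

lemma commute_of_transpose_quasiIdentity_mul {σ : ℂ} (hσ : σ * σ = 1)
    {W : Matrix (Fin m × Fin n) (Fin m × Fin n) ℂ}
    (h : (quasiIdentity n ε * W)ᵀ = σ • (quasiIdentity n ε * W))
    (h' : (quasiIdentity n ε' * W)ᵀ = σ • (quasiIdentity n ε' * W)) :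
    Commute (quasiIdentity n ε' * quasiIdentity n ε) W := by
  rw [transpose_mul, quasiIdentity_transpose] at h h'
  have hW : quasiIdentity n ε * W = σ • (Wᵀ * quasiIdentity n ε) := by
    rw [h, smul_smul, hσ, one_smul]
  have hWT : Wᵀ = σ • (quasiIdentity n ε' * W * quasiIdentity n ε') := by
    rw [← smul_mul_assoc, ← h', mul_assoc, quasiIdentity_mul_self, mul_one]
  rw [Commute, SemiconjBy, mul_assoc, hW, hWT, smul_mul_assoc, smul_smul, hσ, one_smul, mul_assoc,
    mul_assoc, ← mul_assoc, quasiIdentity_mul_self, one_mul]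

lemma commute_of_isTOddPoly {Y W : Matrix (Fin m × Fin n) (Fin m × Fin n) ℂ}
    (h : IsTOddPoly (constPoly (quasiIdentity n ε) * pencil Y W))
    (h' : IsTOddPoly (constPoly (quasiIdentity n ε') * pencil Y W)) :
    Commute (quasiIdentity n ε' * quasiIdentity n ε) Y ∧
      Commute (quasiIdentity n ε' * quasiIdentity n ε) W := by
  rw [constPoly_mul_pencil, isTOddPoly_pencil] at h h'
  exact ⟨commute_of_transpose_quasiIdentity_mul (σ := 1) (by norm_num) (by rw [h.1, one_smul])
      (by rw [h'.1, one_smul]),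
    commute_of_transpose_quasiIdentity_mul (σ := -1) (by norm_num) (by rw [h.2, neg_one_smul])
      (by rw [h'.2, neg_one_smul])⟩

lemma exists_eq_mul_of_isTOddPoly_congPencil (hm : m = g + 1 + 2 * H) (hg : g = p + 2 * Z)
    (h0 : a 0 ≠ 0) (h : IsTOddPoly (constPoly (quasiIdentity n ε) * congPencil m a p Z g H))
    (h' : IsTOddPoly (constPoly (quasiIdentity n ε') * congPencil m a p Z g H)) :
    ∃ δ : ℤˣ, ∀ s, ε' s = δ * ε s := by
  have : IsAddTorsionFree (Matrix (Fin n) (Fin n) ℂ) :=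
    inferInstanceAs (IsAddTorsionFree (Fin n → Fin n → ℂ))
  let δ : ℕ → ℤ := fun t => if ht : t < m then (ε' ⟨t, ht⟩ * ε ⟨t, ht⟩ : ℤˣ) else 1
  have hδ : ∀ s : Fin m, δ s = (ε' s * ε s : ℤˣ) := fun s => dif_pos s.2
  have hφ := (compRingEquiv (Fin m) (Fin n) ℂ).injective
  rw [congPencil_eq_pencil] at h h'
  obtain ⟨hX, hY⟩ := commute_of_isTOddPoly h h'
  rw [Commute.neg_right_iff] at hY
  rw [quasiIdentity_mul_eq_comp ε' ε δ fun s => by rw [hδ, Units.val_mul]] at hX hY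
  have hconst : ∀ s < m, δ s = δ 0 := fun s => intDiag_const_of_commute h0 hm hg
    (.of_map hφ hX) (.of_map hφ hY)
  refine ⟨ε' ⟨0, by omega⟩ * ε ⟨0, by omega⟩, fun s => ?_⟩
  have hs : ε' s * ε s = ε' ⟨0, by omega⟩ * ε ⟨0, by omega⟩ := by
    rw [← Units.val_inj, ← hδ, ← hδ]
    exact hconst s s.2
  rw [← hs, mul_assoc, Int.units_mul_self, mul_one]

end FlatSigns

section LimitsAtInfinity

/-- The rational function `f` tends to `c` at infinity. -/
def TendsAtInfinity (f : RatFunc ℂ) (c : ℂ) : Prop :=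
  Filter.Tendsto (fun x : ℂ => RatFunc.eval (RingHom.id ℂ) x f) (Bornology.cobounded ℂ) (nhds c)

lemma eventually_denom_ne_zero (f : RatFunc ℂ) :
    ∀ᶠ x in Bornology.cobounded ℂ, Polynomial.eval₂ (RingHom.id ℂ) x f.denom ≠ 0 := by
  have hfin : {x : ℂ | f.denom.IsRoot x}.Finite :=
    Polynomial.finite_setOfPred_isRoot (RatFunc.denom_ne_zero f)
  exact Bornology.isBounded_def.1 hfin.isBounded

lemma TendsAtInfinity.add {f g : RatFunc ℂ} {c d : ℂ} (hf : TendsAtInfinity f c)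
    (hg : TendsAtInfinity g d) :
    TendsAtInfinity (f + g) (c + d) := by
  refine (Filter.Tendsto.add hf hg).congr' ?_
  filter_upwards [eventually_denom_ne_zero f, eventually_denom_ne_zero g] with x h1 h2
  exact (RatFunc.eval_add _ _ h1 h2).symm

lemma TendsAtInfinity.mul {f g : RatFunc ℂ} {c d : ℂ} (hf : TendsAtInfinity f c)
    (hg : TendsAtInfinity g d) :
    TendsAtInfinity (f * g) (c * d) := by
  refine (Filter.Tendsto.mul hf hg).congr' ?_
  filter_upwards [eventually_denom_ne_zero f, eventually_denom_ne_zero g] with x h1 h2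
  exact (RatFunc.eval_mul _ _ h1 h2).symm

lemma tendsAtInfinity_C (c : ℂ) : TendsAtInfinity (RatFunc.C c) c := by
  simp [TendsAtInfinity, RatFunc.eval_C]

lemma tendsAtInfinity_zero : TendsAtInfinity 0 0 := by simpa using tendsAtInfinity_C 0

lemma tendsAtInfinity_one : TendsAtInfinity 1 1 := by simpa using tendsAtInfinity_C 1

lemma TendsAtInfinity.neg {f : RatFunc ℂ} {c : ℂ} (hf : TendsAtInfinity f c) :
    TendsAtInfinity (-f) (-c) := by
  simpa using (tendsAtInfinity_C (-1)).mul hf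

lemma TendsAtInfinity.sum {ι : Type*} {s : Finset ι} {f : ι → RatFunc ℂ} {c : ι → ℂ}
    (h : ∀ i ∈ s, TendsAtInfinity (f i) (c i)) : TendsAtInfinity (∑ i ∈ s, f i) (∑ i ∈ s, c i) := by
  classical
  induction s using Finset.induction_on with
  | empty => simpa using tendsAtInfinity_zero
  | insert i s hi ih =>
    rw [Finset.sum_insert hi, Finset.sum_insert hi]
    exact (h i (by simp)).add (ih fun j hj => h j (by simp [hj]))

lemma TendsAtInfinity.prod {ι : Type*} {s : Finset ι} {f : ι → RatFunc ℂ} {c : ι → ℂ}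
    (h : ∀ i ∈ s, TendsAtInfinity (f i) (c i)) : TendsAtInfinity (∏ i ∈ s, f i) (∏ i ∈ s, c i) := by
  classical
  induction s using Finset.induction_on with
  | empty => simpa using tendsAtInfinity_one
  | insert i s hi ih =>
    rw [Finset.prod_insert hi, Finset.prod_insert hi]
    exact (h i (by simp)).mul (ih fun j hj => h j (by simp [hj]))

lemma eval_inv_eventually {f : RatFunc ℂ} (hf : f ≠ 0) :
    ∀ᶠ x in Bornology.cobounded ℂ, (RatFunc.eval (RingHom.id ℂ) x f)⁻¹ =
      RatFunc.eval (RingHom.id ℂ) x f⁻¹ := by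
  filter_upwards [eventually_denom_ne_zero f, eventually_denom_ne_zero f⁻¹] with x h1 h2
  have := RatFunc.eval_mul _ _ h1 h2
  rw [mul_inv_cancel₀ hf, RatFunc.eval_one] at this
  exact (eq_inv_of_mul_eq_one_right this.symm).symm

lemma TendsAtInfinity.ne_zero {f : RatFunc ℂ} {c : ℂ} (hf : TendsAtInfinity f c) (hc : c ≠ 0) :
    f ≠ 0 := by
  rintro rfl
  exact hc (tendsto_nhds_unique hf tendsAtInfinity_zero)

lemma TendsAtInfinity.inv {f : RatFunc ℂ} {c : ℂ} (hf : TendsAtInfinity f c) (hc : c ≠ 0) :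
    TendsAtInfinity f⁻¹ c⁻¹ :=
  (Filter.Tendsto.inv₀ hf hc).congr' (eval_inv_eventually (hf.ne_zero hc))

lemma tendsAtInfinity_X_inv : TendsAtInfinity (RatFunc.X : RatFunc ℂ)⁻¹ 0 := by
  refine (Filter.tendsto_inv₀_cobounded (α := ℂ)).congr' ?_
  have := eval_inv_eventually (RatFunc.X_ne_zero (K := ℂ))
  simp only [RatFunc.eval_X] at this
  exact this

variable {ι κ τ : Type}

/-- The rational matrix `F` tends to `D` at infinity. -/
def MatTendsAtInfinity (F : Matrix ι κ (RatFunc ℂ)) (D : Matrix ι κ ℂ) : Prop :=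
  ∀ i j, TendsAtInfinity (F i j) (D i j)

lemma MatTendsAtInfinity.add {F F' : Matrix ι κ (RatFunc ℂ)} {D D' : Matrix ι κ ℂ}
    (h : MatTendsAtInfinity F D) (h' : MatTendsAtInfinity F' D') :
    MatTendsAtInfinity (F + F') (D + D') :=
  fun i j => (h i j).add (h' i j)

lemma MatTendsAtInfinity.neg {F : Matrix ι κ (RatFunc ℂ)} {D : Matrix ι κ ℂ}
    (h : MatTendsAtInfinity F D) : MatTendsAtInfinity (-F) (-D) :=
  fun i j => (h i j).neg

lemma MatTendsAtInfinity.sub {F F' : Matrix ι κ (RatFunc ℂ)} {D D' : Matrix ι κ ℂ}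
    (h : MatTendsAtInfinity F D) (h' : MatTendsAtInfinity F' D') :
    MatTendsAtInfinity (F - F') (D - D') := by
  rw [sub_eq_add_neg, sub_eq_add_neg]
  exact h.add h'.neg

lemma MatTendsAtInfinity.mul [Fintype κ] {F : Matrix ι κ (RatFunc ℂ)} {F' : Matrix κ τ (RatFunc ℂ)}
    {D : Matrix ι κ ℂ} {D' : Matrix κ τ ℂ} (h : MatTendsAtInfinity F D)
    (h' : MatTendsAtInfinity F' D') : MatTendsAtInfinity (F * F') (D * D') := fun i j => by
  rw [Matrix.mul_apply, Matrix.mul_apply]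
  exact TendsAtInfinity.sum fun k _ => (h i k).mul (h' k j)

lemma matTendsAtInfinity_constRat (D : Matrix ι κ ℂ) : MatTendsAtInfinity (constRat D) D :=
  fun _ _ => tendsAtInfinity_C _

lemma matTendsAtInfinity_zero : MatTendsAtInfinity (0 : Matrix ι κ (RatFunc ℂ)) 0 :=
  fun _ _ => tendsAtInfinity_zero

lemma matTendsAtInfinity_one [DecidableEq ι] :
    MatTendsAtInfinity (1 : Matrix ι ι (RatFunc ℂ)) 1 := by
  intro i j
  by_cases h : i = j
  · subst h; simpa using tendsAtInfinity_one
  · simpa [h] using tendsAtInfinity_zero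

lemma MatTendsAtInfinity.pow [Fintype ι] [DecidableEq ι] {F : Matrix ι ι (RatFunc ℂ)}
    {D : Matrix ι ι ℂ} (h : MatTendsAtInfinity F D) (k : ℕ) :
    MatTendsAtInfinity (F ^ k) (D ^ k) := by
  induction k with
  | zero => simpa using matTendsAtInfinity_one
  | succ k ih => rw [pow_succ, pow_succ]; exact ih.mul h

lemma MatTendsAtInfinity.sum {σ : Type} {s : Finset σ} {F : σ → Matrix ι κ (RatFunc ℂ)}
    {D : σ → Matrix ι κ ℂ} (h : ∀ i ∈ s, MatTendsAtInfinity (F i) (D i)) :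
    MatTendsAtInfinity (∑ i ∈ s, F i) (∑ i ∈ s, D i) := fun i j => by
  rw [Matrix.sum_apply, Matrix.sum_apply]
  exact TendsAtInfinity.sum fun k hk => h k hk i j

lemma MatTendsAtInfinity.det [Fintype ι] [DecidableEq ι] {F : Matrix ι ι (RatFunc ℂ)}
    {D : Matrix ι ι ℂ} (h : MatTendsAtInfinity F D) : TendsAtInfinity F.det D.det := by
  rw [Matrix.det_apply', Matrix.det_apply']
  refine TendsAtInfinity.sum fun σ _ => TendsAtInfinity.mul ?_
    (TendsAtInfinity.prod fun i _ => h _ _)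
  have := tendsAtInfinity_C (((Equiv.Perm.sign σ : ℤˣ) : ℤ) : ℂ)
  rwa [map_intCast] at this

lemma MatTendsAtInfinity.inv [Fintype ι] [DecidableEq ι] {F : Matrix ι ι (RatFunc ℂ)}
    {D : Matrix ι ι ℂ} (h : MatTendsAtInfinity F D) (hD : D.det ≠ 0) :
    MatTendsAtInfinity F⁻¹ D⁻¹ := by
  intro i j
  rw [Matrix.inv_def, Matrix.inv_def, Ring.inverse_eq_inv', Ring.inverse_eq_inv',
    Matrix.smul_apply, Matrix.smul_apply, smul_eq_mul, smul_eq_mul, Matrix.adjugate_apply,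
    Matrix.adjugate_apply]
  refine (h.det.inv hD).mul (MatTendsAtInfinity.det fun k l => ?_)
  by_cases hk : k = j
  · subst hk
    rw [Matrix.updateRow_self, Matrix.updateRow_self]
    by_cases hl : l = i
    · subst hl; simpa using tendsAtInfinity_one
    · simpa [hl] using tendsAtInfinity_zero
  · rw [Matrix.updateRow_ne hk, Matrix.updateRow_ne hk]
    exact h k l

lemma MatTendsAtInfinity.isBiproper [Fintype ι] [DecidableEq ι] {F : Matrix ι ι (RatFunc ℂ)}
    {D : Matrix ι ι ℂ} (h : MatTendsAtInfinity F D) (hD : D.det ≠ 0) : IsBiproper F := ⟨D, hD, h⟩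

lemma IsBiproper.mul [Fintype ι] [DecidableEq ι] {F F' : Matrix ι ι (RatFunc ℂ)}
    (h : IsBiproper F) (h' : IsBiproper F') : IsBiproper (F * F') := by
  obtain ⟨D, hD, h⟩ := h
  obtain ⟨D', hD', h'⟩ := h'
  refine ⟨D * D', ?_, MatTendsAtInfinity.mul h h'⟩
  rw [Matrix.det_mul]
  exact mul_ne_zero hD hD'

lemma IsBiproper.inv [Fintype ι] [DecidableEq ι] {F : Matrix ι ι (RatFunc ℂ)}
    (h : IsBiproper F) : IsBiproper F⁻¹ := by
  obtain ⟨D, hD, h⟩ := h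
  refine ⟨D⁻¹, ?_, MatTendsAtInfinity.inv h hD⟩
  rw [Matrix.det_nonsing_inv, Ring.inverse_eq_inv']
  exact inv_ne_zero hD

lemma IsBiproper.isUnit_det [Fintype ι] [DecidableEq ι] {F : Matrix ι ι (RatFunc ℂ)}
    (h : IsBiproper F) : IsUnit F.det := by
  obtain ⟨D, hD, h⟩ := h
  exact (TendsAtInfinity.ne_zero (MatTendsAtInfinity.det h) hD).isUnit

lemma isBiproper_constRat [Fintype ι] [DecidableEq ι] {D : Matrix ι ι ℂ} (h : IsUnit D) :
    IsBiproper (constRat D) :=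
  (matTendsAtInfinity_constRat D).isBiproper ((Matrix.isUnit_iff_isUnit_det D).1 h).ne_zero

end LimitsAtInfinity

section BlockLimits

variable {m n p N : ℕ} {aR : ℕ → Matrix (Fin n) (Fin n) (RatFunc ℂ)}
  {b : ℕ → Matrix (Fin n) (Fin n) ℂ}

lemma MatTendsAtInfinity.ite {ι κ : Type} {P : Prop} [Decidable P] {F F' : Matrix ι κ (RatFunc ℂ)}
    {D D' : Matrix ι κ ℂ} (h : MatTendsAtInfinity F D) (h' : MatTendsAtInfinity F' D') :
    MatTendsAtInfinity (if P then F else F') (if P then D else D') := by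
  by_cases hP : P
  · rwa [if_pos hP, if_pos hP]
  · rwa [if_neg hP, if_neg hP]

lemma matTendsAtInfinity_leadEntry (h : ∀ t, MatTendsAtInfinity (aR t) (b t)) (p s r : ℕ) :
    MatTendsAtInfinity (leadEntry aR p s r) (leadEntry b p s r) := by
  unfold leadEntry
  have h0 := matTendsAtInfinity_zero (ι := Fin n) (κ := Fin n)
  have h1 := matTendsAtInfinity_one (ι := Fin n)
  exact .ite (.ite (h _) h0) (.ite h0 (.ite (.ite (h _) (.ite h1 h0)) (.ite h1 h0)))

lemma matTendsAtInfinity_constEntry (h : ∀ t, MatTendsAtInfinity (aR t) (b t)) (p s r : ℕ) :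
    MatTendsAtInfinity (constEntry aR p s r) (constEntry b p s r) := by
  unfold constEntry
  have h0 := matTendsAtInfinity_zero (ι := Fin n) (κ := Fin n)
  have h1 := matTendsAtInfinity_one (ι := Fin n)
  exact .ite (.ite (h _) h0) (.ite h0 (.ite (.ite (h _).neg (.ite h1 h0)) (.ite h1 h0)))

lemma matTendsAtInfinity_revHorner (h : ∀ t, MatTendsAtInfinity (aR t) (b t))
    {μ : Matrix (Fin n) (Fin n) (RatFunc ℂ)} {ν : Matrix (Fin n) (Fin n) ℂ}
    (hμ : MatTendsAtInfinity μ ν) (j : ℕ) :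
    MatTendsAtInfinity (revHorner aR m μ j) (revHorner b m ν j) :=
  MatTendsAtInfinity.sum fun i _ => (hμ.pow i).mul (h _)

lemma matTendsAtInfinity_firstCol (h : ∀ t, MatTendsAtInfinity (aR t) (b t))
    {μ : Matrix (Fin n) (Fin n) (RatFunc ℂ)} {ν : Matrix (Fin n) (Fin n) ℂ}
    (hμ : MatTendsAtInfinity μ ν) (t : ℕ) :
    MatTendsAtInfinity (firstCol aR m μ t) (firstCol b m ν t) := by
  unfold firstCol
  split_ifs
  · exact hμ.pow _
  · exact ((matTendsAtInfinity_revHorner h hμ _).mul (hμ.pow _)).neg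

lemma matTendsAtInfinity_corePencil (h : ∀ t, MatTendsAtInfinity (aR t) (b t))
    {μ : Matrix (Fin n) (Fin n) (RatFunc ℂ)} (hμ : MatTendsAtInfinity μ 0) (s r : Fin m) :
    MatTendsAtInfinity (corePencil m aR p 1 μ s r) (leadEntry b p s r) := by
  have hlim := (matTendsAtInfinity_leadEntry h p s r).sub
    (hμ.mul (matTendsAtInfinity_constEntry h p s r))
  rw [zero_mul, sub_zero] at hlim
  simpa [corePencil] using hlim

lemma matTendsAtInfinity_scalar {μ : RatFunc ℂ} {c : ℂ} (hμ : TendsAtInfinity μ c) :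
    MatTendsAtInfinity (Matrix.scalar (Fin n) μ) (Matrix.scalar (Fin n) c) := fun i j => by
  by_cases hij : i = j
  · subst hij; simpa using hμ
  · simpa [hij] using tendsAtInfinity_zero

lemma isBiproper_comp {M : Matrix (Fin m) (Fin m) (Matrix (Fin n) (Fin n) (RatFunc ℂ))}
    {D : Matrix (Fin m) (Fin m) (Matrix (Fin n) (Fin n) ℂ)}
    (h : ∀ s r, MatTendsAtInfinity (M s r) (D s r)) (hD : ∀ W, D *ᵥ W = 0 → W = 0) :
    IsBiproper (compRingEquiv (Fin m) (Fin n) _ M) :=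
  ⟨compRingEquiv (Fin m) (Fin n) ℂ D, det_comp_ne_zero D hD, fun i j => h i.1 j.1 i.2 j.2⟩

lemma isBiproper_comp_of_isUnit {M : Matrix (Fin m) (Fin m) (Matrix (Fin n) (Fin n) (RatFunc ℂ))}
    {D : Matrix (Fin m) (Fin m) (Matrix (Fin n) (Fin n) ℂ)}
    (h : ∀ s r, MatTendsAtInfinity (M s r) (D s r)) (hD : IsUnit D) :
    IsBiproper (compRingEquiv (Fin m) (Fin n) _ M) := by
  obtain ⟨D, rfl⟩ := hD
  refine isBiproper_comp h fun W hW => ?_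
  rw [← one_mulVec W, ← D.inv_mul, ← mulVec_mulVec, hW, mulVec_zero]

lemma isBiproper_comp_swap (c d : Fin m) :
    IsBiproper (compRingEquiv (Fin m) (Fin n) (RatFunc ℂ) (Matrix.swap _ c d)) := by
  refine isBiproper_comp_of_isUnit (D := Matrix.swap _ c d) (fun s r => ?_)
    ⟨⟨_, _, swap_mul_self c d, swap_mul_self c d⟩, rfl⟩
  simp only [Matrix.swap, Equiv.Perm.permMatrix, PEquiv.toMatrix_apply]
  exact .ite matTendsAtInfinity_one matTendsAtInfinity_zero

lemma diagonal_update_mul_swap {S : Type*} [Ring S] (c d : Fin m) (x : S) :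
    Matrix.diagonal (Function.update 1 c x) * Matrix.swap S c d =
      Matrix.swap S c d * Matrix.diagonal (Function.update 1 d x) := by
  ext s r
  rw [Matrix.diagonal_mul, Matrix.mul_diagonal, Matrix.swap, Equiv.Perm.permMatrix,
    PEquiv.toMatrix_apply]
  split_ifs with h
  · obtain rfl : Equiv.swap c d s = r := by simpa using h
    rw [mul_one, one_mul, Function.update_apply, Function.update_apply]
    congr 1
    rw [Equiv.swap_apply_eq_iff, Equiv.swap_apply_right]
  · simp

lemma isBiproper_comp_one_updateCol (c : Fin m) {x : Fin m → Matrix (Fin n) (Fin n) (RatFunc ℂ)}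
    {y : Fin m → Matrix (Fin n) (Fin n) ℂ} (h : ∀ s, MatTendsAtInfinity (x s) (y s))
    (hy : y c = 1) :
    IsBiproper (compRingEquiv (Fin m) (Fin n) _ ((1 : Matrix (Fin m) (Fin m) _).updateCol c x)) :=
  isBiproper_comp_of_isUnit (fun s r => by
    rw [Matrix.updateCol_apply, Matrix.updateCol_apply, Matrix.one_apply, Matrix.one_apply]
    exact .ite (h s) (.ite matTendsAtInfinity_one matTendsAtInfinity_zero))
    (isUnit_one_updateCol c y hy)

lemma isBiproper_idOplus {P : Matrix (Fin n) (Fin n) (RatFunc ℂ)} {D : Matrix (Fin n) (Fin n) ℂ}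
    (h : MatTendsAtInfinity P D) (hD : D.det ≠ 0) {c : Fin m} (hc : (c : ℕ) + 1 = m) :
    IsBiproper (idOplus m P) := by
  rw [idOplus_eq hc]
  refine isBiproper_comp (D := Matrix.diagonal (Function.update 1 c D)) (fun s r => ?_)
    fun W hW => ?_
  · rw [Matrix.diagonal_apply, Matrix.diagonal_apply, Function.update_apply, Function.update_apply]
    exact .ite (.ite h matTendsAtInfinity_one) matTendsAtInfinity_zero
  · funext s
    have hs := congrFun hW s
    rw [Matrix.mulVec_diagonal, Function.update_apply] at hs
    split_ifs at hs
    · exact mul_eq_zero_of_det_ne_zero hD _ hs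
    · simpa using hs

lemma isBiproper_comp_corePencil (hm : m = p + 2 * N + 1) (h : ∀ t, MatTendsAtInfinity (aR t) (b t))
    (hb : (b 0).det ≠ 0) {μ : Matrix (Fin n) (Fin n) (RatFunc ℂ)} (hμ : MatTendsAtInfinity μ 0) :
    IsBiproper (compRingEquiv (Fin m) (Fin n) _ (corePencil m aR p 1 μ)) :=
  isBiproper_comp (D := natMatrix m (leadEntry b p))
    (fun s r => matTendsAtInfinity_corePencil h hμ s r) fun W hW =>
      eq_zero_of_natMatrix_leadEntry_mulVec b hm (mul_eq_zero_of_det_ne_zero hb) W hW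

lemma leadEntry_update_zero {S : Type*} [Ring S] (a : ℕ → S) (x : S) (s : ℕ) {r : ℕ} (hr : r ≠ 0) :
    leadEntry (Function.update a 0 x) 0 s r = leadEntry a 0 s r := by
  unfold leadEntry
  split_ifs <;> first | omega | rfl | rw [Function.update_of_ne (by omega)]

lemma leadEntry_update_zero_left {S : Type*} [Ring S] (a : ℕ → S) (x : S) (s : ℕ) :
    leadEntry (Function.update a 0 x) 0 s 0 = if s = 0 then x else 0 := by
  unfold leadEntry
  split_ifs <;> first | omega | simp_all

lemma isBiproper_comp_corePencil_updateCol (hm : m = 2 * N + 1)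
    (h : ∀ t, MatTendsAtInfinity (aR t) (b t)) {μ : Matrix (Fin n) (Fin n) (RatFunc ℂ)}
    (hμ : MatTendsAtInfinity μ 0) {c : Fin m} (hc : (c : ℕ) = 0) :
    IsBiproper (compRingEquiv (Fin m) (Fin n) _
      ((corePencil m aR 0 1 μ).updateCol c (Pi.single c 1))) := by
  have hm' : m = 0 + 2 * N + 1 := by omega
  refine isBiproper_comp (D := natMatrix m (leadEntry (Function.update b 0 1) 0)) (fun s r => ?_)
    fun W hW => eq_zero_of_natMatrix_leadEntry_mulVec _ hm' (by simp) W hW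
  rw [natMatrix_apply]
  by_cases hr : r = c
  · rw [hr, Matrix.updateCol_self, Pi.single_apply, hc, leadEntry_update_zero_left]
    simp only [Fin.ext_iff, hc]
    exact .ite matTendsAtInfinity_one matTendsAtInfinity_zero
  · rw [Matrix.updateCol_ne hr, leadEntry_update_zero _ _ _ fun h => hr (Fin.ext (h.trans hc.symm))]
    exact matTendsAtInfinity_corePencil h hμ s r

lemma exists_biproper_reduction_of_det_ne_zero (hm : m = p + 2 * N + 1)
    (h : ∀ t, MatTendsAtInfinity (aR t) (b t)) (hb : (b 0).det ≠ 0)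
    {μ : Matrix (Fin n) (Fin n) (RatFunc ℂ)} (hμ : MatTendsAtInfinity μ 0) :
    ∃ Ol Or : Matrix (Fin m × Fin n) (Fin m × Fin n) (RatFunc ℂ),
      IsBiproper Ol ∧ IsBiproper Or ∧
      Ol * compRingEquiv (Fin m) (Fin n) _ (corePencil m aR p 1 μ) * Or =
        idOplus m (revHorner aR m μ 0) := by
  obtain ⟨c, hc⟩ : ∃ c : Fin m, (c : ℕ) + 1 = m := ⟨⟨m - 1, by omega⟩, by simp only; omega⟩
  have hF := isBiproper_comp_corePencil hm h hb hμ
  have hlim : revHorner b m 0 0 = b 0 := by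
    rw [revHorner, Finset.sum_eq_single 0 (fun i _ hi => by simp [zero_pow hi]) (by simp)]
    simp
  have hE : IsBiproper (idOplus m (revHorner aR m μ 0)) :=
    isBiproper_idOplus (matTendsAtInfinity_revHorner h hμ 0) (by rwa [hlim]) hc
  refine ⟨_, 1, hE.mul hF.inv, matTendsAtInfinity_one.isBiproper (by simp), ?_⟩
  rw [mul_one, mul_assoc, Matrix.nonsing_inv_mul _ hF.isUnit_det, mul_one]

lemma exists_biproper_reduction_of_index_zero (hm : m = 2 * N + 1)
    (h : ∀ t, MatTendsAtInfinity (aR t) (b t)) {μ : Matrix (Fin n) (Fin n) (RatFunc ℂ)}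
    (hcomm : ∀ x, Commute μ x) (hμ : MatTendsAtInfinity μ 0) :
    ∃ Ol Or : Matrix (Fin m × Fin n) (Fin m × Fin n) (RatFunc ℂ),
      IsBiproper Ol ∧ IsBiproper Or ∧
      Ol * compRingEquiv (Fin m) (Fin n) _ (corePencil m aR 0 1 μ) * Or =
        idOplus m (revHorner aR m μ 0) := by
  obtain ⟨c, hc⟩ : ∃ c : Fin m, (c : ℕ) + 1 = m := ⟨⟨m - 1, by omega⟩, by simp only; omega⟩
  obtain ⟨c₀, hc₀⟩ : ∃ c : Fin m, (c : ℕ) = 0 := ⟨⟨0, by omega⟩, rfl⟩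
  let φ := compRingEquiv (Fin m) (Fin n) (RatFunc ℂ)
  let E := revHorner aR m μ 0
  let M := φ ((corePencil m aR 0 1 μ).updateCol c₀ (Pi.single c₀ 1))
  let V := φ ((1 : Matrix (Fin m) (Fin m) _).updateCol c₀ fun r => firstCol aR m μ r)
  let T := φ (Matrix.swap _ c₀ c)
  have hM : IsBiproper M := isBiproper_comp_corePencil_updateCol hm h hμ hc₀
  have hV : IsBiproper V := isBiproper_comp_one_updateCol c₀
    (fun s => matTendsAtInfinity_firstCol h hμ s) (by simp [firstCol, hc₀])
  have hT : IsBiproper T := isBiproper_comp_swap c₀ c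
  have hcol : φ (corePencil m aR 0 1 μ) * V = M * φ (Matrix.diagonal (Function.update 1 c₀ E)) := by
    rw [← map_mul, ← map_mul, corePencil_mul_firstCol aR hm μ hcomm c₀ hc₀]
  refine ⟨T * M⁻¹, V * T, hT.mul hM.inv, hV.mul hT, ?_⟩
  calc T * M⁻¹ * φ (corePencil m aR 0 1 μ) * (V * T)
      = T * M⁻¹ * (φ (corePencil m aR 0 1 μ) * V) * T := by simp only [mul_assoc]
    _ = T * (M⁻¹ * M) * φ (Matrix.diagonal (Function.update 1 c₀ E)) * T := by
        rw [hcol]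
        simp only [mul_assoc]
    _ = φ (Matrix.swap _ c₀ c *
          (Matrix.diagonal (Function.update 1 c₀ E) * Matrix.swap _ c₀ c)) := by
        rw [Matrix.nonsing_inv_mul _ hM.isUnit_det, mul_one, map_mul, map_mul, mul_assoc]
    _ = idOplus m E := by
        rw [diagonal_update_mul_swap, ← mul_assoc, swap_mul_self, one_mul, idOplus_eq hc]

lemma exists_biproper_reduction (hm : m = p + 2 * N + 1) (h : ∀ t, MatTendsAtInfinity (aR t) (b t))
    (hb : p = 0 ∨ (b 0).det ≠ 0) {μ : RatFunc ℂ} (hμ : TendsAtInfinity μ 0) :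
    ∃ Ol Or : Matrix (Fin m × Fin n) (Fin m × Fin n) (RatFunc ℂ),
      IsBiproper Ol ∧ IsBiproper Or ∧
      Ol * compRingEquiv (Fin m) (Fin n) _ (corePencil m aR p 1 (Matrix.scalar (Fin n) μ)) * Or =
        idOplus m (revHorner aR m (Matrix.scalar (Fin n) μ) 0) := by
  have hμ' : MatTendsAtInfinity (Matrix.scalar (Fin n) μ) 0 := by
    simpa using matTendsAtInfinity_scalar hμ
  rcases hb with rfl | hb
  · exact exists_biproper_reduction_of_index_zero (N := N) (by omega) h (commute_scalar μ) hμ'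
  · exact exists_biproper_reduction_of_det_ne_zero hm h hb hμ'

end BlockLimits

section Realizations

variable {ι κ τ : Type}

lemma polyRat_mul [Fintype κ] (M : Matrix ι κ ℂ[X]) (M' : Matrix κ τ ℂ[X]) :
    polyRat (M * M') = polyRat M * polyRat M' := by
  simp [polyRat, Matrix.map_mul]

lemma polyRat_add (M M' : Matrix ι κ ℂ[X]) : polyRat (M + M') = polyRat M + polyRat M' := by
  ext; simp [polyRat]

lemma polyRat_constPoly (M : Matrix ι κ ℂ) : polyRat (constPoly M) = constRat M := by
  ext; simp [polyRat, constPoly, constRat]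

lemma constRat_mul [Fintype κ] (M : Matrix ι κ ℂ) (M' : Matrix κ τ ℂ) :
    constRat (M * M') = constRat M * constRat M' := by
  simp [constRat, Matrix.map_mul]

lemma polyRat_pencil_eq (E A : Matrix κ κ ℂ) :
    polyRat (pencil E A) = (RatFunc.X : RatFunc ℂ) • constRat E + constRat A := by
  ext i j
  simp only [polyRat, pencil, constPoly, constRat, Matrix.map_apply, Matrix.add_apply,
    Matrix.smul_apply, smul_eq_mul, map_add, map_mul, RatFunc.algebraMap_X, RatFunc.algebraMap_C]

lemma eq_sum_X_pow_smul_constPoly [Finite ι] [Finite κ] (W : Matrix ι κ ℂ[X]) :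
    ∃ (D : ℕ) (w : ℕ → Matrix ι κ ℂ),
      W = ∑ d ∈ Finset.range D, (X ^ d : ℂ[X]) • constPoly (w d) := by
  have := Fintype.ofFinite ι
  have := Fintype.ofFinite κ
  refine ⟨(Finset.univ.sup fun i => Finset.univ.sup fun j => (W i j).natDegree) + 1,
    fun d => Matrix.of fun i j => (W i j).coeff d, ?_⟩
  ext1 i j
  rw [Matrix.sum_apply]
  conv_lhs => rw [(W i j).as_sum_range' ((Finset.univ.sup fun i => Finset.univ.sup fun j =>
    (W i j).natDegree) + 1) (Nat.lt_succ_of_le ((Finset.le_sup (f := fun j => (W i j).natDegree)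
    (Finset.mem_univ j)).trans (Finset.le_sup (f := fun i => Finset.univ.sup fun j =>
    (W i j).natDegree) (Finset.mem_univ i))))]
  refine Finset.sum_congr rfl fun d _ => ?_
  rw [← Polynomial.C_mul_X_pow_eq_monomial, mul_comm]
  simp [constPoly]

lemma induction_matrix_poly [Finite ι] [Finite κ] {p : Matrix ι κ ℂ[X] → Prop}
    (h0 : ∀ M, p (constPoly M)) (hadd : ∀ M M', p M → p M' → p (M + M'))
    (hX : ∀ M, p M → p ((X : ℂ[X]) • M)) (W : Matrix ι κ ℂ[X]) : p W := by
  obtain ⟨D, w, rfl⟩ := eq_sum_X_pow_smul_constPoly W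
  refine Finset.sum_induction _ p hadd ?_ fun d _ => ?_
  · have := h0 0
    simpa [constPoly] using this
  · generalize w d = M
    clear * - h0 hX
    induction d with
    | zero => simpa using h0 M
    | succ d ih => rw [pow_succ', mul_smul]; exact hX _ ih

variable [Fintype κ] [DecidableEq κ]

lemma isBiproper_smul_pencil {E : Matrix κ κ ℂ} (hE : E.det ≠ 0) (A : Matrix κ κ ℂ) :
    IsBiproper ((RatFunc.X : RatFunc ℂ)⁻¹ • polyRat (pencil E A)) := by
  refine MatTendsAtInfinity.isBiproper (D := E) (fun i j => ?_) hE
  rw [polyRat_pencil_eq, smul_add, smul_smul, inv_mul_cancel₀ RatFunc.X_ne_zero, one_smul]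
  have hA := tendsAtInfinity_X_inv.mul (matTendsAtInfinity_constRat A i j)
  have hEA := (matTendsAtInfinity_constRat E i j).add hA
  rwa [zero_mul, add_zero] at hEA

lemma isUnit_det_polyRat_pencil {E : Matrix κ κ ℂ} (hE : E.det ≠ 0) (A : Matrix κ κ ℂ) :
    IsUnit (polyRat (pencil E A)).det := by
  have h := (isBiproper_smul_pencil hE A).isUnit_det
  rw [Matrix.det_smul] at h
  exact isUnit_of_mul_isUnit_right h

lemma matTendsAtInfinity_pencil_inv {E : Matrix κ κ ℂ} (hE : E.det ≠ 0) (A : Matrix κ κ ℂ) :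
    MatTendsAtInfinity (polyRat (pencil E A))⁻¹ 0 := by
  have h := isBiproper_smul_pencil hE A
  have h1 : (polyRat (pencil E A))⁻¹ =
      (RatFunc.X : RatFunc ℂ)⁻¹ • ((RatFunc.X : RatFunc ℂ)⁻¹ • polyRat (pencil E A))⁻¹ := by
    refine Matrix.inv_eq_right_inv ?_
    rw [mul_smul_comm, ← smul_mul_assoc, Matrix.mul_nonsing_inv _ h.isUnit_det]
  obtain ⟨D, hD, h⟩ := h
  intro i j
  rw [h1]
  have := tendsAtInfinity_X_inv.mul (MatTendsAtInfinity.inv h hD i j)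
  rwa [zero_mul] at this

lemma exists_right_division [Finite ι] {E : Matrix κ κ ℂ} (hE : E.det ≠ 0) (A : Matrix κ κ ℂ)
    (W : Matrix ι κ ℂ[X]) : ∃ (Q : Matrix ι κ ℂ[X]) (R : Matrix ι κ ℂ),
      W = Q * pencil E (-A) + constPoly R := by
  induction W using induction_matrix_poly with
  | h0 M => exact ⟨0, M, by simp⟩
  | hadd M M' h h' =>
    obtain ⟨Q, R, rfl⟩ := h
    obtain ⟨Q', R', rfl⟩ := h'
    exact ⟨Q + Q', R + R', by rw [constPoly_add, Matrix.add_mul]; abel⟩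
  | hX M h =>
    obtain ⟨Q, R, rfl⟩ := h
    refine ⟨(X : ℂ[X]) • Q + constPoly (R * E⁻¹), R * E⁻¹ * A, ?_⟩
    rw [Matrix.add_mul, constPoly_mul_pencil, Matrix.mul_assoc R E⁻¹ E,
      Matrix.nonsing_inv_mul _ hE.isUnit, Matrix.mul_one, smul_add, Matrix.smul_mul,
      Matrix.mul_neg]
    have : pencil R (-(R * E⁻¹ * A)) = (X : ℂ[X]) • constPoly R - constPoly (R * E⁻¹ * A) := by
      rw [pencil, constPoly_neg, sub_eq_add_neg]
    rw [this]
    abel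

lemma exists_left_division [Finite ι] {E : Matrix κ κ ℂ} (hE : E.det ≠ 0) (A : Matrix κ κ ℂ)
    (W : Matrix κ ι ℂ[X]) : ∃ (Q : Matrix κ ι ℂ[X]) (R : Matrix κ ι ℂ),
      W = pencil E (-A) * Q + constPoly R := by
  obtain ⟨Q, R, h⟩ := exists_right_division (E := Eᵀ) (by rwa [Matrix.det_transpose]) Aᵀ Wᵀ
  refine ⟨Qᵀ, Rᵀ, ?_⟩
  have h' := congrArg Matrix.transpose h
  rw [Matrix.transpose_transpose, Matrix.transpose_add, Matrix.transpose_mul] at h'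
  exact h'

lemma exists_realization_mul [Fintype ι] [Finite τ] (T : SystemMatrix ι κ) (hE : T.E.det ≠ 0)
    (u : Matrix τ ι ℂ[X]) (v : Matrix ι τ ℂ[X]) :
    ∃ T' : SystemMatrix τ κ, T'.IsRealization (polyRat u * T.transfer * polyRat v) := by
  obtain ⟨Q₁, R₁, h₁⟩ := exists_right_division hE T.A (u * constPoly T.C)
  obtain ⟨Q₂, R₂, h₂⟩ := exists_left_division hE T.A (constPoly T.B * v)
  refine ⟨⟨u * T.P * v + Q₁ * (constPoly T.B * v) + constPoly R₁ * Q₂, R₁, R₂, T.A, T.E⟩, hE, ?_⟩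
  have hu := isUnit_det_polyRat_pencil hE (-T.A)
  have e₁ := congrArg polyRat h₁
  have e₂ := congrArg polyRat h₂
  rw [polyRat_mul, polyRat_add, polyRat_mul, polyRat_constPoly, polyRat_constPoly] at e₁ e₂
  simp only [SystemMatrix.transfer, polyRat_add, polyRat_mul, polyRat_constPoly]
  set Λ := polyRat (pencil T.E (-T.A))
  have : polyRat u * (polyRat T.P + constRat T.C * Λ⁻¹ * constRat T.B) * polyRat v =
      polyRat u * polyRat T.P * polyRat v +
        (polyRat u * constRat T.C) * Λ⁻¹ * (constRat T.B * polyRat v) := by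
    simp only [Matrix.mul_add, Matrix.add_mul, Matrix.mul_assoc]
  rw [this, e₁, Matrix.add_mul, Matrix.add_mul, Matrix.mul_assoc (polyRat Q₁),
    Matrix.mul_nonsing_inv _ hu, Matrix.mul_one, e₂, Matrix.mul_add (constRat R₁ * Λ⁻¹),
    Matrix.mul_assoc (constRat R₁) Λ⁻¹ (Λ * _), ← Matrix.mul_assoc Λ⁻¹ Λ,
    Matrix.nonsing_inv_mul _ hu, Matrix.one_mul]
  abel

end Realizations

section TOddRational

variable {ι κ : Type}

lemma negSubst_algebraMap (p : ℂ[X]) :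
    negSubst (algebraMap ℂ[X] (RatFunc ℂ) p) = algebraMap ℂ[X] (RatFunc ℂ) (p.comp (-X)) := by
  have : algebraMap ℂ[X] (RatFunc ℂ) p =
      algebraMap ℂ[X] (RatFunc ℂ) p / algebraMap ℂ[X] (RatFunc ℂ) 1 := by simp
  rw [this, negSubst, RatFunc.coe_mapRingHom_eq_coe_map, RatFunc.map_apply_div, map_one, map_one,
    div_one]
  rfl

lemma negSubst_C (c : ℂ) : negSubst (RatFunc.C c) = RatFunc.C c := by
  have := negSubst_algebraMap (Polynomial.C c)
  simpa using this

lemma IsTOddPoly.polyRat {M : Matrix ι ι ℂ[X]} (h : IsTOddPoly M) : IsTOddRat (polyRat M) := by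
  ext i j
  have := congrFun (congrFun h i) j
  simp only [Matrix.map_apply, Matrix.transpose_apply, Matrix.neg_apply] at this
  simp [_root_.polyRat, negSubst_algebraMap, this]

lemma IsTOddRat.add {M N : Matrix ι ι (RatFunc ℂ)} (hM : IsTOddRat M) (hN : IsTOddRat N) :
    IsTOddRat (M + N) := by
  rw [IsTOddRat] at *
  rw [neg_add, ← hM, ← hN]
  ext
  simp

lemma IsTOddRat.inv [Fintype κ] [DecidableEq κ] {M : Matrix κ κ (RatFunc ℂ)} (h : IsTOddRat M)
    (hM : IsUnit M.det) : IsTOddRat M⁻¹ := by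
  have h1 : (M⁻¹)ᵀ.map negSubst * Mᵀ.map negSubst = 1 := by
    rw [← Matrix.map_mul, ← Matrix.transpose_mul, Matrix.mul_nonsing_inv _ hM]
    simp
  rw [h, Matrix.mul_neg, ← Matrix.neg_mul] at h1
  exact neg_eq_iff_eq_neg.mp (Matrix.inv_eq_left_inv h1).symm

lemma IsTOddRat.congr [Fintype κ] {M : Matrix κ κ (RatFunc ℂ)} (h : IsTOddRat M)
    (B : Matrix κ ι ℂ) : IsTOddRat (constRat Bᵀ * M * constRat B) := by
  have hB : ∀ (ι κ : Type) (B : Matrix κ ι ℂ), (constRat B).map negSubst = constRat B := by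
    intro ι κ B
    ext
    simp [constRat, negSubst_C]
  have hT : (constRat B)ᵀ = constRat Bᵀ := rfl
  have hT' : (constRat Bᵀ)ᵀ = constRat B := rfl
  rw [IsTOddRat, Matrix.transpose_mul, Matrix.transpose_mul, hT, hT', Matrix.map_mul,
    Matrix.map_mul, h, hB, hB, Matrix.mul_assoc]
  simp

end TOddRational

section BlockUnitVectors

variable {m n p Z H g r : ℕ}

lemma pairProd_last_col {S : Type} [Ring S] (a : ℕ → S) (hm : m = g + 1 + 2 * H) (s : Fin m)
    {c : Fin m} (hc : (c : ℕ) + 1 = m) :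
    (posOdd m a g H * stepTwoProd (posFactor m a) (g + 1) H) s c =
      if (s : ℕ) + 1 + (if H = 0 then 0 else 1) = m then 1 else 0 := by
  unfold posOdd posFactor
  rw [stepTwoProd_elemEntry m _ _ (g + 1) _ (by omega),
    stepTwoProd_elemEntry_mul _ _ _ _ _ (by omega), natMatrix_apply]
  have := s.2
  simp only [idEntry, mul_ite, mul_zero, mul_one]
  grind

lemma posOdd_last_row {S : Type} [Ring S] (a : ℕ → S) (hm : m = g + 1 + 2 * H) {c : Fin m}
    (hc : (c : ℕ) + 1 = m) (s : Fin m) :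
    posOdd m a g H c s = if (s : ℕ) + 1 + (if H = 0 then 0 else 1) = m then 1 else 0 := by
  unfold posOdd posFactor
  rw [stepTwoProd_elemEntry m _ _ (g + 2) _ (by omega), natMatrix_apply]
  have := s.2
  simp only [idEntry, mul_ite, mul_zero, mul_one]
  grind

lemma quasiIdentity_mul_blockCol (ε : Fin m → ℤˣ) {k : Fin m} {k' : ℤ} (hk : k' = (k : ℕ) + 1)
    (C : Matrix (Fin n) (Fin r) ℂ) :
    quasiIdentity n ε * blockCol m k' C = (((ε k : ℤˣ) : ℤ) : ℂ) • blockCol m k' C := by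
  subst hk
  ext ⟨s, x⟩ y
  rw [quasiIdentity, Matrix.diagonal_mul, Matrix.smul_apply, smul_eq_mul, blockCol, of_apply]
  split_ifs with h
  · rw [show s = k from Fin.ext (by simpa using h)]
  · simp

variable {R : Type} [CommRing R]

lemma blockRow_mul_blockCol (B : Matrix (Fin r) (Fin n) R) {τ : ℕ} (C : Matrix (Fin n) (Fin τ) R)
    {k : Fin m} {k' : ℤ} (hk : k' = (k : ℕ) + 1) : blockRow m k' B * blockCol m k' C = B * C := by
  subst hk
  ext x y
  simp only [Matrix.mul_apply, Fintype.sum_prod_type, blockRow, blockCol, of_apply]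
  rw [Finset.sum_eq_single k]
  · simp
  · intro b _ hb
    have : (b : ℕ) ≠ k := fun h => hb (Fin.ext h)
    simp [this]
  · simp

lemma idOplus_mul_blockCol (P : Matrix (Fin n) (Fin n) R) (C : Matrix (Fin n) (Fin r) R) :
    idOplus m P * blockCol m m C = blockCol m m (P * C) := by
  ext ⟨s, x⟩ y
  simp only [Matrix.mul_apply, Fintype.sum_prod_type, idOplus, blockCol, of_apply]
  rw [Finset.sum_eq_single s]
  · by_cases hs : (s : ℕ) + 1 = m
    · have : ((s : ℕ) : ℤ) + 1 = m := by omega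
      simp [hs, this]
    · have : ((s : ℕ) : ℤ) + 1 ≠ m := by omega
      simp [this]
  · intro b _ hb
    simp [hb.symm]
  · simp

lemma blockCol_transpose (k' : ℤ) (B : Matrix (Fin r) (Fin n) R) :
    (blockRow m k' B)ᵀ = blockCol m k' Bᵀ := rfl

lemma blockCol_neg (k' : ℤ) (C : Matrix (Fin n) (Fin r) R) :
    blockCol m k' (-C) = -blockCol m k' C := by
  ext a b
  simp only [blockCol, of_apply, Matrix.neg_apply]
  split_ifs <;> simp

lemma constPoly_blockCol (k' : ℤ) (C : Matrix (Fin n) (Fin r) ℂ) :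
    constPoly (blockCol m k' C) = blockCol m k' (constPoly C) := by
  ext1 a b
  simp only [constPoly, blockCol, of_apply, Matrix.map_apply]
  split_ifs <;> simp

lemma constPoly_blockRow (k' : ℤ) (B : Matrix (Fin r) (Fin n) ℂ) :
    constPoly (blockRow m k' B) = blockRow m k' (constPoly B) := by
  ext1 a b
  simp only [constPoly, blockRow, of_apply, Matrix.map_apply]
  split_ifs <;> simp

lemma blockCol_injective {k : Fin m} {k' : ℤ} (hk : k' = (k : ℕ) + 1)
    {C C' : Matrix (Fin n) (Fin r) R} (h : blockCol m k' C = blockCol m k' C') : C = C' := by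
  subst hk
  ext x y
  have := congrFun (congrFun h (k, x)) y
  simpa [blockCol] using this

end BlockUnitVectors

section BlockForm

variable {m n r : ℕ}

lemma blockDiag2_mul {R ι ρ : Type} [Ring R] [Fintype ι] [Fintype ρ] (U U' : Matrix ι ι R)
    (V V' : Matrix ρ ρ R) : blockDiag2 U V * blockDiag2 U' V' = blockDiag2 (U * U') (V * V') := by
  simp [blockDiag2, Matrix.fromBlocks_multiply]

lemma tupleProd_eq_blockDiag2 {R ι ρ : Type} [Ring R] [Fintype ι] [Fintype ρ] [DecidableEq ι]
    [DecidableEq ρ] (F : ℤ → Matrix (ι ⊕ ρ) (ι ⊕ ρ) R) (F' : ℤ → Matrix ι ι R) (t : List ℤ)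
    (h : ∀ i ∈ t, F i = blockDiag2 (F' i) 1) :
    tupleProd F t = blockDiag2 (tupleProd F' t) 1 := by
  induction t with
  | nil => simp [tupleProd, blockDiag2]
  | cons i t ih =>
    have := ih fun j hj => h j (List.mem_cons_of_mem _ hj)
    rw [tupleProd] at this ⊢
    rw [List.map_cons, List.prod_cons, this, h i List.mem_cons_self, blockDiag2_mul, one_mul]
    rfl

lemma fiedlerS_of_ne (Ac : ℕ → Matrix (Fin n) (Fin n) ℂ) (C : Matrix (Fin n) (Fin r) ℂ)
    (B : Matrix (Fin r) (Fin n) ℂ) (A : Matrix (Fin r) (Fin r) ℂ) {i : ℤ} (hi : i ≠ 0) :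
    fiedlerS m Ac C B A (-1) i = blockDiag2 (fiedlerP m Ac i) 1 := by
  rw [fiedlerS, if_neg hi, neg_neg, ite_self]

lemma constPoly_fromBlocks {ι ρ : Type} (M₁ : Matrix ι ι ℂ) (M₂ : Matrix ι ρ ℂ)
    (M₃ : Matrix ρ ι ℂ) (M₄ : Matrix ρ ρ ℂ) :
    constPoly (Matrix.fromBlocks M₁ M₂ M₃ M₄) =
      Matrix.fromBlocks (constPoly M₁) (constPoly M₂) (constPoly M₃) (constPoly M₄) :=
  Matrix.fromBlocks_map _ _ _ _ _

lemma constPoly_blockDiag2 {ι ρ : Type} (M : Matrix ι ι ℂ) (N : Matrix ρ ρ ℂ) :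
    constPoly (blockDiag2 M N) = blockDiag2 (constPoly M) (constPoly N) := by
  rw [blockDiag2, constPoly_fromBlocks, blockDiag2]
  congr 1 <;> (ext1; simp [constPoly])

lemma pencil_blockDiag2_mul {ι ρ : Type} [Fintype ι] [Fintype ρ] [DecidableEq ρ]
    (Mz W F D : Matrix ι ι ℂ) (C : Matrix ι ρ ℂ) (B : Matrix ρ ι ℂ) (A : Matrix ρ ρ ℂ) :
    pencil (blockDiag2 Mz (1 : Matrix ρ ρ ℂ)) (-(blockDiag2 W 1 * Matrix.fromBlocks F C (-B) A)) *
        constPoly (blockDiag2 D 1) =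
      Matrix.fromBlocks (pencil (Mz * D) (-(W * F) * D)) (constPoly (-(W * C)))
        (constPoly (B * D)) (pencil 1 (-A)) := by
  rw [pencil_mul_constPoly, blockDiag2, blockDiag2, blockDiag2, pencil, Matrix.fromBlocks_multiply,
    Matrix.fromBlocks_multiply, Matrix.fromBlocks_neg, Matrix.fromBlocks_multiply,
    constPoly_fromBlocks, constPoly_fromBlocks, Matrix.fromBlocks_smul, Matrix.fromBlocks_add]
  have h0 : ∀ ι κ : Type, constPoly (0 : Matrix ι κ ℂ) = 0 := fun ι κ => by ext1; simp [constPoly]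
  congr 1 <;> simp [pencil, h0]

lemma isTOddPoly_fromBlocks {ι ρ : Type} (P : Matrix ι ι ℂ[X]) (C : Matrix ι ρ ℂ)
    (B : Matrix ρ ι ℂ) (D : Matrix ρ ρ ℂ[X]) :
    IsTOddPoly (Matrix.fromBlocks P (constPoly C) (constPoly B) D) ↔
      IsTOddPoly P ∧ IsTOddPoly D ∧ C = -Bᵀ := by
  have hc : ∀ (κ τ : Type) (M : Matrix κ τ ℂ),
      (constPoly M)ᵀ.map (fun f => f.comp (-X)) = constPoly Mᵀ := fun κ τ M => by
    ext1
    simp [constPoly]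
  rw [IsTOddPoly, Matrix.fromBlocks_transpose, Matrix.fromBlocks_map, Matrix.fromBlocks_neg,
    Matrix.fromBlocks_inj, hc, hc, ← constPoly_neg, ← constPoly_neg, constPoly_injective.eq_iff,
    constPoly_injective.eq_iff, IsTOddPoly, IsTOddPoly]
  constructor
  · rintro ⟨h1, h2, -, h4⟩
    exact ⟨h1, h4, by rw [h2, neg_neg]⟩
  · rintro ⟨h1, h4, rfl⟩
    exact ⟨h1, by simp, by simp, h4⟩

end BlockForm

section Coefficients

variable {n : ℕ}

lemma coeff_matPoly (m : ℕ) (Ac : ℕ → Matrix (Fin n) (Fin n) ℂ) (i j : Fin n) {d : ℕ}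
    (hd : d ≤ m) : (matPoly m Ac i j).coeff d = Ac d i j := by
  rw [matPoly, Matrix.sum_apply, Polynomial.finsetSum_coeff, Finset.sum_eq_single d]
  · simp [constPoly]
  · intro b _ hb
    simp [constPoly, Polynomial.coeff_X_pow, hb.symm]
  · intro h
    exact absurd (Finset.mem_range.2 (by omega)) h

lemma transpose_coeff_of_isTOddPoly {m : ℕ} {Ac : ℕ → Matrix (Fin n) (Fin n) ℂ}
    (h : IsTOddPoly (matPoly m Ac)) {d : ℕ} (hd : d ≤ m) :
    (Ac d)ᵀ = (-1 : ℤˣ) ^ (d + 1) • Ac d := by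
  ext i j
  have h1 := congrArg (fun f => f.coeff d) (congrFun (congrFun h i) j)
  simp only [Matrix.map_apply, Matrix.transpose_apply, Matrix.neg_apply, Polynomial.coeff_neg,
    coeff_matPoly m Ac _ _ hd] at h1
  rw [show (-X : ℂ[X]) = Polynomial.C (-1) * X by simp, Polynomial.comp_C_mul_X_coeff,
    coeff_matPoly m Ac _ _ hd, mul_comm] at h1
  rcases Nat.even_or_odd d with he | ho
  · rw [he.neg_one_pow, one_mul] at h1
    rw [pow_succ, he.neg_one_pow]
    simpa [Units.smul_def] using h1
  · rw [ho.neg_one_pow] at h1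
    rw [pow_succ, ho.neg_one_pow]
    simpa [Units.smul_def] using h1

lemma transpose_revCoeff {m : ℕ} {Ac : ℕ → Matrix (Fin n) (Fin n) ℂ}
    (h : IsTOddPoly (matPoly m Ac)) (t : ℕ) (ht : t ≤ m) :
    (revCoeff m Ac t)ᵀ = (-1 : ℤˣ) ^ (m + t + 1) • revCoeff m Ac t := by
  rw [revCoeff, transpose_coeff_of_isTOddPoly h (Nat.sub_le m t)]
  congr 1
  rw [show m + t + 1 = m - t + 1 + 2 * t by omega, pow_add _ (m - t + 1), pow_mul]
  simp

end Coefficients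

section TuplePencils

variable {m n r p Z H g : ℕ} (Ac : ℕ → Matrix (Fin n) (Fin n) ℂ)

lemma gfprP_eq (hm : m = g + 1 + 2 * H) (hg : g = p + 2 * Z) {z cz : List ℤ}
    (hz : shiftTuple m z = admissibleTuple g p) (hcz : shiftTuple m cz = symmComplement g p) :
    gfprP m Ac (admissibleTuple (2 * H) 0) (symmComplement (2 * H) 0) z cz =
      congPencil m (revCoeff m Ac) p Z g H := by
  rw [congPencil_eq_pencil, gfprP, pencil_mul_constPoly, pencil_mul_constPoly,
    tupleProd_fiedlerP_admissibleTuple Ac hm, tupleProd_fiedlerP_symmComplement Ac hm,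
    tupleProd_fiedlerP_of_shift_admissibleTuple Ac hm hg hz,
    tupleProd_fiedlerP_of_shift_symmComplement Ac hm hg hcz, neg_mul, neg_mul, ← map_mul, ← map_mul,
    ← map_mul, ← map_mul, congFactor_mul_leadEntry_mul_congFactor _ hm hg,
    congFactor_mul_constEntry_mul_congFactor _ hm hg]

lemma tupleProd_fiedlerPExt (t : List ℤ) :
    tupleProd (fiedlerPExt m r Ac) t = blockDiag2 (tupleProd (fiedlerP m Ac) t) 1 :=
  tupleProd_eq_blockDiag2 _ _ t fun _ _ => rfl

lemma tupleProd_fiedlerS_of_ne (C : Matrix (Fin n) (Fin r) ℂ) (B : Matrix (Fin r) (Fin n) ℂ)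
    (A : Matrix (Fin r) (Fin r) ℂ) {t : List ℤ} (ht : ∀ i ∈ t, i ≠ 0) :
    tupleProd (fiedlerS m Ac C B A (-1)) t = blockDiag2 (tupleProd (fiedlerP m Ac) t) 1 :=
  tupleProd_eq_blockDiag2 _ _ t fun i hi => fiedlerS_of_ne Ac C B A (ht i hi)

lemma ne_zero_of_mem_shift (hg : g = p + 2 * Z) (hgm : g < m) {z : List ℤ}
    (hz : shiftTuple m z = admissibleTuple g p) {i : ℤ} (hi : i ∈ z) : i ≠ 0 := by
  have h1 : i + m ∈ admissibleTuple g p := by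
    rw [← hz]
    exact List.mem_map_of_mem hi
  rw [hg, admissibleTuple_eq, List.mem_append, List.mem_map] at h1
  rcases h1 with h1 | ⟨l, hl, h1⟩
  · have := (mem_pairTuple h1).2
    omega
  · rw [List.mem_range] at hl
    omega

lemma ne_zero_of_mem_pairTuple {i : ℤ} (hi : i ∈ pairTuple ((2 * H : ℕ) : ℤ) H) : i ≠ 0 := by
  have := (mem_pairTuple hi).1
  push_cast at this
  omega

lemma fiedlerS_zero (C : Matrix (Fin n) (Fin r) ℂ) (B : Matrix (Fin r) (Fin n) ℂ)
    (A E : Matrix (Fin r) (Fin r) ℂ) : fiedlerS m Ac C B A E 0 =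
      Matrix.fromBlocks (fiedlerP m Ac 0) (-blockCol m m C) (-blockRow m m B) (-A) :=
  if_pos rfl

lemma tupleProd_admissibleTuple_zero {κ : Type} [Fintype κ] [DecidableEq κ]
    (F : ℤ → Matrix κ κ ℂ) (N : ℕ) : tupleProd F (admissibleTuple (2 * N) 0) =
      tupleProd F (pairTuple ((2 * N : ℕ) : ℤ) N) * F 0 := by
  simp [admissibleTuple_zero, tupleProd]

lemma tupleProd_fiedlerS_admissibleTuple (C : Matrix (Fin n) (Fin r) ℂ)
    (B : Matrix (Fin r) (Fin n) ℂ) (A : Matrix (Fin r) (Fin r) ℂ) :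
    tupleProd (fiedlerS m Ac (-C) B (-A) (-1)) (admissibleTuple (2 * H) 0) =
      blockDiag2 (tupleProd (fiedlerP m Ac) (pairTuple ((2 * H : ℕ) : ℤ) H)) 1 *
        Matrix.fromBlocks (fiedlerP m Ac 0) (blockCol m m C) (-blockRow m m B) A := by
  rw [tupleProd_admissibleTuple_zero, tupleProd_fiedlerS_of_ne _ _ _ _ fun i =>
    ne_zero_of_mem_pairTuple, fiedlerS_zero, blockCol_neg, neg_neg, neg_neg]

lemma tupleProd_pairTuple_mul_blockCol (hm : m = g + 1 + 2 * H) {k : Fin m} {k' : ℤ}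
    (hk' : k' = (k : ℕ) + 1) (hk : (k : ℕ) + 1 + (if H = 0 then 0 else 1) = m)
    (C : Matrix (Fin n) (Fin r) ℂ) :
    tupleProd (fiedlerP m Ac) (pairTuple ((2 * H : ℕ) : ℤ) H) * blockCol m m C =
      blockCol m k' C := by
  have hc : m - 1 + 1 = m := by omega
  rw [tupleProd_pairTuple Ac hm]
  refine comp_mul_blockCol (c := ⟨m - 1, by omega⟩) _ (fun s => ?_) _ (by simp; omega) hk'
  rw [pairProd_last_col _ hm s hc]
  exact if_congr ⟨fun h => Fin.ext (by omega), fun h => h ▸ hk⟩ rfl rfl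

lemma blockRow_mul_tupleProd_symmComplement (hm : m = g + 1 + 2 * H) (hg : g = p + 2 * Z)
    {cz : List ℤ} (hcz : shiftTuple m cz = symmComplement g p) {k : Fin m} {k' : ℤ}
    (hk' : k' = (k : ℕ) + 1) (hk : (k : ℕ) + 1 + (if H = 0 then 0 else 1) = m)
    (B : Matrix (Fin r) (Fin n) ℂ) :
    blockRow m m B * (tupleProd (fiedlerP m Ac) (symmComplement (2 * H) 0) *
      tupleProd (fiedlerP m Ac) cz) = blockRow m k' B := by
  have hc : m - 1 + 1 = m := by omega
  have hkg : g ≤ k := by split_ifs at hk <;> omega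
  have hposOdd (s : Fin m) : posOdd m (revCoeff m Ac) g H ⟨m - 1, by omega⟩ s =
      if s = k then 1 else 0 := by
    rw [posOdd_last_row _ hm hc]
    exact if_congr ⟨fun h => Fin.ext (by omega), fun h => h ▸ hk⟩ rfl rfl
  have hnegOdd (s : Fin m) : negOdd m (revCoeff m Ac) p Z k s = if s = k then 1 else 0 := by
    rw [negOdd_row _ hg hkg]
    exact if_congr Fin.ext_iff.symm rfl rfl
  have hhankel (s : Fin m) : natMatrix m (hankelEntry (revCoeff m Ac) p) k s =
      if s = k then 1 else 0 := by
    rw [hankelEntry_row _ (by omega)]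
    exact if_congr Fin.ext_iff.symm rfl rfl
  rw [tupleProd_fiedlerP_symmComplement Ac hm,
    tupleProd_fiedlerP_of_shift_symmComplement Ac hm hg hcz, map_mul, ← Matrix.mul_assoc,
    ← Matrix.mul_assoc, blockRow_mul_comp _ hposOdd B (by simp; omega) hk',
    blockRow_mul_comp _ hnegOdd B hk' hk', blockRow_mul_comp _ hhankel B hk' hk']

lemma gfprS_eq (hm : m = g + 1 + 2 * H) (hg : g = p + 2 * Z) {z cz : List ℤ}
    (hz : shiftTuple m z = admissibleTuple g p) (hcz : shiftTuple m cz = symmComplement g p)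
    (B : Matrix (Fin r) (Fin n) ℂ) (A : Matrix (Fin r) (Fin r) ℂ) {k : Fin m} {k' : ℤ}
    (hk' : k' = (k : ℕ) + 1) (hk : (k : ℕ) + 1 + (if H = 0 then 0 else 1) = m) :
    gfprS m Ac (-Bᵀ) B (-A) (-1) (admissibleTuple (2 * H) 0) (symmComplement (2 * H) 0) z cz =
      Matrix.fromBlocks (congPencil m (revCoeff m Ac) p Z g H)
        (constPoly (-blockCol m k' Bᵀ)) (constPoly (blockRow m k' B)) (pencil 1 (-A)) := by
  rw [gfprS, tupleProd_fiedlerS_admissibleTuple, tupleProd_fiedlerPExt, tupleProd_fiedlerPExt,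
    tupleProd_fiedlerS_of_ne _ _ _ _ fun i => ne_zero_of_mem_shift hg (by omega) hz,
    Matrix.mul_assoc, ← constPoly_mul, blockDiag2_mul, Matrix.one_mul, pencil_blockDiag2_mul,
    tupleProd_pairTuple_mul_blockCol Ac hm hk' hk,
    blockRow_mul_tupleProd_symmComplement Ac hm hg hcz hk' hk, ← gfprP_eq Ac hm hg hz hcz, gfprP,
    Matrix.mul_assoc, ← constPoly_mul, pencil_mul_constPoly, tupleProd_admissibleTuple_zero]

end TuplePencils

section UnimodularReduction

variable {m n p Z H g : ℕ} {Ac : ℕ → Matrix (Fin n) (Fin n) ℂ}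

lemma isUnit_constPoly {ι : Type} [Fintype ι] [DecidableEq ι] {N : Matrix ι ι ℂ} (h : IsUnit N) :
    IsUnit (constPoly N) :=
  h.map (Polynomial.C : ℂ →+* ℂ[X]).mapMatrix

lemma isUnit_quasiIdentity (ε : Fin m → ℤˣ) : IsUnit (quasiIdentity n ε) :=
  ⟨⟨_, _, quasiIdentity_mul_self ε, quasiIdentity_mul_self ε⟩, rfl⟩

lemma isUnit_flatCong (a : ℕ → Matrix (Fin n) (Fin n) ℂ) (hm : m = g + 1 + 2 * H)
    (hg : g = p + 2 * Z) : IsUnit (flatCong m a p Z g H) :=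
  (isUnit_congFactor a hm hg).map (compRingEquiv (Fin m) (Fin n) ℂ)

lemma flatCong_mul_blockCol (a : ℕ → Matrix (Fin n) (Fin n) ℂ) (hm : m = g + 1 + 2 * H)
    (hg : g = p + 2 * Z) {k : Fin m} {k' : ℤ} (hk' : k' = (k : ℕ) + 1)
    (hk : (k : ℕ) + 1 + (if H = 0 then 0 else 1) = m) {r : ℕ} (C : Matrix (Fin n) (Fin r) ℂ) :
    flatCong m a p Z g H * blockCol m m C = blockCol m k' C := by
  refine comp_mul_blockCol (c := ⟨m - 1, by omega⟩) _ (fun s => ?_) C (by simp; omega) hk'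
  rw [congFactor_eq a hm hg, natMatrix_apply, congFactorEntry_last_col a hm hg s.2]
  refine if_congr ⟨fun h => Fin.ext (by split_ifs at h hk <;> omega), fun h => h ▸ hk⟩ rfl rfl

lemma blockRow_mul_flatCong (a : ℕ → Matrix (Fin n) (Fin n) ℂ) (hm : m = g + 1 + 2 * H)
    (hg : g = p + 2 * Z) {k : Fin m} {k' : ℤ} (hk' : k' = (k : ℕ) + 1)
    (hk : (k : ℕ) + 1 + (if H = 0 then 0 else 1) = m) {r : ℕ} (B : Matrix (Fin r) (Fin n) ℂ) :
    blockRow m m B * flatCong m a p Z g H = blockRow m k' B := by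
  refine blockRow_mul_comp (c := ⟨m - 1, by omega⟩) _ (fun s => ?_) B (by simp; omega) hk'
  rw [congFactor_eq a hm hg, natMatrix_apply, congFactorEntry_last_row a hm s.2]
  refine if_congr ⟨fun h => Fin.ext (by split_ifs at h hk <;> omega), fun h => h ▸ hk⟩ rfl rfl

lemma quasiIdentity_mul_flatCong_mul_blockCol (a : ℕ → Matrix (Fin n) (Fin n) ℂ)
    (hm : m = g + 1 + 2 * H) (hg : g = p + 2 * Z) {ε : Fin m → ℤˣ} {k : Fin m} {k' : ℤ}
    (hk' : k' = (k : ℕ) + 1) (hk : (k : ℕ) + 1 + (if H = 0 then 0 else 1) = m) (hε : ε k = 1)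
    {r : ℕ} (C : Matrix (Fin n) (Fin r) ℂ) :
    quasiIdentity n ε * flatCong m a p Z g H * blockCol m m C = blockCol m k' C := by
  rw [Matrix.mul_assoc, flatCong_mul_blockCol a hm hg hk' hk, quasiIdentity_mul_blockCol ε hk', hε,
    Units.val_one, Int.cast_one, one_smul]

lemma exists_unimodular_reduction (hm : m = g + 1 + 2 * H) (hg : g = p + 2 * Z)
    (ha : p ≠ 0 → (Ac m).det ≠ 0) {ε : Fin m → ℤˣ} {k : Fin m} {k' : ℤ} (hk' : k' = (k : ℕ) + 1)
    (hk : (k : ℕ) + 1 + (if H = 0 then 0 else 1) = m) (hε : ε k = 1) :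
    ∃ U V : Matrix (Fin m × Fin n) (Fin m × Fin n) ℂ[X], IsUnit U ∧ IsUnit V ∧
      U * (constPoly (quasiIdentity n ε) * congPencil m (revCoeff m Ac) p Z g H) * V =
        idOplus m (matPoly m Ac) ∧
      (∀ (r : ℕ) (C : Matrix (Fin n) (Fin r) ℂ),
        U * constPoly (blockCol m k' C) = constPoly (blockCol m m C)) ∧
      (∀ (r : ℕ) (B : Matrix (Fin r) (Fin n) ℂ),
        constPoly (blockRow m k' B) * V = constPoly (blockRow m m B)) := by
  obtain ⟨M, V, hM, hV, h, hcol, hrow⟩ :=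
    exists_unimodular_core_reduction Ac (show m = p + 2 * (Z + H) + 1 by omega) ha
  have hO := isUnit_flatCong (revCoeff m Ac) hm hg
  have hWcol {r : ℕ} := quasiIdentity_mul_flatCong_mul_blockCol (r := r) (revCoeff m Ac) hm hg hk'
    hk hε
  have hOrow {r : ℕ} := blockRow_mul_flatCong (r := r) (revCoeff m Ac) hm hg hk' hk
  set O := flatCong m (revCoeff m Ac) p Z g H
  have hcO := isUnit_constPoly hO
  have hcW := isUnit_constPoly ((isUnit_quasiIdentity (n := n) ε).mul hO)
  have hMdet := (Matrix.isUnit_iff_isUnit_det M).1 hM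
  have hOdet := (Matrix.isUnit_iff_isUnit_det _).1 hcO
  have hWdet := (Matrix.isUnit_iff_isUnit_det _).1 hcW
  refine ⟨M⁻¹ * (constPoly (quasiIdentity n ε * O))⁻¹, (constPoly O)⁻¹ * V,
    (Matrix.isUnit_nonsing_inv_iff.2 hM).mul (Matrix.isUnit_nonsing_inv_iff.2 hcW),
    (Matrix.isUnit_nonsing_inv_iff.2 hcO).mul hV, ?_, fun r C => ?_, fun r B => ?_⟩
  · have hpencil : constPoly (quasiIdentity n ε) * congPencil m (revCoeff m Ac) p Z g H =
        constPoly (quasiIdentity n ε * O) * (flatCore m (revCoeff m Ac) p * constPoly O) := by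
      simp only [congPencil, constPoly_mul, Matrix.mul_assoc, O]
    rw [hpencil, mul_assoc M⁻¹, Matrix.nonsing_inv_mul_cancel_left _ _ hWdet, mul_assoc, mul_assoc,
      Matrix.mul_nonsing_inv_cancel_left _ _ hOdet, h,
      Matrix.nonsing_inv_mul_cancel_left _ _ hMdet]
  · rw [← hWcol, constPoly_mul _ (blockCol m m C), Matrix.mul_assoc,
      Matrix.nonsing_inv_mul_cancel_left _ _ hWdet, constPoly_blockCol, ← hcol,
      Matrix.nonsing_inv_mul_cancel_left _ _ hMdet, hcol]
  · rw [← hOrow, constPoly_mul, ← Matrix.mul_assoc, Matrix.mul_nonsing_inv_cancel_right _ _ hOdet,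
      constPoly_blockRow, hrow]

end UnimodularReduction

section BiproperReduction

variable {m n r p N : ℕ} {Ac : ℕ → Matrix (Fin n) (Fin n) ℂ}

/-- The strictly proper part `C (λE - A)⁻¹ B` of the transfer function of a system matrix with
nonsingular `E`. -/
noncomputable def SystemMatrix.strictlyProperPart {ι κ : Type} [Fintype κ] [DecidableEq κ]
    (S : SystemMatrix ι κ) : Matrix ι ι (RatFunc ℂ) :=
  constRat S.C * (polyRat (pencil S.E (-S.A)))⁻¹ * constRat S.B

lemma SystemMatrix.matTendsAtInfinity_strictlyProperPart {ι κ : Type} [Fintype κ] [DecidableEq κ]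
    {S : SystemMatrix ι κ} (hE : S.E.det ≠ 0) : MatTendsAtInfinity S.strictlyProperPart 0 := by
  have h := ((matTendsAtInfinity_constRat S.C).mul (matTendsAtInfinity_pencil_inv hE (-S.A))).mul
    (matTendsAtInfinity_constRat S.B)
  rwa [Matrix.mul_zero, Matrix.zero_mul] at h

lemma corePencil_add_ite {S : Type} [Ring S] (hm : m = p + 2 * N + 1) (a : ℕ → S) (w α β : S) :
    corePencil m (fun t => a t + if t = m then w else 0) p α β = corePencil m a p α β +
      natMatrix m fun s t => if s + 1 = m ∧ t + 1 = m then β * w else 0 := by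
  rw [corePencil, corePencil, ← sub_eq_iff_eq_add']
  ext s t
  have hs := s.2
  have ht := t.2
  simp only [Matrix.sub_apply, natMatrix_apply, leadEntry, constEntry]
  split_ifs <;> first | omega | (simp; done) | (simp [mul_add]; abel)

/-- The reversed coefficients of `P(λ) + W(λ)`, with `W` (strictly proper, in the application)
included in the coefficient of index `m`, that of `λ ^ 0`. -/
noncomputable def properCoeff (m : ℕ) (Ac : ℕ → Matrix (Fin n) (Fin n) ℂ)
    (W : Matrix (Fin n) (Fin n) (RatFunc ℂ)) (t : ℕ) : Matrix (Fin n) (Fin n) (RatFunc ℂ) :=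
  constRat (revCoeff m Ac t) + if t = m then W else 0

lemma matTendsAtInfinity_properCoeff {W : Matrix (Fin n) (Fin n) (RatFunc ℂ)}
    (hW : MatTendsAtInfinity W 0) (t : ℕ) :
    MatTendsAtInfinity (properCoeff m Ac W t) (revCoeff m Ac t) := by
  have hite : MatTendsAtInfinity (if t = m then W else 0) (0 : Matrix (Fin n) (Fin n) ℂ) := by
    split_ifs
    exacts [hW, matTendsAtInfinity_zero]
  have h := (matTendsAtInfinity_constRat (revCoeff m Ac t)).add hite
  rwa [add_zero] at h

lemma polyRat_matPoly (m : ℕ) (Ac : ℕ → Matrix (Fin n) (Fin n) ℂ) :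
    polyRat (matPoly m Ac) = ∑ i ∈ Finset.range (m + 1),
      (RatFunc.X : RatFunc ℂ) ^ (m - i) • constRat (revCoeff m Ac i) := by
  rw [← Finset.sum_range_reflect, matPoly]
  ext1 x y
  rw [polyRat, Matrix.map_apply, Matrix.sum_apply, Matrix.sum_apply, map_sum]
  refine Finset.sum_congr rfl fun u hu => ?_
  rw [Finset.mem_range] at hu
  rw [revCoeff, show m - (m + 1 - 1 - u) = u by omega]
  simp only [constPoly, constRat, Matrix.smul_apply, Matrix.map_apply, smul_eq_mul, map_mul,
    map_pow, RatFunc.algebraMap_X, RatFunc.algebraMap_C]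

lemma revHorner_properCoeff (W : Matrix (Fin n) (Fin n) (RatFunc ℂ)) :
    revHorner (properCoeff m Ac W) m (Matrix.scalar (Fin n) (RatFunc.X : RatFunc ℂ)⁻¹) 0 =
      ((RatFunc.X : RatFunc ℂ) ^ m)⁻¹ • (polyRat (matPoly m Ac) + W) := by
  have hscalar (i : ℕ) (M : Matrix (Fin n) (Fin n) (RatFunc ℂ)) :
      Matrix.scalar (Fin n) (RatFunc.X : RatFunc ℂ)⁻¹ ^ i * M =
        ((RatFunc.X : RatFunc ℂ) ^ i)⁻¹ • M := by
    rw [← map_pow, inv_pow, Matrix.scalar_apply, ← Matrix.smul_eq_diagonal_mul]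
  have hpow {i : ℕ} (hi : i ≤ m) : ((RatFunc.X : RatFunc ℂ) ^ m)⁻¹ * RatFunc.X ^ (m - i) =
      (RatFunc.X ^ i)⁻¹ := by
    have hX : (RatFunc.X : RatFunc ℂ) ≠ 0 := RatFunc.X_ne_zero
    rw [inv_mul_eq_iff_eq_mul₀ (pow_ne_zero _ hX), pow_sub₀ _ hX hi]
  rw [revHorner, polyRat_matPoly, smul_add, Finset.smul_sum]
  simp only [properCoeff, hscalar, smul_add, Finset.sum_add_distrib, zero_add, Nat.sub_zero]
  congr 1
  · refine Finset.sum_congr rfl fun i hi => ?_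
    rw [smul_smul, hpow (Nat.lt_succ_iff.1 (Finset.mem_range.1 hi))]
  · simp

lemma polyRat_flatCore (a : ℕ → Matrix (Fin n) (Fin n) ℂ) :
    polyRat (flatCore m a p) = compRingEquiv (Fin m) (Fin n) (RatFunc ℂ)
      (corePencil m (fun t => constRat (a t)) p (Matrix.scalar (Fin n) RatFunc.X) 1) := by
  let φ : Matrix (Fin n) (Fin n) ℂ →+* Matrix (Fin n) (Fin n) (RatFunc ℂ) := RatFunc.C.mapMatrix
  have hlead : ∀ s t, leadEntry (fun i => constRat (a i)) p s t = constRat (leadEntry a p s t) :=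
    fun s t => (map_leadEntry φ a p s t).symm
  have hconst : ∀ s t, constEntry (fun i => constRat (a i)) p s t = constRat (constEntry a p s t) :=
    fun s t => (map_constEntry φ a p s t).symm
  rw [flatCore, polyRat_pencil_eq]
  ext1 ⟨s, x⟩ ⟨t, y⟩
  simp only [compRingEquiv_apply, comp_apply, corePencil, natMatrix_apply, hlead, hconst, one_mul,
    Matrix.add_apply, Matrix.sub_apply, Matrix.smul_apply]
  simp [constRat, sub_eq_add_neg]

lemma constRat_blockCol_mul_mul_blockRow (C : Matrix (Fin n) (Fin r) ℂ)
    (D : Matrix (Fin r) (Fin r) (RatFunc ℂ)) (B : Matrix (Fin r) (Fin n) ℂ) :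
    constRat (blockCol m m C) * D * constRat (blockRow m m B) =
      compRingEquiv (Fin m) (Fin n) (RatFunc ℂ) (natMatrix m fun s t =>
        if s + 1 = m ∧ t + 1 = m then constRat C * D * constRat B else 0) := by
  ext1 ⟨s, x⟩ ⟨t, y⟩
  have hs : ((s : ℕ) : ℤ) + 1 = m ↔ (s : ℕ) + 1 = m := by omega
  have ht : ((t : ℕ) : ℤ) + 1 = m ↔ (t : ℕ) + 1 = m := by omega
  simp only [compRingEquiv_apply, comp_apply, natMatrix_apply, Matrix.mul_apply, constRat, blockCol,
    blockRow, Matrix.map_apply, of_apply, hs, ht]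
  by_cases h1 : (s : ℕ) + 1 = m <;> by_cases h2 : (t : ℕ) + 1 = m <;>
    simp [h1, h2, Matrix.mul_apply]

/-- The strictly proper part of the transfer function enters the core pencil in its last block only,
as a contribution to the coefficient of `λ ^ 0`. -/
lemma inv_X_smul_transfer_flatCore (hm : m = p + 2 * N + 1) (S : SystemMatrix (Fin n) (Fin r)) :
    (RatFunc.X : RatFunc ℂ)⁻¹ • SystemMatrix.transfer
      ⟨flatCore m (revCoeff m Ac) p, blockCol m m S.C, blockRow m m S.B, S.A, S.E⟩ =
      compRingEquiv (Fin m) (Fin n) (RatFunc ℂ) (corePencil m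
        (properCoeff m Ac S.strictlyProperPart) p 1
        (Matrix.scalar (Fin n) (RatFunc.X : RatFunc ℂ)⁻¹)) := by
  have hadd := corePencil_add_ite hm (fun t => constRat (revCoeff m Ac t)) S.strictlyProperPart 1
    (Matrix.scalar (Fin n) (RatFunc.X : RatFunc ℂ)⁻¹)
  rw [SystemMatrix.transfer, constRat_blockCol_mul_mul_blockRow, polyRat_flatCore, ← map_add]
  refine Eq.trans ?_ (congrArg _ hadd.symm)
  ext1 ⟨s, x⟩ ⟨t, y⟩
  simp only [corePencil, compRingEquiv_apply, comp_apply, natMatrix_apply, Matrix.smul_apply,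
    Matrix.add_apply, Matrix.sub_apply, one_mul, Matrix.scalar_apply, ← Matrix.smul_eq_diagonal_mul,
    smul_eq_mul, SystemMatrix.strictlyProperPart]
  have hX : (RatFunc.X : RatFunc ℂ) ≠ 0 := RatFunc.X_ne_zero
  split_ifs <;> simp [field]

lemma exists_biproper_flatCore_reduction (hm : m = p + 2 * N + 1) (ha : p ≠ 0 → (Ac m).det ≠ 0)
    {S : SystemMatrix (Fin n) (Fin r)} (hE : S.E.det ≠ 0) (hP : S.P = matPoly m Ac) :
    ∃ Ol Or : Matrix (Fin m × Fin n) (Fin m × Fin n) (RatFunc ℂ), IsBiproper Ol ∧ IsBiproper Or ∧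
      Ol * ((RatFunc.X : RatFunc ℂ)⁻¹ • SystemMatrix.transfer
        ⟨flatCore m (revCoeff m Ac) p, blockCol m m S.C, blockRow m m S.B, S.A, S.E⟩) * Or =
        idOplus m (((RatFunc.X : RatFunc ℂ) ^ m)⁻¹ • S.transfer) := by
  have hcoeff := matTendsAtInfinity_properCoeff (m := m) (Ac := Ac)
    (SystemMatrix.matTendsAtInfinity_strictlyProperPart hE)
  obtain ⟨Ol, Or, hOl, hOr, h⟩ := exists_biproper_reduction (p := p) hm hcoeff
    (or_iff_not_imp_left.2 ha) tendsAtInfinity_X_inv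
  refine ⟨Ol, Or, hOl, hOr, ?_⟩
  rw [inv_X_smul_transfer_flatCore hm, h, revHorner_properCoeff, ← hP]
  rfl

end BiproperReduction

section StrongLinearization

variable {m n r p Z H g : ℕ} {Ac : ℕ → Matrix (Fin n) (Fin n) ℂ}

lemma SystemMatrix.transfer_mul_mul {ι κ : Type} [Fintype ι] [Fintype κ] [DecidableEq κ]
    (W O : Matrix ι ι ℂ) (P : Matrix ι ι ℂ[X]) (C : Matrix ι κ ℂ) (B : Matrix κ ι ℂ)
    (A E : Matrix κ κ ℂ) :
    SystemMatrix.transfer ⟨constPoly W * P * constPoly O, W * C, B * O, A, E⟩ =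
      constRat W * SystemMatrix.transfer ⟨P, C, B, A, E⟩ * constRat O := by
  simp only [SystemMatrix.transfer, polyRat_mul, polyRat_constPoly, constRat_mul, Matrix.mul_add,
    Matrix.add_mul, Matrix.mul_assoc]

/-- A unimodular equivalence with `diag(I, S(λ))` exhibits the transfer function of `S(λ)` as a
polynomial multiple of that of `T(λ)`, so a smaller realization of the latter would give one of the
former. -/
lemma isIrreducible_of_reduction {G : Matrix (Fin n) (Fin n) (RatFunc ℂ)}
    {S : SystemMatrix (Fin n) (Fin r)} (hmin : S.IsMinimalRealization G)
    {T : SystemMatrix (Fin m × Fin n) (Fin r)} (hm : 0 < m) (hTA : T.A = S.A) (hTE : T.E = S.E)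
    {U V : Matrix (Fin m × Fin n) (Fin m × Fin n) ℂ[X]} (hP : U * T.P * V = idOplus m S.P)
    (hC : U * constPoly T.C = constPoly (blockCol m m S.C))
    (hB : constPoly T.B * V = constPoly (blockRow m m S.B)) : T.IsIrreducible := by
  have hmc : (m : ℤ) = ((⟨m - 1, by omega⟩ : Fin m) : ℕ) + 1 := by simp; omega
  set F : Matrix (Fin n) (Fin m × Fin n) ℂ := blockRow m m 1
  set F' : Matrix (Fin m × Fin n) (Fin n) ℂ := blockCol m m 1
  have hpoly : constPoly F * U * T.P * (V * constPoly F') = S.P := by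
    rw [Matrix.mul_assoc, Matrix.mul_assoc, ← Matrix.mul_assoc T.P, ← Matrix.mul_assoc U,
      ← Matrix.mul_assoc U, hP, constPoly_blockRow, constPoly_blockCol, idOplus_mul_blockCol,
      blockRow_mul_blockCol _ _ hmc, constPoly_one, Matrix.one_mul, Matrix.mul_one]
  have hcol : polyRat (constPoly F * U) * constRat T.C = constRat S.C := by
    rw [← polyRat_constPoly, ← polyRat_mul, Matrix.mul_assoc, hC, ← constPoly_mul,
      blockRow_mul_blockCol _ _ hmc, Matrix.one_mul, polyRat_constPoly]
  have hrow : constRat T.B * polyRat (V * constPoly F') = constRat S.B := by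
    rw [← polyRat_constPoly, ← polyRat_mul, ← Matrix.mul_assoc, hB, ← constPoly_mul,
      blockRow_mul_blockCol _ _ hmc, Matrix.mul_one, polyRat_constPoly]
  have htransfer : polyRat (constPoly F * U) * T.transfer * polyRat (V * constPoly F') = G := by
    rw [← hmin.1.2, SystemMatrix.transfer, SystemMatrix.transfer, hTA, hTE, Matrix.mul_add,
      Matrix.add_mul, ← polyRat_mul, ← polyRat_mul, hpoly, ← hcol, ← hrow]
    simp only [Matrix.mul_assoc]
  refine ⟨⟨by rw [hTE]; exact hmin.1.1, rfl⟩, fun r' T' hT' => ?_⟩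
  obtain ⟨T'', hT''⟩ := exists_realization_mul T' hT'.1 (constPoly F * U) (V * constPoly F')
  rw [hT'.2, htransfer] at hT''
  exact hmin.2 r' T'' hT''

lemma exists_biproper_transfer_reduction (hm : m = g + 1 + 2 * H) (hg : g = p + 2 * Z)
    (ha : p ≠ 0 → (Ac m).det ≠ 0) {ε : Fin m → ℤˣ} {k : Fin m} {k' : ℤ} (hk' : k' = (k : ℕ) + 1)
    (hk : (k : ℕ) + 1 + (if H = 0 then 0 else 1) = m) (hε : ε k = 1)
    {S : SystemMatrix (Fin n) (Fin r)} (hE : S.E.det ≠ 0) (hP : S.P = matPoly m Ac) :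
    ∃ Ol Or : Matrix (Fin m × Fin n) (Fin m × Fin n) (RatFunc ℂ), IsBiproper Ol ∧ IsBiproper Or ∧
      Ol * ((RatFunc.X : RatFunc ℂ)⁻¹ • SystemMatrix.transfer
        ⟨constPoly (quasiIdentity n ε) * congPencil m (revCoeff m Ac) p Z g H, blockCol m k' S.C,
          blockRow m k' S.B, S.A, S.E⟩) * Or =
        idOplus m (((RatFunc.X : RatFunc ℂ) ^ m)⁻¹ • S.transfer) := by
  obtain ⟨Ol, Or, hOl, hOr, h⟩ :=
    exists_biproper_flatCore_reduction (show m = p + 2 * (Z + H) + 1 by omega) ha hE hP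
  have hO := isUnit_flatCong (revCoeff m Ac) hm hg
  rw [← quasiIdentity_mul_flatCong_mul_blockCol (revCoeff m Ac) hm hg hk' hk hε,
    ← blockRow_mul_flatCong (revCoeff m Ac) hm hg hk' hk, congPencil, ← mul_assoc, ← mul_assoc,
    ← constPoly_mul, SystemMatrix.transfer_mul_mul]
  have hWbi := isBiproper_constRat ((isUnit_quasiIdentity (n := n) ε).mul hO)
  have hObi := isBiproper_constRat hO
  set O := flatCong m (revCoeff m Ac) p Z g H
  set W := quasiIdentity n ε * O
  refine ⟨Ol * (constRat W)⁻¹, (constRat O)⁻¹ * Or, hOl.mul hWbi.inv, hObi.inv.mul hOr, ?_⟩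
  rw [← h, ← smul_mul_assoc, ← mul_smul_comm, mul_assoc, mul_assoc Ol, mul_assoc (constRat W),
    mul_assoc (constRat W), Matrix.nonsing_inv_mul_cancel_left _ _ hWbi.isUnit_det,
    mul_assoc, mul_assoc, Matrix.mul_nonsing_inv_cancel_left _ _ hObi.isUnit_det]

lemma blockDiag2_mul_toMatrix_mul {S : SystemMatrix (Fin n) (Fin r)}
    {T : SystemMatrix (Fin m × Fin n) (Fin r)} (hTA : T.A = S.A) (hTE : T.E = S.E)
    {U V : Matrix (Fin m × Fin n) (Fin m × Fin n) ℂ[X]} (hP : U * T.P * V = idOplus m S.P)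
    (hC : U * constPoly T.C = constPoly (blockCol m m S.C))
    (hB : constPoly T.B * V = constPoly (blockRow m m S.B)) :
    blockDiag2 U (constPoly 1) * T.toMatrix * blockDiag2 V (constPoly 1) = idOplusSystem m S := by
  rw [SystemMatrix.toMatrix, blockDiag2, blockDiag2, constPoly_one, Matrix.fromBlocks_multiply,
    Matrix.fromBlocks_multiply, idOplusSystem, ← hP, ← hC, ← hB, hTA, hTE]
  simp only [Matrix.zero_mul, Matrix.mul_zero, add_zero, zero_add, Matrix.one_mul, Matrix.mul_one]

lemma isRosenbrockStrongLinearization_of_sign (hm : m = g + 1 + 2 * H) (hg : g = p + 2 * Z)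
    (ha : p ≠ 0 → (Ac m).det ≠ 0) {ε : Fin m → ℤˣ} {k : Fin m} {k' : ℤ} (hk' : k' = (k : ℕ) + 1)
    (hk : (k : ℕ) + 1 + (if H = 0 then 0 else 1) = m) (hε : ε k = 1)
    {S : SystemMatrix (Fin n) (Fin r)} {G : Matrix (Fin n) (Fin n) (RatFunc ℂ)}
    (hmin : S.IsMinimalRealization G) (hP : S.P = matPoly m Ac) :
    IsRosenbrockStrongLinearization
      (Matrix.fromBlocks
        (constPoly (quasiIdentity n ε) * congPencil m (revCoeff m Ac) p Z g H)
        (constPoly (blockCol m k' S.C)) (constPoly (blockRow m k' S.B)) (pencil (-S.E) S.A))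
      S G := by
  obtain ⟨U, V, hU, hV, hUV, hC, hB⟩ := exists_unimodular_reduction hm hg ha hk' hk hε
  rw [← hP] at hUV
  obtain ⟨Ol, Or, hOl, hOr, h⟩ :=
    exists_biproper_transfer_reduction hm hg ha hk' hk hε hmin.1.1 hP
  rw [hmin.1.2] at h
  have hpencil : ∃ X Y, constPoly (quasiIdentity n ε) * congPencil m (revCoeff m Ac) p Z g H =
      pencil (-Y) X := by
    rw [congPencil_eq_pencil, constPoly_mul_pencil]
    exact ⟨_, -_, by rw [neg_neg]⟩
  generalize constPoly (quasiIdentity n ε) * congPencil m (revCoeff m Ac) p Z g H = P at *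
  let T : SystemMatrix (Fin m × Fin n) (Fin r) :=
    ⟨P, blockCol m k' S.C, blockRow m k' S.B, S.A, S.E⟩
  exact ⟨T, rfl, hpencil, hmin.1.1,
    isIrreducible_of_reduction hmin (by omega) rfl rfl hUV (hC r S.C) (hB r S.B),
    ⟨U, V, 1, 1, isUnimodular_of_isUnit hU, isUnimodular_of_isUnit hV, by simp, by simp,
      blockDiag2_mul_toMatrix_mul (T := T) rfl rfl hUV (hC r S.C) (hB r S.B)⟩,
    Ol, Or, hOl, hOr, h⟩

lemma SystemMatrix.IsMinimalRealization.B_ne_zero {ι : Type} {S : SystemMatrix ι (Fin r)}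
    {G : Matrix ι ι (RatFunc ℂ)} (h : S.IsMinimalRealization G) (hr : 0 < r) : S.B ≠ 0 := by
  intro hB
  have hzero : ∀ κ τ : Type, constRat (0 : Matrix κ τ ℂ) = 0 := fun κ τ => by
    ext1; simp [constRat]
  have hle := h.2 0 ⟨S.P, 0, 0, 0, 1⟩ ⟨by simp, by
    rw [← h.1.2, SystemMatrix.transfer, SystemMatrix.transfer, hB, hzero, hzero, hzero]
    simp⟩
  omega

end StrongLinearization

section BorderedPencil

variable {m n r : ℕ}

lemma IsTOddPoly.neg {ι : Type} {M : Matrix ι ι ℂ[X]} (h : IsTOddPoly M) : IsTOddPoly (-M) := by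
  ext1 i j
  have hij := congrFun (congrFun h i) j
  simp only [Matrix.map_apply, Matrix.transpose_apply, Matrix.neg_apply] at hij ⊢
  rw [Polynomial.neg_comp, hij]

lemma isTOddPoly_quasiIdentity_mul_sign {ε : Fin m → ℤˣ}
    {L : Matrix (Fin m × Fin n) (Fin m × Fin n) ℂ[X]}
    (h : IsTOddPoly (constPoly (quasiIdentity n ε) * L)) (δ : ℤˣ) :
    IsTOddPoly (constPoly (quasiIdentity n fun s => δ * ε s) * L) := by
  rcases Int.units_eq_one_or δ with rfl | rfl
  · simpa using h
  · simp only [neg_mul, one_mul, quasiIdentity_neg, constPoly_neg]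
    exact h.neg

lemma quasiIdentity_eq_or_eq_neg {ε ε' : Fin m → ℤˣ} (h : ∃ δ : ℤˣ, ∀ s, ε' s = δ * ε s) :
    quasiIdentity n ε' = quasiIdentity n ε ∨ quasiIdentity n ε' = -quasiIdentity n ε := by
  obtain ⟨δ, hδ⟩ := h
  rw [funext hδ]
  rcases Int.units_eq_one_or δ with rfl | rfl <;> simp [quasiIdentity_neg]

lemma extQuasiIdentity_congr {ε ε' : Fin m → ℤˣ} (h : ∃ δ : ℤˣ, ∀ s, ε' s = δ * ε s)
    (k : Fin m) :
    extQuasiIdentity n r (ε' k) ε' = extQuasiIdentity n r (ε k) ε := by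
  obtain ⟨δ, hδ⟩ := h
  have hsign : ∀ s, ε' k * ε' s = ε k * ε s := fun s => by
    rw [hδ, hδ, mul_mul_mul_comm, Int.units_mul_self, one_mul]
  rw [extQuasiIdentity, extQuasiIdentity, smul_quasiIdentity, smul_quasiIdentity, funext hsign]

lemma eq_one_of_smul_transpose_eq {B : Matrix (Fin r) (Fin n) ℂ} (hB : B ≠ 0) {δ : ℤˣ}
    (h : ((δ : ℤ) : ℂ) • Bᵀ = Bᵀ) : δ = 1 := by
  refine (Int.units_eq_one_or δ).resolve_right fun hδ => hB ?_
  rw [hδ] at h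
  ext x y
  simpa [neg_eq_self] using congrFun (congrFun h y) x

/-- The block form of the pencil `𝕃(λ)` over `L(λ)`, with `B` in the block position `k'`. -/
noncomputable def borderedPencil (L : Matrix (Fin m × Fin n) (Fin m × Fin n) ℂ[X]) (k' : ℤ)
    (B : Matrix (Fin r) (Fin n) ℂ) (A : Matrix (Fin r) (Fin r) ℂ) :
    Matrix ((Fin m × Fin n) ⊕ Fin r) ((Fin m × Fin n) ⊕ Fin r) ℂ[X] :=
  Matrix.fromBlocks L (constPoly (-blockCol m k' Bᵀ)) (constPoly (blockRow m k' B)) (pencil 1 (-A))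

variable {k : Fin m} {k' : ℤ} {L : Matrix (Fin m × Fin n) (Fin m × Fin n) ℂ[X]}
  {B : Matrix (Fin r) (Fin n) ℂ} {A : Matrix (Fin r) (Fin r) ℂ}

lemma extQuasiIdentity_mul_borderedPencil (hk' : k' = (k : ℕ) + 1) (δ : ℤˣ) (ε : Fin m → ℤˣ) :
    constPoly (extQuasiIdentity n r δ ε) * borderedPencil L k' B A =
      Matrix.fromBlocks (constPoly (quasiIdentity n fun s => δ * ε s) * L)
        (constPoly (-blockCol m k' ((((δ * ε k : ℤˣ) : ℤ) : ℂ) • Bᵀ)))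
        (constPoly (blockRow m k' B)) (pencil 1 (-A)) := by
  have hsmul : ∀ c : ℂ, c • blockCol m k' Bᵀ = blockCol m k' (c • Bᵀ) := fun c => by
    ext a b
    simp [blockCol]
  rw [borderedPencil, extQuasiIdentity, constPoly_blockDiag2, smul_quasiIdentity, blockDiag2,
    Matrix.fromBlocks_multiply, constPoly_one]
  simp only [Matrix.zero_mul, add_zero, zero_add, Matrix.one_mul]
  rw [← constPoly_mul, Matrix.mul_neg, quasiIdentity_mul_blockCol _ hk', hsmul]

lemma extQuasiIdentity_mul_borderedPencil_self (hk' : k' = (k : ℕ) + 1) (ε : Fin m → ℤˣ) :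
    constPoly (extQuasiIdentity n r (ε k) ε) * borderedPencil L k' B A =
      borderedPencil (constPoly (quasiIdentity n fun s => ε k * ε s) * L) k' B A := by
  rw [extQuasiIdentity_mul_borderedPencil hk', Int.units_mul_self, Units.val_one, Int.cast_one,
    one_smul, borderedPencil]

lemma isTOddPoly_extQuasiIdentity_mul_iff (hk' : k' = (k : ℕ) + 1) (hA : IsTOddPoly (pencil 1 (-A)))
    (δ : ℤˣ) (ε : Fin m → ℤˣ) :
    IsTOddPoly (constPoly (extQuasiIdentity n r δ ε) * borderedPencil L k' B A) ↔
      IsTOddPoly (constPoly (quasiIdentity n fun s => δ * ε s) * L) ∧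
        (((δ * ε k : ℤˣ) : ℤ) : ℂ) • Bᵀ = Bᵀ := by
  rw [extQuasiIdentity_mul_borderedPencil hk', isTOddPoly_fromBlocks, neg_inj, blockCol_transpose]
  exact ⟨fun h => ⟨h.1, blockCol_injective hk' h.2.2⟩, fun h => ⟨h.1, hA, by rw [h.2]⟩⟩

lemma isTOddPoly_extQuasiIdentity_self_iff (hk' : k' = (k : ℕ) + 1)
    (hA : IsTOddPoly (pencil 1 (-A))) (ε : Fin m → ℤˣ) :
    IsTOddPoly (constPoly (extQuasiIdentity n r (ε k) ε) * borderedPencil L k' B A) ↔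
      IsTOddPoly (constPoly (quasiIdentity n ε) * L) := by
  rw [isTOddPoly_extQuasiIdentity_mul_iff hk' hA, Int.units_mul_self, Units.val_one, Int.cast_one,
    one_smul, and_iff_left rfl]
  refine ⟨fun h => ?_, fun h => isTOddPoly_quasiIdentity_mul_sign h _⟩
  simpa [← mul_assoc, Int.units_mul_self] using isTOddPoly_quasiIdentity_mul_sign h (ε k)

lemma extQuasiIdentity_one_eq_of_isTOddPoly (hk' : k' = (k : ℕ) + 1)
    (hA : IsTOddPoly (pencil 1 (-A))) (hB : B ≠ 0) {ε : Fin m → ℤˣ}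
    (h : IsTOddPoly (constPoly (extQuasiIdentity n r 1 ε) * borderedPencil L k' B A)) :
    extQuasiIdentity n r 1 ε = extQuasiIdentity n r (ε k) ε := by
  have hone :=
    eq_one_of_smul_transpose_eq hB ((isTOddPoly_extQuasiIdentity_mul_iff hk' hA _ _).1 h).2
  rw [one_mul] at hone
  rw [hone]

lemma isTOddRat_transfer (k' : ℤ) (hA : IsTOddPoly (pencil 1 (-A))) (hL : IsTOddPoly L) :
    IsTOddRat (polyRat L + constRat (blockCol m k' Bᵀ) * (polyRat (pencil 1 (-A)))⁻¹ *
      constRat (blockRow m k' B)) :=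
  hL.polyRat.add ((hA.polyRat.inv (isUnit_det_polyRat_pencil (by simp) _)).congr (blockRow m k' B))

end BorderedPencil

section Parameters

lemma exists_parameters {m h q p : ℕ} {w z : List ℤ} (hhm : h < m) (hh : Even h)
    (hq : q = 0 ∨ q = 1) (hw : IsAdmissibleTuple h q w)
    (hz : IsAdmissibleTuple (m - h - 1) p (shiftTuple m z)) :
    ∃ (H Z g : ℕ) (k : Fin m), h = 2 * H ∧ q = 0 ∧ m - h - 1 = g ∧ m = g + 1 + 2 * H ∧
      g = p + 2 * Z ∧ w = admissibleTuple (2 * H) 0 ∧ shiftTuple m z = admissibleTuple g p ∧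
      (k : ℕ) + 1 + (if H = 0 then 0 else 1) = m ∧
      (m : ℤ) - inversionsAt 0 w = (k : ℕ) + 1 := by
  obtain ⟨H, rfl⟩ := hh.two_dvd
  obtain ⟨hqh, ⟨x, hx⟩, rfl⟩ := hw
  obtain ⟨hpg, ⟨Z, hZ⟩, hz⟩ := hz
  obtain rfl : q = 0 := by omega
  refine ⟨H, Z, _, ⟨m - 1 - (if H = 0 then 0 else 1), by omega⟩, rfl, rfl, rfl, by omega, by omega,
    rfl, hz, ?_, ?_⟩
  · simp only
    split_ifs <;> omega
  · rw [inversionsAt_admissibleTuple]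
    simp only
    split_ifs <;> omega

end Parameters

theorem theorem4p18 {n m r : ℕ}
    (G : Matrix (Fin n) (Fin n) (RatFunc ℂ)) (hG : IsTOddRat G)
    -- a minimal `T`-odd realization `G(λ) = P(λ) + Bᵀ (λ I_r - A)⁻¹ B`, `P(λ) = ∑_{j ≤ m} λ^j A_j`,
    -- with system matrix `S(λ) = [P(λ), -Bᵀ; B, λ I_r - A]`
    (Ac : ℕ → Matrix (Fin n) (Fin n) ℂ) (hm : Ac m ≠ 0)
    (B : Matrix (Fin r) (Fin n) ℂ) (A : Matrix (Fin r) (Fin r) ℂ)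
    (S : SystemMatrix (Fin n) (Fin r))
    (hS : S = { P := matPoly m Ac, C := -Bᵀ, B := B, A := -A, E := -1 })
    (hmin : S.IsMinimalRealization G)
    (hP : IsTOddPoly (matPoly m Ac)) (hA : IsTOddPoly (pencil 1 (-A)))
    -- `h` is even, `w` is the simple admissible tuple of `{0:h}`, and `c_w` its symmetric complement
    (h : ℕ) (hhm : h < m) (hh : Even h)
    (q : ℕ) (hq : q = 0 ∨ q = 1) (w : List ℤ) (hw : IsAdmissibleTuple h q w)
    (cw : List ℤ) (hcw : cw = symmComplement h q)
    -- `z + m` is an admissible tuple of `{0:m-h-1}` of index `p`, `c_z + m` its symmetric complement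
    (p : ℕ) (z : List ℤ) (hz : IsAdmissibleTuple (m - h - 1) p (shiftTuple m z))
    (cz : List ℤ) (hcz : shiftTuple m cz = symmComplement (m - h - 1) p)
    (L : Matrix (Fin m × Fin n) (Fin m × Fin n) ℂ[X]) (hL : L = gfprP m Ac w cw z cz)
    (LL : Matrix ((Fin m × Fin n) ⊕ Fin r) ((Fin m × Fin n) ⊕ Fin r) ℂ[X])
    (hLL : LL = gfprS m Ac S.C S.B S.A S.E w cw z cz) :
    -- `k = m - i_0(w)` is a block number
    ∃ k : Fin m, ((k : ℕ) : ℤ) + 1 = m - inversionsAt 0 w ∧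
    -- `Q`, with parameters `ε`, is the quasi-identity matrix, unique up to sign, making `L` `T`-odd
    ∃ ε : Fin m → ℤˣ,
      IsTOddPoly (constPoly (quasiIdentity n ε) * L) ∧
      (∀ ε' : Fin m → ℤˣ, IsTOddPoly (constPoly (quasiIdentity n ε') * L) →
        quasiIdentity n ε' = quasiIdentity n ε ∨ quasiIdentity n ε' = -quasiIdentity n ε) ∧
      -- the block form of `diag(𝐬 Q, I_r) 𝕃(λ)`, with `𝐬` the `k`-th parameter of `Q`
      constPoly (extQuasiIdentity n r (ε k) ε) * LL =
        Matrix.fromBlocks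
          (constPoly ((((ε k : ℤˣ) : ℤ) : ℂ) • quasiIdentity n ε) * L)
          (constPoly (-blockCol m (m - inversionsAt 0 w) Bᵀ))
          (constPoly (blockRow m (m - inversionsAt 0 w) B))
          (pencil 1 (-A)) ∧
      IsTOddPoly (constPoly (extQuasiIdentity n r (ε k) ε) * LL) ∧
      -- uniqueness of `diag(𝐬 Q, I_r)`
      (∀ ε' : Fin m → ℤˣ, IsTOddPoly (constPoly (extQuasiIdentity n r (ε' k) ε') * LL) →
        extQuasiIdentity n r (ε' k) ε' = extQuasiIdentity n r (ε k) ε) ∧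
      (0 < r → ∀ ε' : Fin m → ℤˣ, IsTOddPoly (constPoly (extQuasiIdentity n r 1 ε') * LL) →
        extQuasiIdentity n r 1 ε' = extQuasiIdentity n r (ε k) ε) ∧
      -- strong linearization
      (((Ac m).det = 0 → p = 0) →
        IsRosenbrockStrongLinearization (constPoly (extQuasiIdentity n r (ε k) ε) * LL) S G) ∧
      -- the transfer function
      IsTOddRat (polyRat (constPoly ((((ε k : ℤˣ) : ℤ) : ℂ) • quasiIdentity n ε) * L) +
        constRat (blockCol m (m - inversionsAt 0 w) Bᵀ) * (polyRat (pencil 1 (-A)))⁻¹ *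
          constRat (blockRow m (m - inversionsAt 0 w) B)) := by
  obtain ⟨H, Z, g, k, rfl, rfl, hg, hmg, hgp, rfl, hz, hk, hk'⟩ :=
    exists_parameters hhm hh hq hw hz
  rw [hg] at hcz
  subst hS hcw hL hLL
  rw [gfprP_eq Ac hmg hgp hz hcz, gfprS_eq Ac hmg hgp hz hcz B A hk' hk, ← borderedPencil]
  obtain ⟨ε, hodd⟩ : ∃ ε : Fin m → ℤˣ, IsTOddPoly (constPoly (quasiIdentity n ε) *
      congPencil m (revCoeff m Ac) p Z g H) :=
    ⟨_, isTOddPoly_congPencil hmg hgp (transpose_revCoeff hP)⟩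
  have huniq ε' := exists_eq_mul_of_isTOddPoly_congPencil (ε' := ε') hmg hgp
    (by simpa [revCoeff] using hm) hodd
  have hext ε' h := huniq ε' ((isTOddPoly_extQuasiIdentity_self_iff (B := B) hk' hA ε').1 h)
  refine ⟨k, hk'.symm, ε, hodd, fun ε' h => quasiIdentity_eq_or_eq_neg (huniq ε' h), ?_,
    (isTOddPoly_extQuasiIdentity_self_iff hk' hA ε).2 hodd,
    fun ε' h => extQuasiIdentity_congr (hext ε' h) k, fun hr ε' h => ?_, fun ha => ?_, ?_⟩
  · rw [smul_quasiIdentity, extQuasiIdentity_mul_borderedPencil_self hk', borderedPencil]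
  · have hone := extQuasiIdentity_one_eq_of_isTOddPoly hk' hA (hmin.B_ne_zero hr) h
    exact hone.trans (extQuasiIdentity_congr (hext ε' (hone ▸ h)) k)
  · have hstrong := isRosenbrockStrongLinearization_of_sign hmg hgp (fun hp hdet => hp (ha hdet))
      hk' hk (ε := fun s => ε k * ε s) (Int.units_mul_self (ε k)) hmin rfl
    rw [neg_neg, blockCol_neg] at hstrong
    rwa [extQuasiIdentity_mul_borderedPencil_self hk']
  · rw [smul_quasiIdentity]
    exact isTOddRat_transfer _ hA (isTOddPoly_quasiIdentity_mul_sign hodd _)
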